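/- **Types and terms.** EAL formulas are $A::=\alpha\mid A\multimap A\mid\;!A$ with $\alpha$ a type variable. A basis is a finite set of declarations $x:A$ in which each variable is declared at most once. $\Gamma\vdash M:A$ is derived for $\lambda$-terms $M$ (modulo $\alpha$-equivalence) by the sequent rules of implicational Elementary Affine Logic: (ax) $x:A\vdash x:A$; (cut) from $\Gamma\vdash N:A$ and $x:A,\Delta\vdash M:B$ infer $\Gamma,\Delta\vdash M\{N/x\}:B$; (weak) from $\Gamma\vdash M:B$ infer $\Gamma,x:A\vdash M:B$; (contr) from $\Gamma,x_1:!A,x_2:!A\vdash M:B$ infer $\Gamma,z:!A\vdash M\{z/x_1,z/x_2\}:B$; ($\multimap R$) from $\Gamma,x:A\vdash M:B$ infer $\Gamma\vdash\lambda x.M:A\multimap B$; ($\multimap L$) from $\Gamma\vdash N:A$ and $x:B,\Delta\vdash M:C$ infer $\Gamma,f:A\multimap B,\Delta\vdash M\{(f\,N)/x\}:C$; (!) from $x_1:A_1,\dots,x_n:A_n\vdash M:B$ infer $x_1:!A_1,\dots,x_n:!A_n\vdash M:!B$. The sharing graph of a derivation is the syntax tree built along the derivation in which each contraction is an explicit fan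 node with two auxiliary ports. We write $\Gamma\vdash_{\mathrm{EAL}}M:A$ if there is a derivation of $\Gamma\vdash M:A$ whose sharing graph has fans sharing only variables, i.e. no fan faces the root of a subgraph (an application or abstraction node). **General types.** $\Theta::=\;!^{n_1+\cdots+n_k}\alpha\mid\;!^{n_1+\cdots+n_k}(\Theta\multimap\Theta)$, $k\ge0$, where the $n_i$ are variables ranging over $\mathbb N$; $!^{n}(!^{m}\Theta)$ is identified with $!^{n+m}\Theta$. $X(\Theta)$ is the instantiation of the $n_i$ by $X$. **The algorithm** $\mathscr S(M:\sigma)=\langle\Theta,B,A\rangle$ is defined on a simple type derivation of $M:\sigma$, all new variables $p,b,c,n$ being fresh. * $\mathcal P(\alpha)=\,!^p\alpha$, $\mathcal P(\sigma\to\tau)=\,!^p(\mathcal P(\sigma)\multimap\mathcal P(\tau))$. * $\mathcal U(\Theta_1,\dots,\Theta_h)$, for general types of the same shape, is the set of equations between the exponents of $\Theta_i$ and $\Theta_{i+1}$ at corresponding positions, the first row being the one for the outermost exponents; $\mathcal C(\Theta)=\emptyset$, and for $h\ge2$, $\mathcal C(\Theta_1,\dots,\Theta_h)$ is $\mathcal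 U(\Theta_1,\dots,\Theta_h)$ together with the constraint that the outermost exponent of $\Theta_1$ is $\ge1$. * A critical point is a pair (equation, list of free variable occurrences); a slice is a set of critical points; $cpts$ denotes a set of slices. An occurrence $x$ or an equation belongs to a slice if it belongs to one of its critical points. If an equation $E=0$ is replaced by $E-c=0$, the slices containing it refer to the new equation. * $\mathcal B(B,\Gamma,cpts,A)$ performs, for each slice $sl\in cpts$ in turn, with a fresh $c$: replace $\Gamma$ by $!^c\Gamma$; replace $x:\Theta$ in $B$ by $x:!^c\Theta$ unless the occurrence $x$ is in $sl$; replace each equation $E=0$ of $A$ that is in $sl$ by $E-c=0$. $\mathbb B(M,B,\Gamma,cpts,A)=\langle B,\Gamma,A\rangle$ if $M$ is a variable, and $\langle!^bB_1,!^b\Gamma_1,A_1\rangle$ with $\langle B_1,\Gamma_1,A_1\rangle=\mathcal B(B,\Gamma,cpts,A)$ otherwise. * $P\Cup Q=P\cup Q\cup\{s\cup t: s\in P,t\in Q\}$. * $\mathcal S(x:\sigma)=\langle\Theta,\{x:\Theta\},\emptyset,\emptyset\rangle$ with $\Theta=\mathcal P(\sigma)$ (bases are multisets with one entry per free occurrence).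 * $\mathcal S(\lambda x.M:\sigma\to\tau)$: let $\mathcal S(M:\tau)=\langle\Gamma_1,B_1,A_1,cpts\rangle$ and $\mathbb B(M,B_1,\Gamma_1,cpts,A_1)=\langle B',\Gamma,A_2\rangle$. If $x\in FV(M)$, let $x:\Theta_1,\dots,x:\Theta_h$ be the entries for $x$ in $B'$ and $B$ the rest; the result is $\langle\Theta_1\multimap\Gamma,\,B,\,A_2\cup\mathcal C(\Theta_1,\dots,\Theta_h),\,cpts'\rangle$, where $cpts'$ consists of the slices of $cpts$ containing no occurrence of $x$. If $x\notin FV(M)$ and $M$ is not an application, the result is $\langle\mathcal P(\sigma)\multimap\Gamma,B',A_2,cpts\rangle$. If $x\notin FV(M)$ and $M$ is an application, write $\Gamma=\,!^{\sum n_i}\Gamma'$ with $\sum n_i$ its whole outermost exponent; the result is $\langle\mathcal P(\sigma)\multimap\,!^n\Gamma',\,B',\,A_2\cup\{\sum n_i-n=0\},\,cpts\cup\{\{(\sum n_i-n=0,FVO(M))\}\}\rangle$, where $FVO(M)$ lists the free variable occurrences of $M$. * $\mathcal S((M\,N):\tau)$: let $\mathcal S(M:\sigma\to\tau)=\langle!^{\sum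 n_i}(\Theta_1\multimap\Gamma),B_1,A_1,cpts_1\rangle$, $\mathcal S(N:\sigma)=\langle\Theta_2,B_2,A_2,cpts_2\rangle$, $\mathbb B(N,B_2,\Theta_2,cpts_2,A_2)=\langle B_3,\Theta_3,A_3\rangle$ and $A_4=\mathcal U(\Theta_3,\Theta_1)$ with first row $A_4^1$. The result is $\langle\Gamma,\,B_1\cup B_3,\,A_1\cup A_3\cup A_4\cup\{\sum n_i=0\},\,cpts_1'\Cup cpts_2'\rangle$, where $cpts_1'=cpts_1\cup\{\{(\sum n_i=0,FVO(M))\}\}$ if $M$ is an application and $cpts_1'=cpts_1$ otherwise, and $cpts_2'=cpts_2\cup\{\{(A_4^1,FVO(N))\}\}$ if $N$ is an application and $cpts_2'=cpts_2$ otherwise. * $\mathscr S(M:\sigma)$: let $\mathcal S(M:\sigma)=\langle\Theta_1,B_1,A',cpts\rangle$ and $\mathbb B(M,B_1,\Theta_1,cpts,A')=\langle B_2,\Theta,A''\rangle$. For each free variable $x$ of $M$ with entries $x:\Theta_{1},\dots,x:\Theta_{k}$ in $B_2$, the base $B$ contains the single declaration $x:\Theta_1$; $A$ is $A''$ together with all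 the constraints $\mathcal C(\Theta_1,\dots,\Theta_k)$, one set for each $x$. **Statement.** Let $M$ be a simply typeable $\lambda$-term and let $\sigma$ (together with the simple types of the free variables of $M$) be its principal type schema. For every basis $\Gamma$ and every EAL formula $C$: $\Gamma\vdash_{\mathrm{EAL}}M:C$ if and only if $\mathscr S(M:\sigma)=\langle\Theta,B,A\rangle$, $A$ has a solution $X$ in the natural numbers, and there is a substitution $S$ from type variables to EAL formulas such that $S(X(B))\subseteq\Gamma$ and $S(X(\Theta))=C$. -/

import Mathlib

namespace EAL

/-! ### Types -/

/-- Simple types over type variables. -/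
inductive Ty : Type
  | var (a : ℕ)
  | arr (σ τ : Ty)

/-- Substitution of simple types for type variables. -/
def Ty.subst (s : ℕ → Ty) : Ty → Ty
  | .var a => s a
  | .arr σ τ => .arr (σ.subst s) (τ.subst s)

/-- EAL formulas: type variables, `A ⊸ B` and `!A`. -/
inductive Fm : Type
  | var (a : ℕ)
  | limp (A B : Fm)
  | bang (A : Fm)

/-- Substitution of EAL formulas for type variables. -/
def Fm.subst (S : ℕ → Fm) : Fm → Fm
  | .var a => S a
  | .limp A B => .limp (A.subst S) (B.subst S)
  | .bang A => .bang (A.subst S)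

/-- General EAL-types `!^{n₁+⋯+nₖ} α` and `!^{n₁+⋯+nₖ} (Θ ⊸ Δ)`. The list `[n₁, …, nₖ]` names
variables that range over the natural numbers. -/
inductive GTy : Type
  | var (ns : List ℕ) (a : ℕ)
  | limp (ns : List ℕ) (Θ Δ : GTy)

/-- The outermost exponent of a general type. -/
def GTy.exps : GTy → List ℕ
  | .var ns _ => ns
  | .limp ns _ _ => ns

/-- Replace the outermost exponent of a general type. -/
def GTy.setExps (ms : List ℕ) : GTy → GTy
  | .var _ a => .var ms a
  | .limp _ Θ Δ => .limp ms Θ Δ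

/-- `!^c Θ`, where `!^c (!^{n₁+⋯+nₖ} Θ')` is identified with `!^{c+n₁+⋯+nₖ} Θ'`. -/
def GTy.bang (c : ℕ) (Θ : GTy) : GTy := Θ.setExps (c :: Θ.exps)

/-- The sum of the values of a list of variables. -/
def sumOf (X : ℕ → ℕ) (ns : List ℕ) : ℕ := (ns.map X).sum

/-- The instantiation `X(Θ)`. -/
def GTy.inst (X : ℕ → ℕ) : GTy → Fm
  | .var ns a => Fm.bang^[sumOf X ns] (.var a)
  | .limp ns Θ Δ => Fm.bang^[sumOf X ns] (.limp (Θ.inst X) (Δ.inst X))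

/-! ### Terms

Type-free terms are λ-terms modulo α-equivalence, in locally nameless form: free variables have
names (`fvar`), bound variables are de Bruijn indices (`bvar`). -/

inductive Tm : Type
  | fvar (x : ℕ)
  | bvar (k : ℕ)
  | lam (M : Tm)
  | app (M N : Tm)

/-- The free variables. -/
def Tm.fv : Tm → Finset ℕ
  | .fvar x => {x}
  | .bvar _ => ∅
  | .lam M => M.fv
  | .app M N => M.fv ∪ N.fv

/-- `M{N/x}` (used for terms `N` without dangling indices, so nothing is captured). -/
def Tm.subst : Tm → ℕ → Tm → Tm
  | .fvar y, x, N => if y = x then N else .fvar y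
  | .bvar k, _, _ => .bvar k
  | .lam M, x, N => .lam (M.subst x N)
  | .app M P, x, N => .app (M.subst x N) (P.subst x N)

/-- Turn the free variable `x` into the bound variable with index `k`; thus `λx.M` is
`lam (M.close x 0)`. -/
def Tm.close (x : ℕ) : ℕ → Tm → Tm
  | k, .fvar y => if y = x then .bvar k else .fvar y
  | _, .bvar j => .bvar j
  | k, .lam M => .lam (M.close x (k + 1))
  | k, .app M N => .app (M.close x k) (N.close x k)

/-! ### Sharing graphs

A sharing graph is written as a term in which every variable is used linearly and sharing is made
explicit by fan nodes: `fan P Q` is `Q` with a fan whose principal port is attached to the root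
of `P` and whose two auxiliary ports are the variables `bvar 0` and `bvar 1` of `Q`. -/

inductive Graph : Type
  | fvar (x : ℕ)
  | bvar (k : ℕ)
  | lam (G : Graph)
  | app (G H : Graph)
  | fan (P Q : Graph)

/-- Plug the graph `N` into the free wire `x`. -/
def Graph.subst : Graph → ℕ → Graph → Graph
  | .fvar y, x, N => if y = x then N else .fvar y
  | .bvar k, _, _ => .bvar k
  | .lam G, x, N => .lam (G.subst x N)
  | .app G H, x, N => .app (G.subst x N) (H.subst x N)
  | .fan P Q, x, N => .fan (P.subst x N) (Q.subst x N)

/-- Turn the free wire `x` into the bound wire with index `k`. -/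
def Graph.close (x : ℕ) : ℕ → Graph → Graph
  | k, .fvar y => if y = x then .bvar k else .fvar y
  | _, .bvar j => .bvar j
  | k, .lam G => .lam (G.close x (k + 1))
  | k, .app G H => .app (G.close x k) (H.close x k)
  | k, .fan P Q => .fan (P.close x k) (Q.close x (k + 2))

/-- The root of the graph is an application node or an abstraction node
(and not the wire of a variable). -/
def Graph.RootIsNode : Graph → Prop
  | .fvar _ => False
  | .bvar _ => False
  | .lam _ => True
  | .app _ _ => True
  | .fan _ Q => Q.RootIsNode

/-- Fans share only variables: no fan faces the root of an application or of an abstraction. -/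
def Graph.FansShareVars : Graph → Prop
  | .fvar _ => True
  | .bvar _ => True
  | .lam G => G.FansShareVars
  | .app G H => G.FansShareVars ∧ H.FansShareVars
  | .fan P Q => ¬ P.RootIsNode ∧ P.FansShareVars ∧ Q.FansShareVars

/-! ### Elementary Affine Logic -/

/-- A basis: a finite collection of declarations `x : A`. -/
abbrev Basis : Type := Multiset (ℕ × Fm)

def Basis.dom (Γ : Basis) : Multiset ℕ := Γ.map Prod.fst

/-- In a (linear) basis a variable is declared at most once. -/
def Basis.Linear (Γ : Basis) : Prop := Γ.dom.Nodup

/-- `Seq Γ M G A`: there is a derivation of `Γ ⊢ M : A` in the (implicational) sequent calculus of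
Elementary Affine Logic whose sharing graph is `G`. -/
inductive Seq : Basis → Tm → Graph → Fm → Prop
  | ax (x : ℕ) (A : Fm) : Seq {(x, A)} (.fvar x) (.fvar x) A
  | cut {Γ Δ : Basis} {x : ℕ} {N M : Tm} {H G : Graph} {A B : Fm}
      (hN : Seq Γ N H A) (hM : Seq ((x, A) ::ₘ Δ) M G B) (hl : (Γ + Δ).Linear) :
      Seq (Γ + Δ) (M.subst x N) (G.subst x H) B
  | weak {Γ : Basis} {x : ℕ} {M : Tm} {G : Graph} {A B : Fm}
      (hM : Seq Γ M G B) (hx : x ∉ Γ.dom) : Seq ((x, A) ::ₘ Γ) M G B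
  | contr {Γ : Basis} {x₁ x₂ z : ℕ} {M : Tm} {G : Graph} {A B : Fm}
      (hM : Seq ((x₁, .bang A) ::ₘ (x₂, .bang A) ::ₘ Γ) M G B) (hz : z ∉ Γ.dom) :
      Seq ((z, .bang A) ::ₘ Γ) ((M.subst x₁ (.fvar z)).subst x₂ (.fvar z))
        (.fan (.fvar z) ((G.close x₁ 0).close x₂ 1)) B
  | limpR {Γ : Basis} {x : ℕ} {M : Tm} {G : Graph} {A B : Fm}
      (hM : Seq ((x, A) ::ₘ Γ) M G B) :
      Seq Γ (.lam (M.close x 0)) (.lam (G.close x 0)) (.limp A B)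
  | limpL {Γ Δ : Basis} {f x : ℕ} {N M : Tm} {H G : Graph} {A B C : Fm}
      (hN : Seq Γ N H A) (hM : Seq ((x, B) ::ₘ Δ) M G C)
      (hl : Basis.Linear ((f, .limp A B) ::ₘ (Γ + Δ))) :
      Seq ((f, .limp A B) ::ₘ (Γ + Δ)) (M.subst x (.app (.fvar f) N))
        (G.subst x (.app (.fvar f) H)) C
  | bang {Γ : Basis} {M : Tm} {G : Graph} {B : Fm} (hM : Seq Γ M G B) :
      Seq (Γ.map fun p => (p.1, .bang p.2)) M G (.bang B)

/-- `Γ ⊢_EAL M : A`: some derivation of `Γ ⊢ M : A` has a sharing graph in which fans share only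
variables. -/
def Typed (Γ : Basis) (M : Tm) (A : Fm) : Prop :=
  ∃ G : Graph, Seq Γ M G A ∧ G.FansShareVars

/-! ### Simple types -/

/-- λ-terms whose abstractions carry the simple type of the bound variable. Together with types for
the free variables, such a term determines a simple type derivation. -/
inductive CTm : Type
  | fvar (x : ℕ)
  | bvar (k : ℕ)
  | lam (σ : Ty) (M : CTm)
  | app (M N : CTm)

/-- The underlying type-free term. -/
def CTm.erase : CTm → Tm
  | .fvar x => .fvar x
  | .bvar k => .bvar k
  | .lam _ M => .lam M.erase
  | .app M N => .app M.erase N.erase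

/-- `HasType ρ Δ D σ`: `D` encodes a simple type derivation with conclusion `σ`, where `ρ` gives
the types of the free variables and `Δ` those of the dangling indices. -/
inductive HasType (ρ : ℕ → Ty) : List Ty → CTm → Ty → Prop
  | fvar (Δ : List Ty) (x : ℕ) : HasType ρ Δ (.fvar x) (ρ x)
  | bvar {Δ : List Ty} {k : ℕ} {σ : Ty} (h : Δ[k]? = some σ) : HasType ρ Δ (.bvar k) σ
  | lam {Δ : List Ty} {σ τ : Ty} {M : CTm} (h : HasType ρ (σ :: Δ) M τ) :
      HasType ρ Δ (.lam σ M) (.arr σ τ)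
  | app {Δ : List Ty} {σ τ : Ty} {M N : CTm} (hM : HasType ρ Δ M (.arr σ τ))
      (hN : HasType ρ Δ N σ) : HasType ρ Δ (.app M N) τ

/-- `D` is a simple type derivation of `ρ ⊢ M : σ`. -/
def IsSimpleDerivation (ρ : ℕ → Ty) (D : CTm) (M : Tm) (σ : Ty) : Prop :=
  D.erase = M ∧ HasType ρ [] D σ

/-- `M` is simply typeable and `σ`, together with the types `ρ` of the free variables of `M`, is
its principal type schema: every simple typing of `M` is a substitution instance of it. -/
def IsPrincipal (M : Tm) (ρ : ℕ → Ty) (σ : Ty) : Prop :=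
  (∃ D, IsSimpleDerivation ρ D M σ) ∧
    ∀ (ρ' : ℕ → Ty) (τ : Ty) (D' : CTm), IsSimpleDerivation ρ' D' M τ →
      ∃ s : ℕ → Ty, σ.subst s = τ ∧ ∀ x ∈ M.fv, (ρ x).subst s = ρ' x

/-! ### The type synthesis algorithm

Fresh names are taken from a counter. It supplies the variables ranging over the natural numbers,
the labels of those rows (constraints) that occur in slices, and the labels of the occurrences of
the term variables. -/

/-- A linear constraint: `eqn row pos neg` is `∑ pos - ∑ neg = 0`, and `geOne ns` is `∑ ns ≥ 1`.
Slices refer to an equation by its label `row`; an equation that no slice refers to needs none. -/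
inductive Constraint : Type
  | eqn (row : Option ℕ) (pos neg : List ℕ)
  | geOne (ns : List ℕ)

/-- `X`, with values in the natural numbers, satisfies the constraint. -/
def Constraint.Holds (X : ℕ → ℕ) : Constraint → Prop
  | .eqn _ pos neg => sumOf X pos = sumOf X neg
  | .geOne ns => 1 ≤ sumOf X ns

/-- A critical point: an equation, given by its label, and a list of occurrences of variables. A
slice is a set of critical points. -/
abbrev Slice : Type := List (ℕ × List ℕ)

/-- `x ∈ sl` for an occurrence `x` of a variable. -/
def Slice.hasOcc (sl : Slice) (occ : ℕ) : Bool := sl.any fun p => p.2.contains occ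

/-- `Aʲ ∈ sl` for the equation with the given label. -/
def Slice.hasRow (sl : Slice) (row : ℕ) : Bool := sl.any fun p => p.1 == row

/-- `Aʲ - c` if `Aʲ ∈ sl`, and `Aʲ` otherwise. -/
def Constraint.boxSlice (sl : Slice) (c : ℕ) : Constraint → Constraint
  | .eqn (some r) pos neg => .eqn (some r) pos (if sl.hasRow r then c :: neg else neg)
  | .eqn none pos neg => .eqn none pos neg
  | .geOne ns => .geOne ns

/-- A term variable: a free variable or a dangling index. -/
inductive Name : Type
  | free (x : ℕ)
  | bound (k : ℕ)

/-- An element `x : Θ` of the (multiset) base, for one occurrence `occ` of `x`. -/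
structure Entry : Type where
  occ : ℕ
  name : Name
  ty : GTy

def Entry.bang (c : ℕ) (e : Entry) : Entry := { e with ty := e.ty.bang c }

/-- Does the entry belong to the index `0`, the variable bound by the next abstraction? -/
def Entry.isZero (e : Entry) : Bool :=
  match e.name with
  | .bound 0 => true
  | _ => false

/-- Renumber an index when an abstraction is passed. -/
def Entry.down (e : Entry) : Entry :=
  match e.name with
  | .bound k => { e with name := .bound (k - 1) }
  | .free _ => e

/-- The list of free variable occurrences of a term, read off its base, which has exactly one entry
for each of them. -/
def occs (B : List Entry) : List ℕ := B.map Entry.occ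

/-- Unification of two general types of the same shape; `row` labels the first equation, the one
between the outermost exponents. Types of different shape (which do not occur for typed terms) give
an unsolvable constraint. -/
def unify (row : Option ℕ) : GTy → GTy → List Constraint
  | .var ns _, .var ms _ => [.eqn row ns ms]
  | .limp ns Θ₁ Θ₂, .limp ms Δ₁ Δ₂ =>
      .eqn row ns ms :: (unify none Θ₁ Δ₁ ++ unify none Θ₂ Δ₂)
  | _, _ => [.geOne []]

/-- Unification of a list of general types: consecutive ones are unified. -/
def unifyAll : List GTy → List Constraint
  | Θ :: Δ :: l => unify none Θ Δ ++ unifyAll (Δ :: l)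
  | _ => []

/-- Contraction. -/
def contract : List GTy → List Constraint
  | Θ :: Δ :: l => .geOne Θ.exps :: unifyAll (Θ :: Δ :: l)
  | _ => []

/-- The most general EAL-type with a given erasure: a fresh exponent is added everywhere. The
second component is the new value of the counter. -/
def general : Ty → ℕ → GTy × ℕ
  | .var a, n => (.var [n] a, n + 1)
  | .arr σ τ, n =>
      let p := general σ (n + 1)
      let q := general τ p.2
      (.limp [n] p.1 q.1, q.2)

/-- The result of boxing: base, type, constraints, new value of the counter. -/
structure Boxed : Type where
  base : List Entry
  ty : GTy
  cons : List Constraint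
  next : ℕ

/-- Boxing through the critical points: for every slice, a fresh number `c` of boxes. -/
def boxSlices : List Slice → List Entry → GTy → List Constraint → ℕ → Boxed
  | [], B, Γ, A, n => ⟨B, Γ, A, n⟩
  | sl :: cpts, B, Γ, A, n =>
      boxSlices cpts (B.map fun e => if sl.hasOcc e.occ then e else e.bang n) (Γ.bang n)
        (A.map (Constraint.boxSlice sl n)) (n + 1)

def CTm.isVar : CTm → Bool
  | .fvar _ => true
  | .bvar _ => true
  | _ => false

def CTm.isApp : CTm → Bool
  | .app _ _ => true
  | _ => false

/-- Boxing of the term `M`: nothing happens for a variable; otherwise boxes are added through the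
critical points, and a fresh number `b` of boxes around the whole term. -/
def box (M : CTm) (cpts : List Slice) (B : List Entry) (Γ : GTy) (A : List Constraint) (n : ℕ) :
    Boxed :=
  if M.isVar then ⟨B, Γ, A, n⟩
  else
    let r := boxSlices cpts B Γ A n
    ⟨r.base.map (Entry.bang r.next), r.ty.bang r.next, r.cons, r.next + 1⟩

/-- Product union. -/
def prodUnion : List Slice → List Slice → List Slice
  | [], ds => ds
  | sl :: cs, [] => sl :: cs
  | sl :: cs, d :: ds => (sl :: (d :: ds).map (sl ++ ·)) ++ prodUnion cs (d :: ds)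

/-- The result of type synthesis: type, base, constraints, critical points (a list of slices), and
the new value of the counter. -/
structure Out : Type where
  ty : GTy
  base : List Entry
  cons : List Constraint
  cpts : List Slice
  next : ℕ

/-- The slice that consists of the single critical point `(row, os)` is added if `b` holds. -/
def addPoint (b : Bool) (cpts : List Slice) (row : ℕ) (os : List ℕ) : List Slice :=
  if b then cpts ++ [[(row, os)]] else cpts

/-- A variable of simple type `σ`. -/
def synthVar (v : Name) (σ : Ty) (n : ℕ) : Out :=
  let p := general σ n
  ⟨p.1, [⟨p.2, v, p.1⟩], [], [], p.2 + 1⟩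

/-- An abstraction `λx.M`, with `x : σ`, from the result `r` for `M`. If `x` occurs in `M`, the
slices that contain an occurrence of `x` are dropped; if it does not and `M` is an application, the
root of `M` becomes a critical point. -/
def synthLam (σ : Ty) (M : CTm) (r : Out) : Out :=
  let k := box M r.cpts r.base r.ty r.cons r.next
  let xs := k.base.filter Entry.isZero
  let rest := (k.base.filter fun e => !e.isZero).map Entry.down
  match xs with
  | x :: _ =>
      ⟨.limp [] x.ty k.ty, rest, k.cons ++ contract (xs.map Entry.ty),
        r.cpts.filter fun sl => !(xs.any fun e => sl.hasOcc e.occ), k.next⟩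
  | [] =>
      let p := general σ k.next
      if M.isApp then
        ⟨.limp [] p.1 (k.ty.setExps [p.2]), rest,
          k.cons ++ [.eqn (some (p.2 + 1)) k.ty.exps [p.2]],
          addPoint true r.cpts (p.2 + 1) (occs rest), p.2 + 2⟩
      else ⟨.limp [] p.1 k.ty, rest, k.cons, r.cpts, p.2⟩

/-- An application `(M N)` from the results `r` for `M` and `s` for `N`. The root of `M` (of `N`)
becomes a critical point if `M` (if `N`) is an application. If the type of `M` is not an
implication (which does not occur for typed terms), the constraints are unsolvable. -/
def synthApp (M N : CTm) (r s : Out) : Out :=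
  let k := box N s.cpts s.base s.ty s.cons s.next
  match r.ty with
  | .limp ns Θ Γ =>
      ⟨Γ, r.base ++ k.base,
        r.cons ++ k.cons ++ unify (some (k.next + 1)) k.ty Θ ++ [.eqn (some k.next) ns []],
        prodUnion (addPoint M.isApp r.cpts k.next (occs r.base))
          (addPoint N.isApp s.cpts (k.next + 1) (occs k.base)), k.next + 2⟩
  | .var _ _ => ⟨r.ty, [], [.geOne []], [], k.next⟩

/-- Type synthesis for a term with simple types; `ρ` and `Δ` give the simple types of the free
variables and of the dangling indices. -/
def synth (ρ : ℕ → Ty) : List Ty → CTm → ℕ → Out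
  | _, .fvar x, n => synthVar (.free x) (ρ x) n
  | Δ, .bvar k, n => synthVar (.bound k) (Δ.getD k (.var 0)) n
  | Δ, .lam σ M, n => synthLam σ M (synth ρ (σ :: Δ) M n)
  | Δ, .app M N, n =>
      let r := synth ρ Δ M n
      synthApp M N r (synth ρ Δ N r.next)

def Name.free? : Name → Option ℕ
  | .free x => some x
  | .bound _ => none

/-- The free variables declared in a base, without repetition. -/
def freeNames (B : List Entry) : List ℕ := (B.filterMap fun e => e.name.free?).dedup

/-- The types of all occurrences of the free variable `x` in a base. -/
def occTypes (B : List Entry) (x : ℕ) : List GTy :=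
  (B.filter fun e => e.name.free? == some x).map Entry.ty

/-- The type synthesis algorithm: the term is boxed, the critical points are forgotten, and the
common variables of the base are contracted. The result is a general type, a base and a set of
linear constraints. -/
def typeSynthesis (ρ : ℕ → Ty) (D : CTm) : GTy × List (ℕ × GTy) × List Constraint :=
  let r := synth ρ [] D 0
  let k := box D r.cpts r.base r.ty r.cons r.next
  let names := freeNames k.base
  (k.ty,
    names.filterMap fun x => (occTypes k.base x).head?.map fun Θ => (x, Θ),
    k.cons ++ names.flatMap fun x => contract (occTypes k.base x))

end EAL

namespace EAL

/-! ### Renaming and counting occurrences of names -/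

/-! The sequent calculus is not syntax directed, so both directions go through the typing `Leveled γ
r M A`, which follows the structure of the term. Every binder carries a level, the number of boxes
around it. At any node one may enter a new box, or leave the innermost open one if no variable
occurring in the subterm was bound inside it.

Derivations and `Leveled` at depth `0` agree, provided that repeated variables have types of the
form `!A` (`Seq.leveled`, `Leveled.typed`). Towards levels, the restriction on fans is decisive: an
application or abstraction is only plugged into a wire that no fan shares, so duplication of a
compound term never happens. Towards derivations, a box that is left at some subterms becomes a
derivation with fresh variables in their place; promotion applies to it, and the subterms are cut in
afterwards (`Staged`, `Leveled.exists_staged`).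

Synthesis is then compared with `Leveled`. By `Leveled.invert`, leaving a box is only ever needed at
an application: at a variable the variable rule absorbs it, and at an abstraction it cancels against
an entering. These are the critical points, and a box is described by the set of critical points at
which it is left, a slice. For a subterm at depth `d`, the open boxes form a list `W` of `d` slices,
innermost first, and constraints are read relative to it (`Constraint.HoldsIn`): an equation is
shifted by the number of slices containing it. An occurrence of level `l` that lies in `c` of these
slices is still inside `d - c` of the boxes, `l` of which enclose its binder; hence `d - l - c` is
the number of `!`s by which its declared type exceeds its entry (`Entry.Fits`). Boxing with a fresh
variable adds copies of a slice to `W`; the product of slices expresses that a box around an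
application is left independently in the function and in the argument; slices through an occurrence
of a bound variable disappear because those boxes lie outside the binder. With this invariant,
`synth_sound` and `synth_complete` are inductions on the simple type derivation, and at the root `W`
is empty.

Completeness by itself only finds the exponents over the skeleton of the principal schema. The
formulas that stand for its type variables are recovered from principality: they are coded as new
type variables (`Fm.expand`), which gives a simple typing of the term, and decoding the instance of
the principal schema gives the substitution `S` (`Fm.subst_decode_reshape`). -/

noncomputable instance : DecidableEq Name := Classical.decEq _

/-- The name of a variable as seen from below one more abstraction. -/
def Name.up : Name → Name
  | .free x => .free x
  | .bound k => .bound (k + 1)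

/-- Extend an assignment by a value for a new index `0`. -/
def Name.cons {α : Sort*} (a : α) (γ : Name → α) : Name → α
  | .free x => γ (.free x)
  | .bound 0 => a
  | .bound (k + 1) => γ (.bound k)

/-- A renaming carried below one abstraction. -/
def Name.lift (f : Name → Name) : Name → Name := Name.cons (.bound 0) fun v => (f v).up

/-- The term consisting of a single variable. -/
def Name.toTm : Name → Tm
  | .free x => .fvar x
  | .bound k => .bvar k

/-- Rename the free variables and the dangling indices. -/
def Tm.ren : (Name → Name) → Tm → Tm
  | f, .fvar x => (f (.free x)).toTm
  | f, .bvar k => (f (.bound k)).toTm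
  | f, .lam M => .lam (M.ren (Name.lift f))
  | f, .app M N => .app (M.ren f) (N.ren f)

/-- The number of occurrences of a name. -/
noncomputable def Tm.cnt : Name → Tm → ℕ
  | v, .fvar x => if v = .free x then 1 else 0
  | v, .bvar k => if v = .bound k then 1 else 0
  | v, .lam M => M.cnt v.up
  | v, .app M N => M.cnt v + N.cnt v

/-- No dangling indices. -/
def Tm.LC (M : Tm) : Prop := ∀ k, M.cnt (.bound k) = 0

@[simp] theorem Name.up_free (x : ℕ) : (Name.free x).up = .free x := rfl
@[simp] theorem Name.up_bound (k : ℕ) : (Name.bound k).up = .bound (k + 1) := rfl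

theorem Name.up_injective : Function.Injective Name.up := by
  intro u v h
  cases u <;> cases v <;> simp_all [Name.up]

@[simp] theorem Name.up_inj {u v : Name} : u.up = v.up ↔ u = v := Name.up_injective.eq_iff

@[simp] theorem Name.up_ne_zero (v : Name) : v.up ≠ .bound 0 := by
  cases v <;> simp [Name.up]

theorem Name.eq_zero_or_up (v : Name) : v = .bound 0 ∨ ∃ u : Name, v = u.up := by
  match v with
  | .free x => exact .inr ⟨.free x, rfl⟩
  | .bound 0 => exact .inl rfl
  | .bound (k + 1) => exact .inr ⟨.bound k, rfl⟩

@[simp] theorem Name.cons_zero {α : Sort*} (a : α) (γ : Name → α) :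
    Name.cons a γ (.bound 0) = a := rfl

@[simp] theorem Name.cons_up {α : Sort*} (a : α) (γ : Name → α) (v : Name) :
    Name.cons a γ v.up = γ v := by
  cases v <;> rfl

@[simp] theorem Name.cons_free {α : Sort*} (a : α) (γ : Name → α) (x : ℕ) :
    Name.cons a γ (.free x) = γ (.free x) := rfl

@[simp] theorem Name.lift_zero (f : Name → Name) : Name.lift f (.bound 0) = .bound 0 := rfl

@[simp] theorem Name.lift_up (f : Name → Name) (v : Name) : Name.lift f v.up = (f v).up := by
  cases v <;> rfl

@[simp] theorem Name.lift_free (f : Name → Name) (x : ℕ) :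
    Name.lift f (.free x) = (f (.free x)).up := rfl

@[simp] theorem Tm.ren_toTm (f : Name → Name) (v : Name) : v.toTm.ren f = (f v).toTm := by
  cases v <;> rfl

@[simp] theorem Tm.cnt_toTm (u v : Name) : v.toTm.cnt u = if u = v then 1 else 0 := by
  cases v <;> rfl

@[simp] theorem Tm.cnt_lam (v : Name) (M : Tm) : (Tm.lam M).cnt v = M.cnt v.up := rfl

@[simp] theorem Tm.cnt_app (v : Name) (M N : Tm) : (Tm.app M N).cnt v = M.cnt v + N.cnt v := rfl

theorem Name.toTm_injective : Function.Injective Name.toTm := by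
  intro u v h
  cases u <;> cases v <;> simp_all [Name.toTm]

theorem Tm.cnt_ren_ne_zero {f : Name → Name} {v : Name} {M : Tm} (h : (M.ren f).cnt v ≠ 0) :
    ∃ u, M.cnt u ≠ 0 ∧ f u = v := by
  induction M generalizing f v with
  | fvar x => exact ⟨.free x, by simp [Tm.cnt], by simpa [Tm.ren, eq_comm] using h⟩
  | bvar k => exact ⟨.bound k, by simp [Tm.cnt], by simpa [Tm.ren, eq_comm] using h⟩
  | lam M ih =>
    obtain ⟨u, hu, hv⟩ := ih h
    rcases u.eq_zero_or_up with rfl | ⟨u, rfl⟩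
    · exact absurd hv.symm (Name.up_ne_zero v)
    · exact ⟨u, hu, by simpa using hv⟩
  | app M N ihM ihN =>
    simp only [Tm.ren, Tm.cnt_app] at h
    by_cases hM : (M.ren f).cnt v = 0
    · obtain ⟨u, hu, hv⟩ := ihN (f := f) (v := v) (by omega)
      exact ⟨u, by simp only [Tm.cnt_app]; omega, hv⟩
    · obtain ⟨u, hu, hv⟩ := ihM hM
      exact ⟨u, by simp only [Tm.cnt_app]; omega, hv⟩

/-- Only the fibre over `v` matters, so `f` may identify other names; the condition on the fibre
survives passing under an abstraction. -/
theorem Tm.cnt_ren_of_forall {f : Name → Name} {u v : Name} (M : Tm)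
    (h : ∀ w, f w = v ↔ w = u) : (M.ren f).cnt v = M.cnt u := by
  induction M generalizing f u v with
  | fvar x => simp [Tm.ren, Tm.cnt, eq_comm (a := v), eq_comm (a := u), h]
  | bvar k => simp [Tm.ren, Tm.cnt, eq_comm (a := v), eq_comm (a := u), h]
  | lam M ih =>
    refine ih fun w => ?_
    rcases w.eq_zero_or_up with rfl | ⟨w, rfl⟩
    · simp [eq_comm (b := Name.up _)]
    · simp [h]
  | app M N ihM ihN => simp [Tm.ren, ihM h, ihN h]

theorem Tm.cnt_zero_ren_lift (f : Name → Name) (M : Tm) :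
    (M.ren (Name.lift f)).cnt (.bound 0) = M.cnt (.bound 0) := by
  refine Tm.cnt_ren_of_forall M fun w => ?_
  rcases w.eq_zero_or_up with rfl | ⟨w, rfl⟩ <;> simp

theorem Tm.ren_congr {f g : Name → Name} {M : Tm} (h : ∀ u, M.cnt u ≠ 0 → f u = g u) :
    M.ren f = M.ren g := by
  induction M generalizing f g with
  | fvar x => simp [Tm.ren, h (.free x) (by simp [Tm.cnt])]
  | bvar k => simp [Tm.ren, h (.bound k) (by simp [Tm.cnt])]
  | lam M ih =>
    simp only [Tm.ren, Tm.lam.injEq]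
    refine ih fun u hu => ?_
    rcases u.eq_zero_or_up with rfl | ⟨u, rfl⟩
    · rfl
    · simp [h u hu]
  | app M N ihM ihN =>
    simp only [Tm.ren, Tm.app.injEq]
    exact ⟨ihM fun u hu => h u (by simp; omega), ihN fun u hu => h u (by simp; omega)⟩

theorem Name.lift_comp (f g : Name → Name) :
    Name.lift (fun v => g (f v)) = fun v => Name.lift g (Name.lift f v) := by
  funext v
  rcases v.eq_zero_or_up with rfl | ⟨v, rfl⟩ <;> simp

theorem Tm.ren_ren (f g : Name → Name) (M : Tm) :
    (M.ren f).ren g = M.ren fun v => g (f v) := by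
  induction M generalizing f g with
  | fvar x => simp [Tm.ren]
  | bvar k => simp [Tm.ren]
  | lam M ih => simp only [Tm.ren, ih, Name.lift_comp]
  | app M N ihM ihN => simp [Tm.ren, ihM, ihN]

theorem Name.lift_id : Name.lift (fun v => v) = fun v => v := by
  funext v
  rcases v.eq_zero_or_up with rfl | ⟨v, rfl⟩ <;> simp

theorem Tm.ren_id (M : Tm) : M.ren (fun v => v) = M := by
  induction M with
  | fvar x => rfl
  | bvar k => rfl
  | lam M ih => simp only [Tm.ren, Name.lift_id, ih]
  | app M N ihM ihN => simp [Tm.ren, ihM, ihN]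

/-! ### Substitution and closing as renamings; occurrence counts under substitution -/

theorem Tm.subst_fvar_eq_ren (M : Tm) (x y : ℕ) :
    M.subst x (.fvar y) = M.ren fun v => if v = .free x then .free y else v := by
  induction M with
  | fvar z => by_cases h : z = x <;> simp [Tm.subst, Tm.ren, h, Name.toTm]
  | bvar k => simp [Tm.subst, Tm.ren, Name.toTm]
  | lam M ih =>
    simp only [Tm.subst, Tm.ren, ih, Tm.lam.injEq]
    congr 1
    funext v
    rcases v.eq_zero_or_up with rfl | ⟨v, rfl⟩
    · simp
    · by_cases h : v = .free x
      · subst h; simp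
      · have : v.up ≠ .free x := fun h' => h (Name.up_injective (by simpa using h'))
        simp [h, this]
  | app M N ihM ihN => simp [Tm.subst, Tm.ren, ihM, ihN]

theorem Tm.close_eq_ren (M : Tm) (x k : ℕ) :
    M.close x k = M.ren fun v => if v = .free x then .bound k else v := by
  induction M generalizing k with
  | fvar z => by_cases h : z = x <;> simp [Tm.close, Tm.ren, h, Name.toTm]
  | bvar j => simp [Tm.close, Tm.ren, Name.toTm]
  | lam M ih =>
    simp only [Tm.close, Tm.ren, ih, Tm.lam.injEq]
    congr 1
    funext v
    rcases v.eq_zero_or_up with rfl | ⟨v, rfl⟩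
    · simp
    · by_cases h : v = .free x
      · subst h; simp
      · have : v.up ≠ .free x := fun h' => h (Name.up_injective (by simpa using h'))
        simp [h, this]
  | app M N ihM ihN => simp [Tm.close, Tm.ren, ihM, ihN]

/-- Under an abstraction the counted index shifts while `N` does not, which is harmless because `N`
has no dangling indices. -/
theorem Tm.cnt_subst {N : Tm} (hN : N.LC) (M : Tm) (x : ℕ) (v : Name) :
    (M.subst x N).cnt v = (if v = .free x then 0 else M.cnt v) + M.cnt (.free x) * N.cnt v := by
  induction M generalizing v with
  | fvar z =>
    by_cases h : z = x
    · subst h; by_cases hv : v = .free z <;> simp [Tm.subst, Tm.cnt, hv]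
    · simp only [Tm.subst, h, Tm.cnt]
      by_cases hv : v = .free x
      · subst hv; simp [Ne.symm h, Tm.cnt]
      · simp [hv, Ne.symm h, Tm.cnt]
  | bvar k =>
    by_cases hv : v = .free x
    · subst hv; simp [Tm.subst, Tm.cnt]
    · simp [Tm.subst, Tm.cnt, hv]
  | lam M ih =>
    simp only [Tm.subst, Tm.cnt_lam, ih, Name.up_free]
    have h1 : N.cnt v.up = N.cnt v := by
      cases v with
      | free x => rfl
      | bound k => rw [Name.up_bound, hN, hN]
    have h2 : v.up = .free x ↔ v = .free x := by
      rw [← Name.up_free x, Name.up_inj]; rfl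
    rw [h1]
    simp only [h2]
  | app M P ihM ihP =>
    simp only [Tm.subst, Tm.cnt_app, ihM, ihP]
    split <;> ring

theorem Tm.subst_of_cnt_eq_zero {M : Tm} {x : ℕ} (N : Tm) (h : M.cnt (.free x) = 0) :
    M.subst x N = M := by
  induction M with
  | fvar z =>
    have : z ≠ x := by rintro rfl; simp [Tm.cnt] at h
    simp [Tm.subst, this]
  | bvar k => rfl
  | lam M ih => simp [Tm.subst, ih h]
  | app M P ihM ihP =>
    simp only [Tm.cnt_app] at h
    simp [Tm.subst, ihM (by omega), ihP (by omega)]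

/-- Associativity of cuts, for `Staged.cut_base`; `Tm.subst_comm` is the commutation needed in
`Staged.cut`. -/
theorem Tm.subst_subst {M N P : Tm} {x y : ℕ} (hM : M.cnt (.free y) = 0) :
    M.subst x (N.subst y P) = (M.subst x N).subst y P := by
  induction M with
  | fvar z =>
    have : z ≠ y := by rintro rfl; simp [Tm.cnt] at hM
    by_cases hz : z = x <;> simp [Tm.subst, hz]
    exact fun h => absurd h this
  | bvar k => rfl
  | lam M ih => simp [Tm.subst, ih hM]
  | app M P ihM ihP =>
    simp only [Tm.cnt_app] at hM
    simp [Tm.subst, ihM (by omega), ihP (by omega)]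

theorem Tm.subst_comm {M N P : Tm} {x y : ℕ} (hxy : x ≠ y) (hN : N.cnt (.free y) = 0)
    (hP : P.cnt (.free x) = 0) : (M.subst x N).subst y P = (M.subst y P).subst x N := by
  induction M with
  | fvar z =>
    by_cases hx : z = x
    · subst hx; simp [Tm.subst, hxy, Tm.subst_of_cnt_eq_zero _ hN]
    · by_cases hy : z = y
      · subst hy; simp [Tm.subst, hx, Tm.subst_of_cnt_eq_zero _ hP]
      · simp [Tm.subst, hx, hy]
  | bvar k => rfl
  | lam M ih => simp [Tm.subst, ih]
  | app M P ihM ihP => simp [Tm.subst, ihM, ihP]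

theorem Tm.mem_fv {M : Tm} {x : ℕ} : x ∈ M.fv ↔ M.cnt (.free x) ≠ 0 := by
  induction M with
  | fvar z => simp [Tm.fv, Tm.cnt]
  | bvar k => simp [Tm.fv, Tm.cnt]
  | lam M ih => simpa [Tm.fv] using ih
  | app M N ihM ihN =>
    simp only [Tm.fv, Finset.mem_union, ihM, ihN, Tm.cnt_app]
    omega

/-! ### Typing with levels

Contexts give the type of each name and its level, the number of boxes around its binder. -/

abbrev LCtx : Type := Name → Fm × ℕ

/-- `A` has the form `!B`. -/
def Fm.IsBang (A : Fm) : Prop := ∃ B, A = .bang B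

/-- `Leveled γ r M A`: inside `r` boxes the term `M` has type `A`; boxes may be entered and left
at every node, as long as they are not left below the level of a variable that occurs there. -/
inductive Leveled : LCtx → ℕ → Tm → Fm → Prop
  | var {γ : LCtx} {r : ℕ} {M : Tm} {A : Fm} (v : Name) (hM : M = v.toTm) (hl : (γ v).2 ≤ r)
      (hT : (γ v).1 = Fm.bang^[r - (γ v).2] A) : Leveled γ r M A
  | lam {γ : LCtx} {r : ℕ} {M : Tm} {A B : Fm} (h : Leveled (Name.cons (A, r) γ) r M B)
      (hm : 2 ≤ M.cnt (.bound 0) → A.IsBang) : Leveled γ r (.lam M) (.limp A B)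
  | app {γ : LCtx} {r : ℕ} {M N : Tm} {A B : Fm} (hM : Leveled γ r M (.limp A B))
      (hN : Leveled γ r N A) : Leveled γ r (.app M N) B
  | enter {γ : LCtx} {r : ℕ} {M : Tm} {A : Fm} (h : Leveled γ (r + 1) M A) :
      Leveled γ r M (.bang A)
  | exit {γ : LCtx} {r : ℕ} {M : Tm} {A : Fm} (h : Leveled γ r M (.bang A))
      (hl : ∀ v, M.cnt v ≠ 0 → (γ v).2 ≤ r) : Leveled γ (r + 1) M A

/-- The renaming may identify variables of equal type and level: the contraction condition concerns
index `0` only, and a lifted renaming sends nothing else there. Contraction of free variables is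
therefore invisible to `Leveled` and must be tracked separately. -/
theorem Leveled.ren {γ γ' : LCtx} {r : ℕ} {M : Tm} {A : Fm} {f : Name → Name}
    (h : Leveled γ r M A) (hf : ∀ v, M.cnt v ≠ 0 → γ' (f v) = γ v) : Leveled γ' r (M.ren f) A := by
  induction h generalizing γ' f with
  | var v hM hl hT =>
    subst hM
    have := hf v (by simp)
    exact .var (f v) (by simp) (this ▸ hl) (this ▸ hT)
  | lam _ hm ih =>
    refine .lam (ih fun v hv => ?_) (by rwa [Tm.cnt_zero_ren_lift])
    rcases v.eq_zero_or_up with rfl | ⟨v, rfl⟩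
    · simp
    · simpa using hf v hv
  | app _ _ ihM ihN =>
    exact .app (ihM fun v hv => hf v (by simp; omega)) (ihN fun v hv => hf v (by simp; omega))
  | enter _ ih => exact .enter (ih hf)
  | exit _ hl ih =>
    refine .exit (ih hf) fun v hv => ?_
    obtain ⟨u, hu, rfl⟩ := Tm.cnt_ren_ne_zero hv
    rw [hf u hu]
    exact hl u hu

theorem Leveled.congr {γ γ' : LCtx} {r : ℕ} {M : Tm} {A : Fm} (h : Leveled γ r M A)
    (hγ : ∀ v, M.cnt v ≠ 0 → γ' v = γ v) : Leveled γ' r M A := by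
  simpa [Tm.ren_id] using h.ren (f := fun v => v) hγ

theorem Leveled.exit_iterate {γ : LCtx} {l : ℕ} {M : Tm} {A : Fm} (k : ℕ)
    (h : Leveled γ l M (Fm.bang^[k] A)) (hl : ∀ v, M.cnt v ≠ 0 → (γ v).2 ≤ l) :
    Leveled γ (l + k) M A := by
  induction k generalizing A with
  | zero => exact h
  | succ k ih =>
    have := ih (A := .bang A) h
    exact .exit this fun v hv => (hl v hv).trans (Nat.le_add_right _ _)

theorem Leveled.enter_iterate {γ : LCtx} {l : ℕ} {M : Tm} {A : Fm} (k : ℕ)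
    (h : Leveled γ (l + k) M A) : Leveled γ l M (Fm.bang^[k] A) := by
  induction k generalizing A with
  | zero => exact h
  | succ k ih => exact ih (A := .bang A) (.enter h)

/-- Substitution of a term for a variable of its type and level. -/
theorem Leveled.subst {γ γ' : LCtx} {r : ℕ} {M N : Tm} {B : Fm} {x : ℕ}
    (h : Leveled γ r M B) (hN : Leveled γ' (γ (.free x)).2 N (γ (.free x)).1) (hc : N.LC)
    (hl : ∀ v, N.cnt v ≠ 0 → (γ' v).2 ≤ (γ (.free x)).2)
    (hγ : ∀ v, v ≠ .free x → M.cnt v ≠ 0 → γ' v = γ v) :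
    Leveled γ' r (M.subst x N) B := by
  have key : ∀ (M : Tm) (v : Name), (M.subst x N).cnt v ≠ 0 →
      (v ≠ .free x ∧ M.cnt v ≠ 0) ∨ (M.cnt (.free x) ≠ 0 ∧ N.cnt v ≠ 0) := by
    intro M v hv
    rw [Tm.cnt_subst hc] at hv
    by_cases h1 : M.cnt (.free x) * N.cnt v = 0
    · left
      rw [h1] at hv
      by_cases h2 : v = .free x
      · simp [h2] at hv
      · simpa [h2] using hv
    · right; simpa using h1
  induction h generalizing γ' with
  | @var γ r M A v hM hle hT =>
    subst hM
    by_cases hv : v = .free x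
    · subst hv
      have : (Name.free x).toTm.subst x N = N := by simp [Name.toTm, Tm.subst]
      rw [this]
      rw [hT] at hN
      -- The occurrence may be deeper than the level of `x`. Leaving boxes bridges the gap, which is
      -- allowed since the variables of `N` have levels at most that of `x`.
      have := hN.exit_iterate _ hl
      rwa [Nat.add_sub_cancel' hle] at this
    · have h1 : v.toTm.subst x N = v.toTm := Tm.subst_of_cnt_eq_zero _ (by simp [Ne.symm hv])
      have h2 := hγ v hv (by simp)
      rw [h1]
      exact .var v rfl (h2 ▸ hle) (h2 ▸ hT)
  | @lam γ r M A B hM hm ih =>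
    refine .lam (ih ?_ ?_ ?_) ?_
    · refine hN.congr fun v hv => ?_
      cases v with
      | free y => rfl
      | bound k => exact absurd (hc k) hv
    · intro v hv
      cases v with
      | free y => exact hl _ hv
      | bound k => exact absurd (hc k) hv
    · intro v hv hv'
      rcases v.eq_zero_or_up with rfl | ⟨v, rfl⟩
      · rfl
      · simpa using hγ v (fun h => hv (by simp [h])) hv'
    · rw [Tm.cnt_subst hc, hc]
      simpa using hm
  | app _ _ ihM ihN =>
    exact .app (ihM hN hl fun v hv hv' => hγ v hv (by simp; omega))
      (ihN hN hl fun v hv hv' => hγ v hv (by simp; omega))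
  | enter _ ih => exact .enter (ih hN hl hγ)
  | @exit γ r M A hM hle ih =>
    refine .exit (ih hN hl hγ) fun v hv => ?_
    rcases key _ _ hv with ⟨h1, h2⟩ | ⟨h1, h2⟩
    · rw [hγ v h1 h2]; exact hle v h2
    · exact (hl v h2).trans (hle _ h1)

/-- Adding a `!` to the types of all variables at level `0` puts everything into one more box. -/
theorem Leveled.raise {γ γ' : LCtx} {r : ℕ} {M : Tm} {A : Fm} (h : Leveled γ r M A)
    (hγ : ∀ v, M.cnt v ≠ 0 →
      γ' v = ((γ v).1, (γ v).2 + 1) ∨ (γ' v = (.bang (γ v).1, (γ v).2))) :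
    Leveled γ' (r + 1) M A := by
  induction h generalizing γ' with
  | @var γ r M A v hM hl hT =>
    subst hM
    rcases hγ v (by simp) with h | h
    · refine .var v rfl (by rw [h]; simpa using hl) ?_
      rw [h]; simpa using hT
    · refine .var v rfl (by rw [h]; simp; omega) ?_
      rw [h]
      simp only [hT]
      -- The level stays while the depth grows; the added `!` pays for the difference.
      rw [Nat.succ_sub hl, Function.iterate_succ_apply']
  | lam _ hm ih =>
    refine .lam (ih fun v hv => ?_) hm
    rcases v.eq_zero_or_up with rfl | ⟨v, rfl⟩
    · simp
    · simpa using hγ v hv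
  | app _ _ ihM ihN =>
    exact .app (ihM fun v hv => hγ v (by simp; omega)) (ihN fun v hv => hγ v (by simp; omega))
  | enter _ ih => exact .enter (ih hγ)
  | exit _ hl ih =>
    refine .exit (ih hγ) fun v hv => ?_
    have := hl v hv
    rcases hγ v hv with h | h <;> rw [h] <;> simp <;> omega

/-! ### Free wires of sharing graphs -/

/-- The wire `x` is free in the graph. -/
def Graph.HasFree (x : ℕ) : Graph → Prop
  | .fvar y => y = x
  | .bvar _ => False
  | .lam G => G.HasFree x
  | .app G H => G.HasFree x ∨ H.HasFree x
  | .fan P Q => P.HasFree x ∨ Q.HasFree x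

/-- The free wire `x` lies on the principal side of a fan. -/
def Graph.Fanned (x : ℕ) : Graph → Prop
  | .fvar _ => False
  | .bvar _ => False
  | .lam G => G.Fanned x
  | .app G H => G.Fanned x ∨ H.Fanned x
  | .fan P Q => P.HasFree x ∨ Q.Fanned x

theorem Graph.Fanned.hasFree {x : ℕ} {G : Graph} (h : G.Fanned x) : G.HasFree x := by
  induction G with
  | fvar _ => exact h.elim
  | bvar _ => exact h.elim
  | lam _ ih => exact ih h
  | app _ _ ih1 ih2 => exact h.imp ih1 ih2
  | fan _ _ _ ih2 => exact h.imp id ih2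

theorem Graph.hasFree_subst {x y : ℕ} {G H : Graph} :
    (G.subst x H).HasFree y ↔ (y ≠ x ∧ G.HasFree y) ∨ (G.HasFree x ∧ H.HasFree y) := by
  induction G with
  | fvar z =>
    by_cases hz : z = x
    · subst hz
      simp [Graph.subst, Graph.HasFree]
      rintro h rfl
      exact absurd rfl h
    · simp only [Graph.subst, hz, if_false, Graph.HasFree, false_and, or_false]
      exact ⟨fun h => ⟨h ▸ hz, h⟩, fun h => h.2⟩
  | bvar _ => simp [Graph.subst, Graph.HasFree]
  | lam _ ih => simpa [Graph.subst, Graph.HasFree] using ih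
  | app _ _ ih1 ih2 => simp only [Graph.subst, Graph.HasFree, ih1, ih2]; tauto
  | fan _ _ ih1 ih2 => simp only [Graph.subst, Graph.HasFree, ih1, ih2]; tauto

theorem Graph.hasFree_close {x y k : ℕ} {G : Graph} :
    (G.close x k).HasFree y ↔ y ≠ x ∧ G.HasFree y := by
  induction G generalizing k with
  | fvar z =>
    by_cases hz : z = x
    · subst hz
      simp [Graph.close, Graph.HasFree]
      exact fun h h' => h h'.symm
    · simp only [Graph.close, hz, if_false, Graph.HasFree]
      exact ⟨fun h => ⟨h ▸ hz, h⟩, fun h => h.2⟩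
  | bvar _ => simp [Graph.close, Graph.HasFree]
  | lam _ ih => simpa [Graph.close, Graph.HasFree] using ih
  | app _ _ ih1 ih2 => simp only [Graph.close, Graph.HasFree, ih1, ih2]; tauto
  | fan _ _ ih1 ih2 => simp only [Graph.close, Graph.HasFree, ih1, ih2]; tauto

theorem Graph.fanned_subst {x y : ℕ} {G H : Graph} :
    (G.subst x H).Fanned y ↔ (y ≠ x ∧ G.Fanned y) ∨ (G.Fanned x ∧ H.HasFree y) ∨
      (G.HasFree x ∧ H.Fanned y) := by
  induction G with
  | fvar z => by_cases hz : z = x <;> simp [Graph.subst, Graph.HasFree, Graph.Fanned, hz]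
  | bvar _ => simp [Graph.subst, Graph.HasFree, Graph.Fanned]
  | lam _ ih => simpa [Graph.subst, Graph.HasFree, Graph.Fanned] using ih
  | app _ _ ih1 ih2 => simp only [Graph.subst, Graph.HasFree, Graph.Fanned, ih1, ih2]; grind
  | fan _ _ ih1 ih2 =>
    simp only [Graph.subst, Graph.HasFree, Graph.Fanned, Graph.hasFree_subst, ih2]
    have := fun h : H.Fanned y => h.hasFree
    grind

theorem Graph.fanned_close {x y k : ℕ} {G : Graph} :
    (G.close x k).Fanned y ↔ y ≠ x ∧ G.Fanned y := by
  induction G generalizing k with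
  | fvar z => by_cases hz : z = x <;> simp [Graph.close, Graph.Fanned, hz]
  | bvar _ => simp [Graph.close, Graph.Fanned]
  | lam _ ih => simpa [Graph.close, Graph.Fanned] using ih
  | app _ _ ih1 ih2 => simp only [Graph.close, Graph.Fanned, ih1, ih2]; tauto
  | fan _ _ ih1 ih2 => simp only [Graph.close, Graph.Fanned, Graph.hasFree_close, ih2]; tauto

/-! ### Roots and fans of graphs under closing and plugging -/

@[simp] theorem Graph.rootIsNode_close {x k : ℕ} {G : Graph} :
    (G.close x k).RootIsNode ↔ G.RootIsNode := by
  induction G generalizing k with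
  | fvar z => by_cases hz : z = x <;> simp [Graph.close, Graph.RootIsNode, hz]
  | fan _ _ _ ih2 => simpa [Graph.close, Graph.RootIsNode] using ih2
  | _ => simp [Graph.close, Graph.RootIsNode]

@[simp] theorem Graph.fansShareVars_close {x k : ℕ} {G : Graph} :
    (G.close x k).FansShareVars ↔ G.FansShareVars := by
  induction G generalizing k with
  | fvar z => by_cases hz : z = x <;> simp [Graph.close, Graph.FansShareVars, hz]
  | bvar _ => simp [Graph.close, Graph.FansShareVars]
  | lam _ ih => simpa [Graph.close, Graph.FansShareVars] using ih
  | app _ _ ih1 ih2 => simp only [Graph.close, Graph.FansShareVars, ih1, ih2]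
  | fan _ _ ih1 ih2 =>
    simp only [Graph.close, Graph.FansShareVars, ih1, ih2, Graph.rootIsNode_close]

theorem Graph.RootIsNode.subst {x : ℕ} {G : Graph} (h : G.RootIsNode) (H : Graph) :
    (G.subst x H).RootIsNode := by
  induction G with
  | fvar _ => exact h.elim
  | bvar _ => exact h.elim
  | fan _ _ _ ih2 => exact ih2 h
  | _ => trivial

theorem Graph.fansShareVars_of_subst {x : ℕ} {G H : Graph} (h : (G.subst x H).FansShareVars) :
    G.FansShareVars := by
  induction G with
  | fvar _ => trivial
  | bvar _ => trivial
  | lam _ ih => exact ih h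
  | app _ _ ih1 ih2 => exact ⟨ih1 h.1, ih2 h.2⟩
  | fan _ _ ih1 ih2 => exact ⟨fun hn => h.1 (hn.subst H), ih1 h.2.1, ih2 h.2.2⟩

theorem Graph.HasFree.fansShareVars {x : ℕ} {G H : Graph} (hx : G.HasFree x)
    (h : (G.subst x H).FansShareVars) : H.FansShareVars := by
  induction G with
  | fvar y => cases hx; simpa [Graph.subst] using h
  | bvar _ => exact hx.elim
  | lam _ ih => exact ih hx h
  | app _ _ ih1 ih2 => exact hx.elim (fun hx => ih1 hx h.1) (fun hx => ih2 hx h.2)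
  | fan _ _ ih1 ih2 => exact hx.elim (fun hx => ih1 hx h.2.1) (fun hx => ih2 hx h.2.2)

/-- If `x` were on the principal side of a fan at the root, that fan would face a node after
plugging. Otherwise the root either was a node already or is that of the plugged graph. -/
theorem Graph.HasFree.rootIsNode_subst {x : ℕ} {G H : Graph} (hx : G.HasFree x)
    (hn : H.RootIsNode) (h : (G.subst x H).FansShareVars) : (G.subst x H).RootIsNode := by
  induction G with
  | fvar y => cases hx; simpa [Graph.subst] using hn
  | bvar _ => exact hx.elim
  | lam _ ih => trivial
  | app _ _ ih1 ih2 => trivial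
  | fan _ _ ih1 ih2 =>
    exact hx.elim (fun hx => absurd (ih1 hx h.2.1) h.1) (fun hx => ih2 hx h.2.2)

/-- A fan with `x` on its principal side would face a node once `H` is plugged in. This is the form
in which the restriction on fans is used. -/
theorem Graph.not_fanned_of_subst {x : ℕ} {G H : Graph} (hn : H.RootIsNode)
    (h : (G.subst x H).FansShareVars) : ¬ G.Fanned x := by
  induction G with
  | fvar _ => exact id
  | bvar _ => exact id
  | lam _ ih => exact ih h
  | app _ _ ih1 ih2 => exact fun hx => hx.elim (ih1 h.1) (ih2 h.2)
  | fan _ _ ih1 ih2 =>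
    exact fun hx => hx.elim (fun hx => h.1 (hx.rootIsNode_subst hn h.2.1)) (ih2 h.2.2)

theorem Graph.subst_of_not_hasFree {x : ℕ} {G : Graph} (H : Graph) (h : ¬ G.HasFree x) :
    G.subst x H = G := by
  induction G with
  | fvar y => exact if_neg h
  | bvar _ => rfl
  | lam _ ih => exact congrArg _ (ih h)
  | app _ _ ih1 ih2 =>
    simp only [Graph.HasFree, not_or] at h
    simp [Graph.subst, ih1 h.1, ih2 h.2]
  | fan _ _ ih1 ih2 =>
    simp only [Graph.HasFree, not_or] at h
    simp [Graph.subst, ih1 h.1, ih2 h.2]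

/-! ### Derivations: elementary facts -/

@[simp] theorem Basis.dom_add (Γ Δ : Basis) : Basis.dom (Γ + Δ) = Basis.dom Γ + Basis.dom Δ :=
  Multiset.map_add _ _ _

@[simp] theorem Basis.dom_cons (p : ℕ × Fm) (Γ : Basis) :
    Basis.dom (p ::ₘ Γ) = p.1 ::ₘ Basis.dom Γ := Multiset.map_cons _ _ _

@[simp] theorem Basis.dom_zero : Basis.dom 0 = 0 := rfl

@[simp] theorem Basis.dom_singleton (p : ℕ × Fm) : Basis.dom {p} = {p.1} := rfl

@[simp] theorem Basis.dom_map_bang (Γ : Basis) :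
    Basis.dom (Γ.map fun p => (p.1, Fm.bang p.2)) = Basis.dom Γ := by
  simp [Basis.dom]

theorem Basis.mem_dom {Γ : Basis} {x : ℕ} : x ∈ Basis.dom Γ ↔ ∃ A, (x, A) ∈ Γ := by
  simp [Basis.dom]

theorem Seq.linear {Γ : Basis} {M : Tm} {G : Graph} {A : Fm} (h : Seq Γ M G A) : Γ.Linear := by
  induction h with
  | ax => simp [Basis.Linear]
  | cut _ _ hl => exact hl
  | weak _ hx ih => simpa [Basis.Linear] using ⟨hx, ih⟩
  | contr _ hz ih => simp [Basis.Linear] at ih ⊢; exact ⟨hz, ih.2.2⟩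
  | limpR _ ih => simp [Basis.Linear] at ih ⊢; exact ih.2
  | limpL _ _ hl => exact hl
  | bang _ ih => simpa [Basis.Linear] using ih

theorem Seq.lc {Γ : Basis} {M : Tm} {G : Graph} {A : Fm} (h : Seq Γ M G A) : M.LC := by
  have hv : ∀ x, (Tm.fvar x).LC := fun x k => by simp [Tm.cnt]
  induction h with
  | ax => exact hv _
  | cut _ _ _ ihN ihM => intro k; rw [Tm.cnt_subst ihN, ihM k, ihN k]; simp
  | weak _ _ ih => exact ih
  | contr _ _ ih =>
    intro k
    simp [Tm.cnt_subst (hv _), ih k, hv _ k]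
  | limpR _ ih =>
    intro k
    rw [Tm.cnt_lam, Tm.close_eq_ren]
    by_contra hc
    obtain ⟨u, hu, hk⟩ := Tm.cnt_ren_ne_zero hc
    split at hk
    · simp at hk
    · subst hk; exact hu (ih _)
  | @limpL _ _ f x N M _ _ _ _ _ _ _ _ ihN ihM =>
    have : (Tm.app (.fvar f) N).LC := fun k => by simp [ihN k, hv _ k]
    intro k; rw [Tm.cnt_subst this, ihM k, this k]; simp
  | bang _ ih => exact ih

theorem Tm.cnt_subst_ne_zero {M N : Tm} (hN : N.LC) {x : ℕ} {v : Name}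
    (h : (M.subst x N).cnt v ≠ 0) :
    (v ≠ .free x ∧ M.cnt v ≠ 0) ∨ (M.cnt (.free x) ≠ 0 ∧ N.cnt v ≠ 0) := by
  rw [Tm.cnt_subst hN] at h
  by_cases h1 : M.cnt (.free x) * N.cnt v = 0
  · left
    rw [h1] at h
    by_cases h2 : v = .free x
    · simp [h2] at h
    · simpa [h2] using h
  · right; simpa using h1

theorem Tm.cnt_close_ne_zero {M : Tm} {x y k : ℕ} (h : (M.close x k).cnt (.free y) ≠ 0) :
    y ≠ x ∧ M.cnt (.free y) ≠ 0 := by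
  rw [Tm.close_eq_ren] at h
  obtain ⟨u, hu, hk⟩ := Tm.cnt_ren_ne_zero h
  split at hk
  · simp at hk
  · next hne => subst hk; exact ⟨fun h => hne (by simp [h]), hu⟩

theorem Tm.lc_fvar (x : ℕ) : (Tm.fvar x).LC := fun k => by simp [Tm.cnt]

theorem Tm.cnt_fvar_ne_zero {x y : ℕ} : (Tm.fvar x).cnt (.free y) ≠ 0 ↔ y = x := by
  simp [Tm.cnt]

theorem Seq.hasFree_of_cnt {Γ : Basis} {M : Tm} {G : Graph} {A : Fm} (h : Seq Γ M G A) {y : ℕ}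
    (hy : M.cnt (.free y) ≠ 0) : G.HasFree y := by
  induction h generalizing y with
  | ax x A => exact (Tm.cnt_fvar_ne_zero.1 hy).symm
  | cut hN hM hl ihN ihM =>
    rw [Graph.hasFree_subst]
    exact (Tm.cnt_subst_ne_zero hN.lc hy).imp (fun h => ⟨fun e => h.1 (by rw [e]), ihM h.2⟩)
      (fun h => ⟨ihM h.1, ihN h.2⟩)
  | weak _ _ ih => exact ih hy
  | @contr Γ x₁ x₂ z M G A B hM hz ih =>
    simp only [Graph.HasFree, Graph.hasFree_close]
    rcases Tm.cnt_subst_ne_zero (Tm.lc_fvar _) hy with ⟨h1, h2⟩ | ⟨_, h2⟩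
    · rcases Tm.cnt_subst_ne_zero (Tm.lc_fvar _) h2 with ⟨h3, h4⟩ | ⟨_, h4⟩
      · exact .inr ⟨fun e => h1 (by rw [e]), fun e => h3 (by rw [e]), ih h4⟩
      · exact .inl (Tm.cnt_fvar_ne_zero.1 h4).symm
    · exact .inl (Tm.cnt_fvar_ne_zero.1 h2).symm
  | limpR hM ih =>
    have := Tm.cnt_close_ne_zero (M := _) (k := 0) hy
    exact Graph.hasFree_close.2 ⟨this.1, ih this.2⟩
  | @limpL Γ Δ f x N M H G A B C hN hM hl ihN ihM =>
    have hc : (Tm.app (.fvar f) N).LC := fun k => by simp [hN.lc k, Tm.lc_fvar f k]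
    rw [Graph.hasFree_subst]
    refine (Tm.cnt_subst_ne_zero hc hy).imp (fun h => ⟨fun e => h.1 (by rw [e]), ihM h.2⟩)
      (fun h => ⟨ihM h.1, ?_⟩)
    by_cases hyf : y = f
    · exact .inl hyf.symm
    · exact .inr (ihN (by simpa [Tm.cnt, hyf] using h.2))
  | bang _ ih => exact ih hy

theorem Seq.mem_dom_of_hasFree {Γ : Basis} {M : Tm} {G : Graph} {A : Fm} (h : Seq Γ M G A) {y : ℕ}
    (hy : G.HasFree y) : y ∈ Γ.dom := by
  induction h generalizing y with
  | ax x A => simpa [Graph.HasFree, eq_comm] using hy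
  | cut hN hM hl ihN ihM =>
    rw [Graph.hasFree_subst] at hy
    rw [Basis.dom_add, Multiset.mem_add]
    rcases hy with ⟨h1, h2⟩ | ⟨h1, h2⟩
    · exact .inr (by simpa [h1] using ihM h2)
    · exact .inl (ihN h2)
  | weak _ _ ih => simp [ih hy]
  | contr hM hz ih =>
    simp only [Graph.HasFree, Graph.hasFree_close] at hy
    rcases hy with rfl | ⟨h1, h2, h3⟩
    · simp
    · have := ih h3
      simp [h1, h2] at this
      simp [this]
  | limpR hM ih =>
    have := Graph.hasFree_close.1 hy
    simpa [this.1] using ih this.2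
  | limpL hN hM hl ihN ihM =>
    rw [Graph.hasFree_subst] at hy
    rw [Basis.dom_cons, Basis.dom_add, Multiset.mem_cons, Multiset.mem_add]
    rcases hy with ⟨h1, h2⟩ | ⟨h1, rfl | h2⟩
    · exact .inr (.inr (by simpa [h1] using ihM h2))
    · exact .inl rfl
    · exact .inr (.inl (ihN h2))
  | bang _ ih => simpa using ih hy

theorem Seq.mem_dom_of_cnt {Γ : Basis} {M : Tm} {G : Graph} {A : Fm} (h : Seq Γ M G A) {y : ℕ}
    (hy : M.cnt (.free y) ≠ 0) : y ∈ Γ.dom := h.mem_dom_of_hasFree (h.hasFree_of_cnt hy)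

theorem Seq.cnt_eq_zero {Γ : Basis} {M : Tm} {G : Graph} {A : Fm} (h : Seq Γ M G A) {y : ℕ}
    (hy : y ∉ Γ.dom) : M.cnt (.free y) = 0 := by
  by_contra hc
  exact hy (h.mem_dom_of_cnt hc)

/-- Repeated variables are shared by fans. -/
theorem Seq.fanned {Γ : Basis} {M : Tm} {G : Graph} {A : Fm} (h : Seq Γ M G A) {y : ℕ}
    (hy : 2 ≤ M.cnt (.free y)) : G.Fanned y := by
  have hv : ∀ x, (Tm.fvar x).LC := fun x k => by simp [Tm.cnt]
  have aux : ∀ a b : ℕ, 2 ≤ a * b → (2 ≤ a ∧ b ≠ 0) ∨ (a ≠ 0 ∧ 2 ≤ b) := by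
    intro a b hab
    by_contra hc
    rcases a with _ | _ | a <;> rcases b with _ | _ | b <;> simp at hab hc
  -- Common to `cut` and `limpL`. A repetition of `y` lies in `M`, or lies in `N`, or arises from a
  -- repetition of `x`; linearity of the basis excludes that `y` occurs in both terms.
  have main : ∀ {Γ Δ : Basis} {x y : ℕ} {N M : Tm} {H G : Graph} {A B : Fm}, N.LC →
      (N.cnt (.free y) ≠ 0 → y ∈ Γ.dom ∧ H.HasFree y) → Seq ((x, A) ::ₘ Δ) M G B →
      (Γ + Δ).Linear → (2 ≤ N.cnt (.free y) → H.Fanned y) →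
      (∀ y, 2 ≤ M.cnt (.free y) → G.Fanned y) →
      2 ≤ (M.subst x N).cnt (.free y) → (G.subst x H).Fanned y := by
    intro Γ Δ x y N M H G A B hN hfree hM hl ihN ihM hy
    rw [Tm.cnt_subst hN] at hy
    rw [Graph.fanned_subst]
    by_cases h0 : M.cnt (.free x) * N.cnt (.free y) = 0
    · left
      rw [h0] at hy
      by_cases hyx : y = x
      · subst hyx; simp at hy
      · simp [hyx] at hy
        exact ⟨hyx, ihM y hy⟩
    · right
      have hyN : N.cnt (.free y) ≠ 0 := right_ne_zero_of_mul h0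
      have hyM : (if Name.free y = Name.free x then 0 else M.cnt (.free y)) = 0 := by
        by_cases hyx : y = x
        · simp [hyx]
        · simp only [Name.free.injEq, hyx, if_false]
          refine hM.cnt_eq_zero ?_
          have := (hfree hyN).1
          simp [Basis.Linear, Multiset.nodup_add] at hl
          simp [hyx]
          exact Multiset.disjoint_left.1 hl.2.2 this
      rw [hyM, zero_add] at hy
      rcases aux _ _ hy with ⟨h1, h2⟩ | ⟨h1, h2⟩
      · exact .inl ⟨ihM x h1, (hfree h2).2⟩
      · exact .inr ⟨hM.hasFree_of_cnt h1, ihN h2⟩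
  induction h generalizing y with
  | ax x A => simp [Tm.cnt] at hy; split at hy <;> omega
  | @cut Γ Δ x N M H G A B hN hM hl ihN ihM =>
    exact main hN.lc (fun h => ⟨hN.mem_dom_of_cnt h, hN.hasFree_of_cnt h⟩) hM hl ihN
      (fun _ => ihM) hy
  | weak _ _ ih => exact ih hy
  | @contr Γ x₁ x₂ z M G A B hM hz ih =>
    simp only [Graph.Fanned, Graph.HasFree, Graph.fanned_close]
    by_cases hyz : y = z
    · exact .inl hyz.symm
    · right
      simp only [Tm.cnt_subst (hv _)] at hy
      have hz0 : (Tm.fvar z).cnt (.free y) = 0 := by simp [Tm.cnt, hyz]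
      rw [hz0] at hy
      by_cases e2 : y = x₂
      · simp [e2] at hy
      · by_cases e1 : y = x₁
        · simp [e1] at hy
        · exact ⟨e2, e1, ih (by simpa [e1, e2] using hy)⟩
  | @limpR Γ x M G A B hM ih =>
    simp only [Graph.Fanned, Graph.fanned_close]
    rw [Tm.cnt_lam, Tm.close_eq_ren] at hy
    have hyx : y ≠ x := by
      rintro rfl
      obtain ⟨u, hu, hk⟩ := Tm.cnt_ren_ne_zero (Nat.ne_of_gt (lt_of_lt_of_le two_pos hy))
      split at hk
      · simp at hk
      · next hne => exact hne hk
    refine ⟨hyx, ih ?_⟩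
    rw [Tm.cnt_ren_of_forall (u := .free y)] at hy
    · exact hy
    · intro w
      split
      · next h => subst h; simp [Ne.symm hyx]
      · rfl
  | @limpL Γ Δ f x N M H G A B C hN hM hl ihN ihM =>
    have hc : (Tm.app (.fvar f) N).LC := fun k => by simp [hN.lc k, hv _ k]
    have hl' := hl
    simp [Basis.Linear] at hl
    refine main (Γ := (f, .limp A B) ::ₘ Γ) hc ?_ hM (by simpa using hl') ?_ (fun _ => ihM) hy
    · intro h
      by_cases hyf : y = f
      · subst hyf; simp [Graph.HasFree]
      · have : N.cnt (.free y) ≠ 0 := by simpa [Tm.cnt, hyf] using h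
        exact ⟨by simp [hN.mem_dom_of_cnt this], .inr (hN.hasFree_of_cnt this)⟩
    · intro h
      by_cases hyf : y = f
      · subst hyf
        have : N.cnt (.free y) = 0 := hN.cnt_eq_zero hl.1.1
        simp [Tm.cnt, this] at h
      · exact .inr (ihN (by simpa [Tm.cnt, hyf] using h))
  | bang _ ih => exact ih hy

/-- The delicate case plugs a term into a derivation of the variable `x` itself: the node then has
to come from the plugged graph, and `Graph.HasFree.rootIsNode_subst` carries it to the root. -/
theorem Seq.rootIsNode {Γ : Basis} {M : Tm} {G : Graph} {A : Fm} (h : Seq Γ M G A)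
    (hG : G.FansShareVars) (hM : ∀ y, M ≠ .fvar y) : G.RootIsNode := by
  have main : ∀ {Γ : Basis} {x : ℕ} {N M : Tm} {H G : Graph} {B : Fm},
      Seq Γ M G B → (H.FansShareVars → (∀ y, N ≠ .fvar y) → H.RootIsNode) →
      (G.FansShareVars → (∀ y, M ≠ .fvar y) → G.RootIsNode) →
      (G.subst x H).FansShareVars → (∀ y, M.subst x N ≠ .fvar y) → (G.subst x H).RootIsNode := by
    intro Γ x N M H G B hM ihN ihM hG hv
    by_cases h : ∃ y, M = .fvar y
    · obtain ⟨y, rfl⟩ := h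
      by_cases hyx : y = x
      · subst hyx
        have hy := hM.hasFree_of_cnt (y := y) (by simp [Tm.cnt])
        simp only [Tm.subst, if_true] at hv
        exact hy.rootIsNode_subst (ihN (hy.fansShareVars hG) hv) hG
      · exact absurd (by simp [Tm.subst, hyx]) (hv y)
    · push Not at h
      exact (ihM (Graph.fansShareVars_of_subst hG) h).subst H
  induction h with
  | ax x A => exact absurd rfl (hM x)
  | cut hN hM' hl ihN ihM => exact main hM' ihN ihM hG hM
  | weak _ _ ih => exact ih hG hM
  | @contr Γ x₁ x₂ z M G A B _ hz ih =>
    simp only [Graph.RootIsNode, Graph.rootIsNode_close]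
    refine ih (by simpa using hG.2.2) ?_
    rintro y rfl
    by_cases e1 : y = x₁
    · by_cases e3 : z = x₂ <;> simp [Tm.subst, e1, e3] at hM
    · simp only [Tm.subst, e1, if_false] at hM
      by_cases e2 : y = x₂ <;> simp [e2] at hM
  | limpR => trivial
  | limpL hN hM' hl ihN ihM => exact main hM' (fun _ _ => trivial) ihM hG hM
  | bang _ ih => exact ih hG hM

/-! ### From derivations to typing with levels -/

/-- At a variable, entering and leaving boxes changes depth and type in step, so every typing of a
variable amounts to the variable rule. -/
theorem Leveled.type_of_toTm {γ : LCtx} {r : ℕ} {M : Tm} {A : Fm} {v : Name} (h : Leveled γ r M A)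
    (hM : M = v.toTm) (hl : (γ v).2 ≤ r) : (γ v).1 = Fm.bang^[r - (γ v).2] A := by
  induction h with
  | var u hu _ hT => rw [hM] at hu; rw [Name.toTm_injective hu]; exact hT
  | lam => cases v <;> simp [Name.toTm] at hM
  | app => cases v <;> simp [Name.toTm] at hM
  | enter _ ih =>
    rw [ih hM (by omega), Nat.succ_sub hl]
    rfl
  | exit _ hl' ih =>
    have := hl' v (by simp [hM])
    rw [ih hM this, Nat.succ_sub this]
    rfl

/-- A typing of `N` is required only if `x` occurs in `M`: otherwise the graph of `N` may be missing
from the whole graph, and nothing is known about its fans. -/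
theorem Leveled.subst_zero {γ : LCtx} {M N : Tm} {A B : Fm} {x : ℕ}
    (hM : Leveled (Function.update γ (.free x) (A, 0)) 0 M B) (hc : N.LC)
    (hN : M.cnt (.free x) ≠ 0 → Leveled γ 0 N A) (hl : ∀ v, N.cnt v ≠ 0 → (γ v).2 = 0) :
    Leveled γ 0 (M.subst x N) B := by
  by_cases hx : M.cnt (.free x) = 0
  · rw [Tm.subst_of_cnt_eq_zero _ hx]
    refine hM.congr fun v hv => ?_
    rw [Function.update_of_ne]
    rintro rfl
    exact hv hx
  · refine hM.subst (by simpa using hN hx) hc (by simpa using hl) fun v hv _ => ?_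
    rw [Function.update_of_ne hv]

/-- The second conjunct is the condition that the abstraction rule of `Leveled` asks for. A cut
preserves it because a duplicated wire can only receive a variable, which then has the same banged
type. -/
theorem Seq.leveled {Γ : Basis} {M : Tm} {G : Graph} {A : Fm} (h : Seq Γ M G A)
    (hG : G.FansShareVars) {γ : LCtx} (hγ : ∀ p ∈ Γ, γ (.free p.1) = (p.2, 0)) :
    Leveled γ 0 M A ∧ ∀ p ∈ Γ, 2 ≤ M.cnt (.free p.1) → p.2.IsBang := by
  have hv : ∀ x, (Tm.fvar x).LC := fun x k => by simp [Tm.cnt]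
  have zero : ∀ {Γ : Basis} {N : Tm}, N.LC → (∀ y, N.cnt (.free y) ≠ 0 → y ∈ Γ.dom) →
      ∀ {γ : LCtx}, (∀ p ∈ Γ, γ (.free p.1) = (p.2, 0)) → ∀ v, N.cnt v ≠ 0 → (γ v).2 = 0 := by
    intro Γ N hN hd γ hγ v hv
    cases v with
    | bound k => exact absurd (hN k) hv
    | free y =>
      obtain ⟨A, hA⟩ := Basis.mem_dom.1 (hd y hv)
      rw [hγ _ hA]
  have upd : ∀ {Γ : Basis} {x : ℕ} {A : Fm}, Basis.Linear ((x, A) ::ₘ Γ) → ∀ {γ : LCtx},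
      (∀ p ∈ Γ, γ (.free p.1) = (p.2, 0)) → ∀ p ∈ (x, A) ::ₘ Γ,
      Function.update γ (.free x) (A, 0) (.free p.1) = (p.2, 0) := by
    intro Γ x A hl γ hγ p hp'
    rcases Multiset.mem_cons.1 hp' with rfl | hp
    · simp
    · have : p.1 ≠ x := by
        rintro rfl
        simp [Basis.Linear] at hl
        exact hl.1 (Multiset.mem_map_of_mem _ ‹p ∈ Γ›)
      rw [Function.update_of_ne (by simpa using this)]
      exact hγ p hp
  induction h generalizing γ with
  | ax x A =>
    have := hγ (x, A) (by simp)
    refine ⟨.var (.free x) rfl (by simp [this]) (by simp [this]), ?_⟩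
    intro p hp h2
    simp [Tm.cnt] at h2
    split at h2 <;> omega
  | @cut Γ Δ x N M H G A B hN hM hl ihN ihM =>
    have hΓ : ∀ p ∈ Γ, γ (.free p.1) = (p.2, 0) := fun p hp => hγ p (by simp [hp])
    have hΔ : ∀ p ∈ Δ, γ (.free p.1) = (p.2, 0) := fun p hp => hγ p (by simp [hp])
    have hGM := Graph.fansShareVars_of_subst hG
    obtain ⟨hM1, hM2⟩ := ihM hGM (upd hM.linear hΔ)
    have hN' : M.cnt (.free x) ≠ 0 → _ := fun hx =>
      ihN ((hM.hasFree_of_cnt hx).fansShareVars hG) hΓ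
    refine ⟨hM1.subst_zero hN.lc (fun hx => (hN' hx).1)
      (zero hN.lc (fun y => hN.mem_dom_of_cnt) hΓ), fun p hp h2 => ?_⟩
    have hdisj : ∀ y, y ∈ Γ.dom → y ∉ Δ.dom := by
      simp [Basis.Linear, Multiset.nodup_add] at hl
      exact fun y h1 => Multiset.disjoint_left.1 hl.2.2 h1
    rw [Tm.cnt_subst hN.lc] at h2
    rcases Multiset.mem_add.1 hp with hp | hp
    · have hpd : p.1 ∈ Γ.dom := Multiset.mem_map_of_mem _ hp
      have h0 : (if Name.free p.1 = Name.free x then 0 else M.cnt (.free p.1)) = 0 := by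
        by_cases hpx : p.1 = x
        · simp [hpx]
        · simp only [Name.free.injEq, hpx, if_false]
          exact hM.cnt_eq_zero (by simpa [hpx] using hdisj _ hpd)
      rw [h0, zero_add] at h2
      have hx : M.cnt (.free x) ≠ 0 := by intro h; simp [h] at h2
      by_cases hN2 : 2 ≤ N.cnt (.free p.1)
      · exact (hN' hx).2 p hp hN2
      -- Here the repetition comes from duplicating `x`. The restriction on fans forces `N` to be a
      -- variable, and its type inherits the `!` of the type of `x`.
      · have hM3 : 2 ≤ M.cnt (.free x) := by
          have : N.cnt (.free p.1) ≤ 1 := by omega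
          nlinarith
        have hNv : ∃ y, N = .fvar y := by
          by_contra hc
          push Not at hc
          have hf := (hM.hasFree_of_cnt hx).fansShareVars hG
          exact Graph.not_fanned_of_subst (hN.rootIsNode hf hc) hG (hM.fanned hM3)
        obtain ⟨y, rfl⟩ := hNv
        have hyp : p.1 = y := by
          by_contra hc
          simp [Tm.cnt, hc] at h2
        subst hyp
        have := (hN' hx).1.type_of_toTm (v := .free p.1) rfl (by simp [hΓ p hp])
        rw [hΓ p hp] at this
        have h3 := hM2 (x, A) (by simp) hM3
        simp at this h3
        rwa [this]
    · have hpd : p.1 ∈ Δ.dom := Multiset.mem_map_of_mem _ hp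
      have : N.cnt (.free p.1) = 0 := hN.cnt_eq_zero fun h => hdisj _ h hpd
      have hpx : p.1 ≠ x := by
        have := hM.linear
        simp [Basis.Linear] at this
        rintro rfl
        exact this.1 hpd
      simp [this, hpx] at h2
      exact hM2 p (by simp [hp]) h2
  | @weak Γ x M G A B hM hx ih =>
    obtain ⟨h1, h2⟩ := ih hG fun p hp => hγ p (by simp [hp])
    refine ⟨h1, fun p hp h3 => ?_⟩
    rcases Multiset.mem_cons.1 hp with rfl | hp
    · have := hM.cnt_eq_zero hx
      simp [this] at h3
    · exact h2 p hp h3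
  | @contr Γ x₁ x₂ z M G A B hM hz ih =>
    have hΓ : ∀ p ∈ Γ, γ (.free p.1) = (p.2, 0) := fun p hp => hγ p (by simp [hp])
    have hl := hM.linear
    simp [Basis.Linear] at hl
    have hl2 : Basis.Linear ((x₂, .bang A) ::ₘ Γ) := by simpa [Basis.Linear] using hl.2
    obtain ⟨h1, h2⟩ := ih (by simpa using hG.2.2)
      (upd hM.linear (upd hl2 hΓ))
    constructor
    · simp only [Tm.subst_fvar_eq_ren, Tm.ren_ren]
      refine h1.ren fun v hv' => ?_
      have hz' := hγ (z, .bang A) (by simp)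
      by_cases e1 : v = .free x₁
      · subst e1
        simp [hz']
      · by_cases e2 : v = .free x₂
        · subst e2
          simp [e1, hz']
        · simp [e1, e2]
    · intro p hp h3
      rcases Multiset.mem_cons.1 hp with rfl | hp
      · exact ⟨A, rfl⟩
      · have hpd : p.1 ∈ Γ.dom := Multiset.mem_map_of_mem _ hp
        have e1 : p.1 ≠ x₁ := fun h => hl.1.2 (h ▸ hpd)
        have e2 : p.1 ≠ x₂ := fun h => hl.2.1 (h ▸ hpd)
        have e3 : p.1 ≠ z := fun h => hz (h ▸ hpd)
        simp [Tm.cnt_subst (hv _), Tm.cnt, e1, e2, e3] at h3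
        exact h2 p (by simp [hp]) h3
  | @limpR Γ x M G A B hM ih =>
    obtain ⟨h1, h2⟩ := ih (γ := Function.update γ (.free x) (A, 0))
      (by simpa [Graph.FansShareVars] using hG) (upd hM.linear hγ)
    have inj : ∀ v : Name, M.cnt v ≠ 0 → ∀ k, v ≠ .bound k := by
      rintro v hv k rfl
      exact hv (hM.lc k)
    constructor
    · rw [Tm.close_eq_ren]
      refine .lam (h1.ren fun v hv => ?_) fun h3 => h2 (x, A) (by simp) ?_
      · by_cases e : v = .free x
        · subst e; simp
        · cases v with
          | free y => simp at e; simp [e]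
          | bound k => exact absurd (hM.lc k) hv
      -- Exchanging `x` with index `0`, instead of sending both to index `0`, makes the fibre over
      -- index `0` a single point; on a term without dangling indices the two renamings agree.
      · have : (M.ren fun v => if v = .free x then .bound 0 else v) = M.ren fun v =>
            if v = .free x then .bound 0 else if v = .bound 0 then .free x else v := by
          refine Tm.ren_congr fun u hu => ?_
          simp [inj u hu 0]
        rw [this, Tm.cnt_ren_of_forall (u := .free x)] at h3
        · exact h3
        · intro w
          split
          · simp_all
          · split
            · simp_all
            · simp_all
    · intro p hp h3
      have hpx : p.1 ≠ x := by
        have := hM.linear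
        simp [Basis.Linear] at this
        rintro rfl
        exact this.1 (Multiset.mem_map_of_mem _ hp)
      refine h2 p (by simp [hp]) ?_
      rw [Tm.cnt_lam, Tm.close_eq_ren, Tm.cnt_ren_of_forall (u := .free p.1)] at h3
      · exact h3
      · intro w
        split
        · next h => subst h; simp [Ne.symm hpx]
        · rfl
  | @limpL Γ Δ f x N M H G A B C hN hM hl ihN ihM =>
    have hΓ : ∀ p ∈ Γ, γ (.free p.1) = (p.2, 0) := fun p hp => hγ p (by simp [hp])
    have hΔ : ∀ p ∈ Δ, γ (.free p.1) = (p.2, 0) := fun p hp => hγ p (by simp [hp])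
    have hf : γ (.free f) = (.limp A B, 0) := hγ (f, .limp A B) (by simp)
    have hGM := Graph.fansShareVars_of_subst hG
    obtain ⟨hM1, hM2⟩ := ihM hGM (upd hM.linear hΔ)
    have hN' : M.cnt (.free x) ≠ 0 → _ := fun hx =>
      ihN ((hM.hasFree_of_cnt hx).fansShareVars hG).2 hΓ
    have hc : (Tm.app (.fvar f) N).LC := fun k => by simp [hN.lc k, hv _ k]
    simp [Basis.Linear, Multiset.nodup_add] at hl
    have hdisj : ∀ y, y ∈ Γ.dom → y ∉ Δ.dom := fun y h1 => Multiset.disjoint_left.1 hl.2.2.2 h1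
    -- An application node replaces `x`, so no fan may share `x`.
    have hx1 : M.cnt (.free x) ≤ 1 := by
      by_contra hc
      exact Graph.not_fanned_of_subst (by trivial) hG (hM.fanned (y := x) (by omega))
    have hNf : N.cnt (.free f) = 0 := hN.cnt_eq_zero hl.1.1
    refine ⟨hM1.subst_zero hc (fun hx => .app (.var (.free f) rfl (by simp [hf]) (by simp [hf]))
      (hN' hx).1) (zero (Γ := (f, .limp A B) ::ₘ Γ) hc ?_ ?_), fun p hp h2 => ?_⟩
    · intro y hy
      by_cases hyf : y = f
      · simp [hyf]
      · simp [Tm.cnt, hyf] at hy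
        simp [hN.mem_dom_of_cnt hy]
    · intro p hp
      rcases Multiset.mem_cons.1 hp with rfl | hp
      · exact hf
      · exact hΓ p hp
    · rw [Tm.cnt_subst hc] at h2
      have outside : p.1 ∉ Δ.dom → (if Name.free p.1 = Name.free x then 0
          else M.cnt (.free p.1)) = 0 := by
        intro hpd
        by_cases hpx : p.1 = x
        · simp [hpx]
        · simp only [Name.free.injEq, hpx, if_false]
          exact hM.cnt_eq_zero (by simpa [hpx] using hpd)
      rcases Multiset.mem_cons.1 hp with rfl | hp
      · have := outside hl.1.2
        simp only at this
        rw [this] at h2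
        simp [Tm.cnt, hNf] at h2
        omega
      rcases Multiset.mem_add.1 hp with hp | hp
      · have hpd : p.1 ∈ Γ.dom := Multiset.mem_map_of_mem _ hp
        have hpf : p.1 ≠ f := fun h => hl.1.1 (h ▸ hpd)
        rw [outside (hdisj _ hpd)] at h2
        simp [Tm.cnt, hpf] at h2
        have hx : M.cnt (.free x) ≠ 0 := by intro h; simp [h] at h2
        refine (hN' hx).2 p hp ?_
        nlinarith
      · have hpd : p.1 ∈ Δ.dom := Multiset.mem_map_of_mem _ hp
        have h0 : N.cnt (.free p.1) = 0 := hN.cnt_eq_zero fun h => hdisj _ h hpd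
        have hpf : p.1 ≠ f := fun h => hl.1.2 (h ▸ hpd)
        have hpx : p.1 ≠ x := by
          have := hM.linear
          simp [Basis.Linear] at this
          rintro rfl
          exact this.1 hpd
        simp [Tm.cnt, h0, hpf, hpx] at h2
        exact hM2 p (by simp [hp]) h2
  | @bang Γ M G B hM ih =>
    classical
    -- The premise needs the types before the `!`s are added; the values outside `Γ` are irrelevant.
    let γ' : LCtx := fun v => match v with
      | .free y => if h : ∃ A, (y, A) ∈ Γ then (h.choose, 0) else (.var 0, 0)
      | .bound k => γ (.bound k)
    have uniq : ∀ {y A B}, (y, A) ∈ Γ → (y, B) ∈ Γ → A = B := by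
      intro y A B h1 h2
      have := Multiset.inj_on_of_nodup_map hM.linear (y, A) h1 (y, B) h2 rfl
      simpa using this
    have hγ' : ∀ p ∈ Γ, γ' (.free p.1) = (p.2, 0) := by
      intro p hp
      have h : ∃ A, (p.1, A) ∈ Γ := ⟨p.2, hp⟩
      simp only [γ', dif_pos h]
      rw [uniq h.choose_spec hp]
    obtain ⟨h1, h2⟩ := ih hG hγ'
    constructor
    -- Promotion: the banged declarations allow the whole typing to be moved one box deeper, and
    -- that box is then entered at the root.
    · refine .enter (h1.raise fun v hv' => ?_)
      cases v with
      | bound k => exact absurd (hM.lc k) hv'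
      | free y =>
        obtain ⟨A, hA⟩ := Basis.mem_dom.1 (hM.mem_dom_of_cnt hv')
        right
        rw [hγ' _ hA]
        exact hγ (y, .bang A) (Multiset.mem_map.2 ⟨(y, A), hA, rfl⟩)
    · intro p hp _
      obtain ⟨q, _, rfl⟩ := Multiset.mem_map.1 hp
      exact ⟨_, rfl⟩

/-! ### Derivations with controlled sharing -/

/-- Plugging is harmless if the wire is not on the principal side of a fan, or if what is plugged in
has no node at its root. -/
theorem Graph.FansShareVars.subst {x : ℕ} {G H : Graph} (hG : G.FansShareVars)
    (hH : H.FansShareVars) (hx : ¬ G.Fanned x ∨ ¬ H.RootIsNode) :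
    (G.subst x H).FansShareVars := by
  have root : ∀ P : Graph, ¬ P.RootIsNode → ¬ P.HasFree x ∨ ¬ H.RootIsNode →
      ¬ (P.subst x H).RootIsNode := by
    intro P hP h
    rcases h with h | h
    · rwa [Graph.subst_of_not_hasFree _ h]
    · induction P with
      | fvar y =>
        by_cases hy : y = x
        · simpa [Graph.subst, hy] using h
        · simpa [Graph.subst, hy] using hP
      | bvar _ => exact id
      | lam => exact absurd trivial hP
      | app => exact absurd trivial hP
      | fan _ _ _ ih2 => exact ih2 hP
  induction G with
  | fvar y => by_cases hy : y = x <;> simp [Graph.subst, hy, hH, Graph.FansShareVars]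
  | bvar _ => trivial
  | lam _ ih => exact ih hG hx
  | app G₁ G₂ ih1 ih2 =>
    exact ⟨ih1 hG.1 (hx.imp_left fun h h' => h (.inl h')),
      ih2 hG.2 (hx.imp_left fun h h' => h (.inr h'))⟩
  | fan P Q ih1 ih2 =>
    refine ⟨root P hG.1 (hx.imp_left fun h h' => h (.inl h')),
      ih1 hG.2.1 (hx.imp_left fun h h' => h (.inl h'.hasFree)),
      ih2 hG.2.2 (hx.imp_left fun h h' => h (.inr h'))⟩

/-- A derivation in which fans share only variables, and no free variables outside `Z`. -/
def SeqOn (Z : Set ℕ) (Γ : Basis) (M : Tm) (A : Fm) : Prop :=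
  ∃ G, Seq Γ M G A ∧ G.FansShareVars ∧ ∀ x, G.Fanned x → x ∈ Z

theorem SeqOn.mono {Z Z' : Set ℕ} {Γ : Basis} {M : Tm} {A : Fm} (h : SeqOn Z Γ M A)
    (hZ : Z ⊆ Z') : SeqOn Z' Γ M A :=
  let ⟨G, h1, h2, h3⟩ := h
  ⟨G, h1, h2, fun x hx => hZ (h3 x hx)⟩

theorem SeqOn.linear {Z : Set ℕ} {Γ : Basis} {M : Tm} {A : Fm} (h : SeqOn Z Γ M A) : Γ.Linear :=
  let ⟨_, h1, _, _⟩ := h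
  h1.linear

theorem SeqOn.lc {Z : Set ℕ} {Γ : Basis} {M : Tm} {A : Fm} (h : SeqOn Z Γ M A) : M.LC :=
  let ⟨_, h1, _, _⟩ := h
  h1.lc

theorem SeqOn.mem_dom_of_cnt {Z : Set ℕ} {Γ : Basis} {M : Tm} {A : Fm} (h : SeqOn Z Γ M A)
    {y : ℕ} (hy : M.cnt (.free y) ≠ 0) : y ∈ Γ.dom :=
  let ⟨_, h1, _, _⟩ := h
  h1.mem_dom_of_cnt hy

theorem SeqOn.ax (Z : Set ℕ) (x : ℕ) (A : Fm) : SeqOn Z {(x, A)} (.fvar x) A :=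
  ⟨_, .ax x A, trivial, fun _ h => h.elim⟩

theorem SeqOn.weak {Z : Set ℕ} {Γ : Basis} {M : Tm} {A B : Fm} {x : ℕ} (h : SeqOn Z Γ M B)
    (hx : x ∉ Γ.dom) : SeqOn Z ((x, A) ::ₘ Γ) M B :=
  let ⟨G, h1, h2, h3⟩ := h
  ⟨G, .weak h1 hx, h2, h3⟩

theorem SeqOn.weak_le {Z : Set ℕ} {Γ Δ : Basis} {M : Tm} {B : Fm} (h : SeqOn Z Γ M B)
    (hle : Γ ≤ Δ) (hΔ : Δ.Linear) : SeqOn Z Δ M B := by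
  obtain ⟨Θ, rfl⟩ := Multiset.le_iff_exists_add.1 hle
  clear hle
  induction Θ using Multiset.induction with
  | empty => simpa using h
  | cons p Θ ih =>
    rw [Multiset.add_cons] at hΔ ⊢
    simp only [Basis.Linear, Basis.dom_cons, Multiset.nodup_cons] at hΔ
    exact (ih hΔ.2).weak hΔ.1

theorem SeqOn.bang {Z : Set ℕ} {Γ : Basis} {M : Tm} {B : Fm} (h : SeqOn Z Γ M B) :
    SeqOn Z (Γ.map fun p => (p.1, .bang p.2)) M (.bang B) :=
  let ⟨G, h1, h2, h3⟩ := h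
  ⟨G, .bang h1, h2, h3⟩

/-- If no free wire is fanned, a cut neither makes a fan face a node nor creates a fanned free wire.
This is why contractions are made only right before an abstraction or at the very end. -/
theorem SeqOn.cut {Γ Δ : Basis} {M N : Tm} {A B : Fm} {x : ℕ} (hN : SeqOn ∅ Γ N A)
    (hM : SeqOn ∅ ((x, A) ::ₘ Δ) M B) (hl : (Γ + Δ).Linear) :
    SeqOn ∅ (Γ + Δ) (M.subst x N) B := by
  obtain ⟨H, hN1, hN2, hN3⟩ := hN
  obtain ⟨G, hM1, hM2, hM3⟩ := hM
  refine ⟨_, .cut hN1 hM1 hl, hM2.subst hN2 (.inl fun h => hM3 x h), fun y hy => ?_⟩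
  rcases Graph.fanned_subst.1 hy with h | h | h
  · exact hM3 y h.2
  · exact (hM3 x h.1).elim
  · exact hN3 y h.2

/-- Application of a variable to a variable. -/
theorem SeqOn.app_vars {f x : ℕ} (hfx : f ≠ x) (A B : Fm) :
    SeqOn ∅ ((f, .limp A B) ::ₘ {(x, A)}) (.app (.fvar f) (.fvar x)) B := by
  have := Seq.limpL (f := f) (Seq.ax x A) (Δ := 0) (Seq.ax x B)
    (by simp [Basis.Linear, hfx])
  simp only [Tm.subst, Graph.subst, if_true, add_zero] at this
  exact ⟨_, this, ⟨trivial, trivial⟩, fun y hy => hy.elim False.elim False.elim⟩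

/-- A cut with an axiom plugs in a bare wire, so fans on `x` do no harm. -/
theorem SeqOn.rename {Γ : Basis} {M : Tm} {A T : Fm} {x y : ℕ}
    (h : SeqOn Set.univ ((x, T) ::ₘ Γ) M A) (hy : y ∉ Γ.dom) :
    SeqOn Set.univ ((y, T) ::ₘ Γ) (M.subst x (.fvar y)) A := by
  obtain ⟨G, h1, h2, -⟩ := h
  have hl := h1.linear
  simp only [Basis.Linear, Basis.dom_cons, Multiset.nodup_cons] at hl
  exact ⟨_, .cut (.ax y T) h1 (by simp [Basis.Linear, hy, hl.2]), h2.subst trivial (.inr id),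
    fun _ _ => trivial⟩

/-- The contraction rule with the name of one of the contracted variables reused for the result; its
second substitution is then trivial. -/
theorem SeqOn.merge {Z : Set ℕ} {Γ : Basis} {M : Tm} {A T : Fm} {x y : ℕ}
    (h : SeqOn Z ((x, T) ::ₘ (y, T) ::ₘ Γ) M A) (hT : T.IsBang) (hy : y ∈ Z) :
    SeqOn Z ((y, T) ::ₘ Γ) (M.subst x (.fvar y)) A := by
  obtain ⟨G, h1, h2, h3⟩ := h
  obtain ⟨T, rfl⟩ := hT
  have hl := h1.linear
  simp only [Basis.Linear, Basis.dom_cons, Multiset.nodup_cons] at hl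
  have h4 := Seq.contr h1 (z := y) hl.2.1
  have h5 : ∀ M : Tm, M.subst y (.fvar y) = M := by
    intro M
    rw [Tm.subst_fvar_eq_ren]
    conv_rhs => rw [← M.ren_id]
    refine Tm.ren_congr fun u _ => ?_
    split <;> simp_all
  rw [h5] at h4
  refine ⟨_, h4, ⟨id, trivial, by simpa using h2⟩, fun z hz => ?_⟩
  rcases hz with hz | hz
  · cases hz; exact hy
  · simp only [Graph.fanned_close] at hz
    exact h3 z hz.2.2

/-- Turn all the free variables in `xs` into the index `0`. -/
noncomputable def Name.closeAll (xs : Multiset ℕ) : Name → Name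
  | .free x => if x ∈ xs then .bound 0 else .free x
  | .bound k => .bound k

theorem SeqOn.mergeAll {Γ : Basis} {M : Tm} {A T : Fm} {y : ℕ} (xs : Multiset ℕ)
    (h : SeqOn {y} (xs.map (fun x => (x, T)) + (y, T) ::ₘ Γ) M A) (hT : xs ≠ 0 → T.IsBang) :
    SeqOn {y} ((y, T) ::ₘ Γ) (M.ren fun v =>
      match v with
      | .free x => if x ∈ xs then .free y else .free x
      | .bound k => .bound k) A := by
  induction xs using Multiset.induction generalizing M with
  | empty =>
    rw [Multiset.map_zero, zero_add] at h
    convert h using 1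
    conv_rhs => rw [← M.ren_id]
    refine Tm.ren_congr fun u _ => ?_
    cases u <;> simp
  | cons x xs ih =>
    simp only [Multiset.map_cons, Multiset.cons_add, Multiset.add_cons] at h
    rw [Multiset.cons_swap] at h
    have h1 := h.merge (hT (by simp)) rfl
    rw [← Multiset.add_cons] at h1
    have h2 := ih h1 fun _ => hT (by simp)
    rw [Tm.subst_fvar_eq_ren, Tm.ren_ren] at h2
    convert h2 using 3 with v
    cases v with
    | bound k => simp
    | free z =>
      by_cases hz : z = x
      · subst hz; simp
      · simp [hz]

/-- The copies of the bound variable are merged into one wire, the only free wire that becomes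
fanned, and binding it restores the invariant that no free wire is fanned. -/
theorem SeqOn.lam_closeAll {Γ : Basis} {M : Tm} {A T : Fm} (xs : Multiset ℕ)
    (h : SeqOn ∅ (xs.map (fun x => (x, T)) + Γ) M A)
    (hT : 2 ≤ Multiset.card xs → T.IsBang) :
    SeqOn ∅ Γ (.lam (M.ren (Name.closeAll xs))) (.limp T A) := by
  have fin : ∀ (y : ℕ) (M : Tm), SeqOn {y} ((y, T) ::ₘ Γ) M A →
      SeqOn ∅ Γ (.lam (M.close y 0)) (.limp T A) := by
    rintro y M ⟨G, h1, h2, h3⟩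
    refine ⟨_, .limpR h1, by simpa [Graph.FansShareVars] using h2, fun z hz => ?_⟩
    have := Graph.fanned_close.1 hz
    exact this.1 (h3 z this.2)
  rcases Multiset.empty_or_exists_mem xs with rfl | ⟨y, hy⟩
  -- A vacuous abstraction: weakening supplies a fresh variable to bind.
  · obtain ⟨y, hy⟩ := Infinite.exists_notMem_finset (Γ.dom.toFinset)
    have h0 : SeqOn ∅ Γ M A := by simpa using h
    have := fin y M ((h0.weak (by simpa using hy)).mono (Set.empty_subset _))
    convert this using 2
    rw [Tm.close_eq_ren]
    refine Tm.ren_congr fun u hu => ?_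
    cases u with
    | bound k => simp [Name.closeAll]
    | free z =>
      have : z ≠ y := by
        rintro rfl
        exact hy (by simpa using h0.mem_dom_of_cnt hu)
      simp [Name.closeAll, this]
  · obtain ⟨xs, rfl⟩ := Multiset.exists_cons_of_mem hy
    have h1 := SeqOn.mergeAll (y := y) (Γ := Γ) (T := T) (M := M) (A := A) xs
      (by simpa using h.mono (Set.empty_subset _)) (fun hne => hT (by
        have := Multiset.card_pos.2 hne
        simp only [Multiset.card_cons]; omega))
    have h2 := fin _ _ h1
    rw [Tm.close_eq_ren, Tm.ren_ren] at h2
    convert h2 using 3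
    refine funext fun v => ?_
    cases v with
    | bound k => simp [Name.closeAll]
    | free z =>
      by_cases hz : z = y
      · subst hz; simp [Name.closeAll]
      · by_cases hz' : z ∈ xs <;> simp [Name.closeAll, hz, hz']

/-! ### Staged derivations

A staged derivation at depth `r + 1` is a derivation for the innermost box, with the results of
staged derivations at depth `r` plugged into its free variables. -/

inductive Staged : Set ℕ → ℕ → Multiset (ℕ × Fm × ℕ) → Tm → Fm → Prop
  | base {V : Set ℕ} {r : ℕ} {Γ : Basis} {M : Tm} {A : Fm} (h : SeqOn ∅ Γ M A)
      (hV : ∀ p ∈ Γ, p.1 ∈ V) : Staged V r (Γ.map fun p => (p.1, p.2, r)) M A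
  | exit {V V₁ V₂ : Set ℕ} {r x : ℕ} {Γ Δ : Multiset (ℕ × Fm × ℕ)} {M N : Tm} {A B : Fm}
      (hN : Staged V₁ r Γ N (.bang A)) (hM : Staged V₂ (r + 1) ((x, A, r + 1) ::ₘ Δ) M B)
      (hd : Disjoint V₁ V₂) (hV : V₁ ∪ V₂ ⊆ V) : Staged V (r + 1) (Γ + Δ) (M.subst x N) B

/-- The sets `V` are pools of names. Disjoint pools keep the variables of different layers apart, so
that staged derivations can be combined without renaming. -/
theorem Staged.mem {V : Set ℕ} {r : ℕ} {Ω : Multiset (ℕ × Fm × ℕ)} {M : Tm} {A : Fm}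
    (h : Staged V r Ω M A) {p : ℕ × Fm × ℕ} (hp : p ∈ Ω) : p.1 ∈ V ∧ p.2.2 ≤ r := by
  induction h with
  | base _ hV =>
    obtain ⟨q, hq, rfl⟩ := Multiset.mem_map.1 hp
    exact ⟨hV q hq, le_rfl⟩
  | exit _ _ _ hV ihN ihM =>
    rcases Multiset.mem_add.1 hp with hp | hp
    · exact ⟨hV (.inl (ihN hp).1), (ihN hp).2.trans (Nat.le_succ _)⟩
    · have := ihM (Multiset.mem_cons_of_mem hp)
      exact ⟨hV (.inr this.1), this.2⟩

theorem Staged.nodup {V : Set ℕ} {r : ℕ} {Ω : Multiset (ℕ × Fm × ℕ)} {M : Tm} {A : Fm}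
    (h : Staged V r Ω M A) : (Ω.map Prod.fst).Nodup := by
  induction h with
  | base h _ =>
    rw [Multiset.map_map]
    exact h.linear
  | exit hN hM hd _ ihN ihM =>
    rw [Multiset.map_cons, Multiset.nodup_cons] at ihM
    rw [Multiset.map_add, Multiset.nodup_add]
    refine ⟨ihN, ihM.2, Multiset.disjoint_left.2 fun {a} ha hb => ?_⟩
    obtain ⟨p, hp, rfl⟩ := Multiset.mem_map.1 ha
    obtain ⟨q, hq, hpq⟩ := Multiset.mem_map.1 hb
    exact Set.disjoint_left.1 hd (hN.mem hp).1
      (hpq ▸ (hM.mem (Multiset.mem_cons_of_mem hq)).1)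

theorem Staged.lc {V : Set ℕ} {r : ℕ} {Ω : Multiset (ℕ × Fm × ℕ)} {M : Tm} {A : Fm}
    (h : Staged V r Ω M A) : M.LC := by
  induction h with
  | base h _ => exact h.lc
  | exit _ _ _ _ ihN ihM => intro k; rw [Tm.cnt_subst ihN, ihM k, ihN k]; simp

theorem Staged.exists_mem {V : Set ℕ} {r : ℕ} {Ω : Multiset (ℕ × Fm × ℕ)} {M : Tm} {A : Fm}
    (h : Staged V r Ω M A) {y : ℕ} (hy : M.cnt (.free y) ≠ 0) : ∃ p ∈ Ω, p.1 = y := by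
  induction h with
  | base h _ =>
    obtain ⟨A, hA⟩ := Basis.mem_dom.1 (h.mem_dom_of_cnt hy)
    exact ⟨_, Multiset.mem_map_of_mem _ hA, rfl⟩
  | exit hN _ _ hV ihN ihM =>
    rcases Tm.cnt_subst_ne_zero hN.lc hy with ⟨h1, h2⟩ | ⟨h1, h2⟩
    · obtain ⟨p, hp, rfl⟩ := ihM h2
      rcases Multiset.mem_cons.1 hp with rfl | hp
      · exact absurd rfl h1
      · exact ⟨p, by simp [hp], rfl⟩
    · obtain ⟨p, hp, rfl⟩ := ihN h2
      exact ⟨p, by simp [hp], rfl⟩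

theorem Staged.mem_of_cnt {V : Set ℕ} {r : ℕ} {Ω : Multiset (ℕ × Fm × ℕ)} {M : Tm} {A : Fm}
    (h : Staged V r Ω M A) {y : ℕ} (hy : M.cnt (.free y) ≠ 0) : y ∈ V := by
  obtain ⟨p, hp, rfl⟩ := h.exists_mem hy
  exact (h.mem hp).1

theorem Staged.cnt_eq_zero {V V' : Set ℕ} {r : ℕ} {Ω : Multiset (ℕ × Fm × ℕ)} {M : Tm} {A : Fm}
    (h : Staged V r Ω M A) (hd : Disjoint V V') {y : ℕ} (hy : y ∈ V') :
    M.cnt (.free y) = 0 := by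
  by_contra hc
  exact Set.disjoint_left.1 hd (h.mem_of_cnt hc) hy

theorem Staged.mono {V V' : Set ℕ} {r : ℕ} {Ω : Multiset (ℕ × Fm × ℕ)} {M : Tm} {A : Fm}
    (h : Staged V r Ω M A) (hV : V ⊆ V') : Staged V' r Ω M A := by
  cases h with
  | base h h' => exact .base h fun p hp => hV (h' p hp)
  | exit hN hM hd h' => exact .exit hN hM hd (h'.trans hV)

theorem Multiset.exists_add_of_add_eq {α : Type*} {s t u v : Multiset α} (h : s + t = u + v)
    (hd : ∀ a ∈ u, a ∉ s) : ∃ w, t = u + w ∧ v = s + w := by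
  classical
  have hle : u ≤ t := by
    refine Multiset.le_iff_count.2 fun a => ?_
    by_cases ha : a ∈ u
    · have := congrArg (Multiset.count a) h
      simp only [Multiset.count_add, Multiset.count_eq_zero.2 (hd a ha)] at this
      omega
    · simp [Multiset.count_eq_zero.2 ha]
  obtain ⟨w, rfl⟩ := Multiset.le_iff_exists_add.1 hle
  refine ⟨w, rfl, ?_⟩
  have : u + (s + w) = u + v := by rw [← h]; abel
  exact (add_left_cancel this).symm

/-- The cut is pushed into the innermost derivation of `N`; the outer results belonging to `N` are
plugged in after it. -/
theorem Staged.cut_base {V V₁ V₂ : Set ℕ} {r x : ℕ} {Ω : Multiset (ℕ × Fm × ℕ)} {Γ : Basis}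
    {M N : Tm} {C B : Fm} (hN : Staged V₁ r Ω N C) (hM : SeqOn ∅ ((x, C) ::ₘ Γ) M B)
    (hV₂ : ∀ p ∈ (x, C) ::ₘ Γ, p.1 ∈ V₂) (hd : Disjoint V₁ V₂) (hV : V₁ ∪ V₂ ⊆ V) :
    Staged V r (Ω + Γ.map fun p => (p.1, p.2, r)) (M.subst x N) B := by
  induction hN generalizing V with
  | @base V₁ r Δ N C h h' =>
    rw [← Multiset.map_add]
    refine .base (h.cut hM ?_) fun p hp => ?_
    · have hl := hM.linear
      simp only [Basis.Linear, Basis.dom_cons, Multiset.nodup_cons] at hl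
      simp only [Basis.Linear, Basis.dom_add, Multiset.nodup_add]
      refine ⟨h.linear, hl.2, Multiset.disjoint_left.2 fun {a} ha hb => ?_⟩
      obtain ⟨A, hA⟩ := Basis.mem_dom.1 ha
      obtain ⟨B, hB⟩ := Basis.mem_dom.1 hb
      exact Set.disjoint_left.1 hd (h' _ hA) (hV₂ (a, B) (by simp [hB]))
    · rcases Multiset.mem_add.1 hp with hp | hp
      · exact hV (.inl (h' p hp))
      · exact hV (.inr (hV₂ p (by simp [hp])))
  | @exit V₁ W₁ W₂ r y Δ₁ Δ₂ N₀ N₁ A C hN₁ hN₀ hd' hV' _ ih =>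
    have hd₁ : Disjoint W₁ V₂ := hd.mono_left (Set.subset_union_left.trans hV')
    have hd₂ : Disjoint W₂ V₂ := hd.mono_left (Set.subset_union_right.trans hV')
    have := ih hM hV₂ hd₂ (V := W₂ ∪ V₂) subset_rfl
    rw [Multiset.cons_add] at this
    have hy : M.cnt (.free y) = 0 := by
      by_contra hc
      obtain ⟨A', hA⟩ := Basis.mem_dom.1 (hM.mem_dom_of_cnt hc)
      exact Set.disjoint_left.1 hd₂ (hN₀.mem (Multiset.mem_cons_self _ _)).1 (hV₂ _ hA)
    rw [Tm.subst_subst hy, add_assoc]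
    refine .exit hN₁ this (Set.disjoint_union_right.2 ⟨hd', hd₁⟩) ?_
    rw [← Set.union_assoc]
    exact (Set.union_subset_union_left _ hV').trans hV

/-- As `x` has the innermost level, it belongs to the innermost derivation of `M`, and the cut can
be moved past the outer results plugged into `M`. -/
theorem Staged.cut {V V₁ V₂ : Set ℕ} {r x : ℕ} {Γ Δ : Multiset (ℕ × Fm × ℕ)}
    {M N : Tm} {C B : Fm} (hN : Staged V₁ r Γ N C) (hM : Staged V₂ r ((x, C, r) ::ₘ Δ) M B)
    (hd : Disjoint V₁ V₂) (hV : V₁ ∪ V₂ ⊆ V) : Staged V r (Γ + Δ) (M.subst x N) B := by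
  classical
  generalize hΩ : (x, C, r) ::ₘ Δ = Ω at hM
  induction hM generalizing V Δ with
  | @base V₂ r Θ M B h h' =>
    obtain ⟨p, hp, hpx, hp'⟩ := (Multiset.map_eq_cons _ _ _ _).2 hΩ.symm
    obtain ⟨Θ, rfl⟩ := Multiset.exists_cons_of_mem hp
    obtain ⟨y, D⟩ := p
    simp only [Prod.mk.injEq, and_true] at hpx
    obtain ⟨rfl, rfl⟩ := hpx
    rw [Multiset.erase_cons_head] at hp'
    subst hp'
    exact hN.cut_base h h' hd hV
  | @exit V₂ W₁ W₂ r y Δ₁ Δ₂ M₀ M₁ A B hM₁ hM₀ hd' hV' _ ih =>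
    -- The declarations of the outer layer `M₁` have level at most `r`, so `x` is not among them.
    obtain ⟨Θ, rfl, rfl⟩ := Multiset.exists_add_of_add_eq (u := {(x, C, r + 1)}) (v := Δ)
      (s := Δ₁) (t := Δ₂) (by rw [← hΩ]; rfl) (fun a ha h => by
        rw [Multiset.mem_singleton] at ha
        subst ha
        have := (hM₁.mem h).2
        simp at this)
    have hd₁ : Disjoint V₁ W₁ := hd.mono_right (Set.subset_union_left.trans hV')
    have hd₂ : Disjoint V₁ W₂ := hd.mono_right (Set.subset_union_right.trans hV')
    have := ih hN hd₂ (V := V₁ ∪ W₂) subset_rfl (Δ := (y, A, r + 1) ::ₘ Θ)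
      (by rw [Multiset.singleton_add, Multiset.cons_swap])
    rw [Multiset.add_cons] at this
    have hx : x ∈ W₂ := (hM₀.mem (p := (x, C, r + 1)) (by simp)).1
    have hy : y ∈ W₂ := (hM₀.mem (p := (y, A, r + 1)) (by simp)).1
    have hyx : x ≠ y := by
      rintro rfl
      have := hM₀.nodup
      simp at this
    rw [Tm.subst_comm hyx.symm (hM₁.cnt_eq_zero hd' hx) (hN.cnt_eq_zero hd₂ hy)]
    have e : Γ + (Δ₁ + Θ) = Δ₁ + (Γ + Θ) := by abel
    rw [e]
    refine .exit hM₁ this (Set.disjoint_union_right.2 ⟨hd₁.symm, hd'⟩) ?_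
    refine Set.union_subset ?_ (Set.union_subset ?_ ?_)
    · exact (Set.subset_union_left.trans hV').trans (Set.subset_union_right.trans hV)
    · exact Set.subset_union_left.trans hV
    · exact (Set.subset_union_right.trans hV').trans (Set.subset_union_right.trans hV)

/-- A term that has left the box is the value of a fresh variable inside it; the inner layer is just
the axiom for that variable. -/
theorem Staged.leave {V V' : Set ℕ} {r x : ℕ} {Ω : Multiset (ℕ × Fm × ℕ)} {M : Tm} {A : Fm}
    (h : Staged V r Ω M (.bang A)) (hx : x ∉ V) (hV : insert x V ⊆ V') :
    Staged V' (r + 1) Ω M A := by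
  have h1 := Staged.base (V := {x}) (r := r + 1) (SeqOn.ax ∅ x A) (by simp)
  have h2 := Staged.exit (V := V') (Δ := 0) h h1 (Set.disjoint_singleton_right.2 hx)
    (by rw [Set.union_comm]; exact hV)
  simpa [Tm.subst] using h2

/-- The context as seen from outside of the box at depth `r + 1`. -/
def lower (r : ℕ) (p : ℕ × Fm × ℕ) : ℕ × Fm × ℕ :=
  if p.2.2 = r + 1 then (p.1, .bang p.2.1, r) else p

theorem lower_of_le {r : ℕ} {p : ℕ × Fm × ℕ} (h : p.2.2 ≤ r) : lower r p = p :=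
  if_neg (by omega)

theorem map_lower {r : ℕ} {Ω : Multiset (ℕ × Fm × ℕ)} (h : ∀ p ∈ Ω, p.2.2 ≤ r) :
    Ω.map (lower r) = Ω := by
  conv_rhs => rw [← Multiset.map_id Ω]
  exact Multiset.map_congr rfl fun p hp => lower_of_le (h p hp)

/-- Promotion of the innermost derivation turns a variable `y : A` that awaits an outer result into
`y : !A` at the depth of that result, so plugging the result in becomes a cut at one depth. -/
theorem Staged.enter {V : Set ℕ} {r : ℕ} {Ω : Multiset (ℕ × Fm × ℕ)} {M : Tm} {A : Fm}
    (h : Staged V (r + 1) Ω M A) : Staged V r (Ω.map (lower r)) M (.bang A) := by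
  generalize hr : r + 1 = r' at h
  induction h generalizing r with
  | @base V r' Γ M A h h' =>
    subst hr
    have := Staged.base (V := V) (r := r) h.bang (fun p hp => by
      obtain ⟨q, hq, rfl⟩ := Multiset.mem_map.1 hp
      exact h' q hq)
    convert this using 1
    rw [Multiset.map_map, Multiset.map_map]
    exact Multiset.map_congr rfl fun p _ => by simp [lower]
  | @exit V W₁ W₂ r' y Δ₁ Δ₂ M₀ M₁ A B hM₁ hM₀ hd hV _ ih =>
    obtain rfl : r = r' := by omega
    have h1 := ih rfl
    rw [Multiset.map_cons] at h1
    have e : lower r (y, A, r + 1) = (y, .bang A, r) := by simp [lower]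
    rw [e] at h1
    rw [Multiset.map_add, map_lower fun p hp => (hM₁.mem hp).2]
    exact hM₁.cut h1 hd hV

theorem Tm.ren_subst {f : Name → Name} {x : ℕ} {N : Tm} (hN : N.LC) (M : Tm)
    (hx : ∀ v, f v = .free x ↔ v = .free x)
    (hf : ∀ y, N.cnt (.free y) ≠ 0 → f (.free y) = .free y) :
    (M.subst x N).ren f = (M.ren f).subst x N := by
  have var : ∀ v : Name, v ≠ .free x → (f v).toTm.subst x N = (f v).toTm := by
    intro v hv
    refine Tm.subst_of_cnt_eq_zero _ ?_
    have : f v ≠ .free x := fun h => hv ((hx v).1 h)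
    simp [Ne.symm this]
  induction M generalizing f with
  | fvar z =>
    by_cases hz : z = x
    · subst hz
      simp only [Tm.subst, Tm.ren, if_true, (hx (.free z)).2 rfl, Name.toTm]
      conv_rhs => rw [← N.ren_id]
      refine Tm.ren_congr fun u hu => ?_
      cases u with
      | free y => exact hf y hu
      | bound k => exact absurd (hN k) hu
    · have := var (.free z) (by simpa using hz)
      simp [Tm.subst, Tm.ren, hz, this]
  | bvar k =>
    have := var (.bound k) (by simp)
    simp [Tm.subst, Tm.ren, this]
  | lam M ih =>
    simp only [Tm.subst, Tm.ren, Tm.lam.injEq]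
    have hx' : ∀ v, Name.lift f v = .free x ↔ v = .free x := by
      intro v
      rcases v.eq_zero_or_up with rfl | ⟨v, rfl⟩
      · simp
      · rw [Name.lift_up, ← Name.up_free x, Name.up_inj, Name.up_inj]
        exact hx v
    refine ih hx' (fun y hy => by simp [hf y hy]) fun v hv => ?_
    refine Tm.subst_of_cnt_eq_zero _ ?_
    have : Name.lift f v ≠ .free x := fun h => hv ((hx' v).1 h)
    simp [Ne.symm this]
  | app M P ihM ihP => simp [Tm.subst, Tm.ren, ihM hx hf var, ihP hx hf var]

/-- The variables to be bound have the innermost level, so they occur in the innermost derivation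
only and can be bound there. -/
theorem Staged.lam {V : Set ℕ} {r : ℕ} {Γ : Multiset (ℕ × Fm × ℕ)} {M : Tm} {T B : Fm}
    (xs : Multiset ℕ) (h : Staged V r (xs.map (fun x => (x, T, r)) + Γ) M B)
    (hT : 2 ≤ Multiset.card xs → T.IsBang) :
    Staged V r Γ (.lam (M.ren (Name.closeAll xs))) (.limp T B) := by
  generalize hΩ : xs.map (fun x => (x, T, r)) + Γ = Ω at h
  induction h generalizing Γ with
  | @base V r Θ M B h h' =>
    have e := congrArg (Multiset.map fun p : ℕ × Fm × ℕ => (p.1, p.2.1)) hΩ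
    rw [Multiset.map_add, Multiset.map_map, Multiset.map_map] at e
    simp only [Function.comp_def, Multiset.map_id'] at e
    have e2 : (Γ.map fun p : ℕ × Fm × ℕ => (p.1, p.2.1)).map (fun p => (p.1, p.2, r)) = Γ := by
      rw [Multiset.map_map]
      conv_rhs => rw [← Multiset.map_id Γ]
      refine Multiset.map_congr rfl fun p hp => ?_
      have hp' : p ∈ Θ.map fun p => (p.1, p.2, r) := by rw [← hΩ]; simp [hp]
      obtain ⟨q, _, rfl⟩ := Multiset.mem_map.1 hp'
      rfl
    rw [← e2]
    rw [← e] at h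
    refine .base (h.lam_closeAll xs hT) fun p hp => h' p ?_
    rw [← e]
    exact Multiset.mem_add.2 (.inr hp)
  | @exit V W₁ W₂ r y Δ₁ Δ₂ M₀ M₁ A B hM₁ hM₀ hd hV _ ih =>
    obtain ⟨Θ, rfl, rfl⟩ := Multiset.exists_add_of_add_eq hΩ.symm (fun a ha h => by
      obtain ⟨x, _, rfl⟩ := Multiset.mem_map.1 ha
      have := (hM₁.mem h).2
      simp at this)
    have h1 := ih (Γ := (y, A, r + 1) ::ₘ Θ) (by rw [Multiset.add_cons])
    have h2 := Staged.exit hM₁ h1 hd hV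
    have hxs : ∀ x ∈ xs, x ∈ W₂ := fun x hx =>
      (hM₀.mem (p := (x, T, r + 1)) (by simp [hx])).1
    have hy : y ∉ xs := by
      have := hM₀.nodup
      simp at this
      exact fun h => this.1.1 h
    rw [Tm.ren_subst hM₁.lc M₀]
    · exact h2
    · intro v
      cases v with
      | bound k => simp [Name.closeAll]
      | free z =>
        by_cases hz : z ∈ xs
        · have : z ≠ y := fun h => hy (h ▸ hz)
          simp [Name.closeAll, hz, this]
        · simp [Name.closeAll, hz]
    · intro z hz
      have : z ∉ xs := fun h => Set.disjoint_left.1 hd (hM₁.mem_of_cnt hz) (hxs z h)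
      simp [Name.closeAll, this]

/-! ### From typing with levels to derivations -/

/-- Rename the free variables only. -/
def Name.via (f : ℕ → Name) : Name → Name
  | .free x => f x
  | .bound k => .bound k

/-- The inverse of `Name.up`. -/
def Name.down : Name → Name
  | .free x => .free x
  | .bound k => .bound (k - 1)

theorem Name.up_down {v : Name} (h : v ≠ .bound 0) : v.down.up = v := by
  rcases v.eq_zero_or_up with rfl | ⟨u, rfl⟩
  · exact absurd rfl h
  · cases u <;> rfl

theorem Tm.cnt_via_congr {f g : ℕ → Name} {M : Tm} (hM : M.LC)
    (h : ∀ x, M.cnt (.free x) ≠ 0 → f x = g x) : M.ren (Name.via f) = M.ren (Name.via g) := by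
  refine Tm.ren_congr fun u hu => ?_
  cases u with
  | free x => exact h x hu
  | bound k => exact absurd (hM k) hu

/-- One fresh name is spent for each box between the level of `x` and the depth `r`. -/
theorem Staged.var {r n : ℕ} (x : ℕ) (hx : x < n) {T A : Fm} {l : ℕ} (hl : l ≤ r)
    (hT : T = Fm.bang^[r - l] A) :
    ∃ m, n ≤ m ∧ Staged (insert x (Set.Ico n m)) r {(x, T, l)} (.fvar x) A := by
  obtain ⟨k, rfl⟩ := Nat.exists_eq_add_of_le hl
  rw [Nat.add_sub_cancel_left] at hT
  clear hl
  induction k generalizing A with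
  | zero =>
    refine ⟨n, le_rfl, ?_⟩
    have := Staged.base (V := insert x (Set.Ico n n)) (r := l) (SeqOn.ax ∅ x A) (by simp)
    simpa [hT] using this
  | succ k ih =>
    obtain ⟨m, hm, h⟩ := ih (A := .bang A) (by rw [hT]; rfl)
    refine ⟨m + 1, by omega, h.leave (x := m) ?_ ?_⟩
    · simp; omega
    · intro y
      simp
      omega

/-- Every free occurrence gets a name of its own, so no sharing of free variables is needed yet:
`M'` is `M` with its occurrences separated, and `f` records what each new name stands for. The
counter `n` keeps the names of different subterms apart. -/
theorem Leveled.exists_staged {γ : LCtx} {r : ℕ} {M : Tm} {A : Fm} (h : Leveled γ r M A)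
    (hl : ∀ v, M.cnt v ≠ 0 → (γ v).2 ≤ r) (n : ℕ) :
    ∃ m, n ≤ m ∧ ∃ (xs : Multiset ℕ) (f : ℕ → Name) (M' : Tm),
      Staged (Set.Ico n m) r (xs.map fun x => (x, γ (f x))) M' A ∧ M = M'.ren (Name.via f) ∧
        ∀ v, M.cnt v = (xs.map f).count v := by
  induction h generalizing n with
  | @var γ r M A v hM hle hT =>
    obtain ⟨m, hm, h⟩ := Staged.var (n := n + 1) n (by omega) hle hT
    refine ⟨m, by omega, {n}, fun _ => v, .fvar n, ?_, hM, fun u => ?_⟩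
    · refine h.mono fun y => ?_
      simp
      omega
    · rw [hM]
      simp [Multiset.count_singleton]
  | @lam γ r M A B hM hm ih =>
    have hl' : ∀ v, M.cnt v ≠ 0 → (Name.cons (A, r) γ v).2 ≤ r := by
      intro v hv
      rcases v.eq_zero_or_up with rfl | ⟨v, rfl⟩
      · simp
      · simpa using hl v hv
    obtain ⟨m, hnm, xs, f, M', h1, h2, h3⟩ := ih hl' n
    -- The copies of the bound variable; all of them have level `r`, as `Staged.lam` requires.
    set xs₀ := xs.filter fun x => f x = .bound 0 with hxs₀
    set xs₁ := xs.filter fun x => ¬ f x = .bound 0 with hxs₁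
    have hxs : xs₀ + xs₁ = xs := Multiset.filter_add_not _ _
    have e : xs.map (fun x => (x, Name.cons (A, r) γ (f x))) =
        xs₀.map (fun x => (x, A, r)) + xs₁.map fun x => (x, γ (f x).down) := by
      conv_lhs => rw [← hxs]
      rw [Multiset.map_add]
      congr 1
      · refine Multiset.map_congr rfl fun x hx => ?_
        rw [(Multiset.mem_filter.1 hx).2, Name.cons_zero]
      · refine Multiset.map_congr rfl fun x hx => ?_
        conv_lhs => rw [← Name.up_down (Multiset.mem_filter.1 hx).2, Name.cons_up]
    have hcard : Multiset.card xs₀ = M.cnt (.bound 0) := by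
      rw [h3, Multiset.count_map]
      simp only [hxs₀, eq_comm]
    rw [e] at h1
    refine ⟨m, hnm, xs₁, fun x => (f x).down, _, h1.lam xs₀ fun h => hm (hcard ▸ h), ?_, fun v => ?_⟩
    · simp only [Tm.ren, Tm.lam.injEq, Tm.ren_ren]
      rw [h2]
      refine Tm.ren_congr fun u hu => ?_
      cases u with
      | bound k => exact absurd (h1.lc k) hu
      | free x =>
        obtain ⟨p, hp, rfl⟩ := h1.exists_mem hu
        by_cases hx : f p.1 = .bound 0
        · have : p.1 ∈ xs₀ := by
            refine Multiset.mem_filter.2 ⟨?_, hx⟩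
            rw [← e] at hp
            obtain ⟨x, hx', rfl⟩ := Multiset.mem_map.1 hp
            exact hx'
          simp [Name.closeAll, this, Name.via, hx]
        · have : p.1 ∉ xs₀ := fun h => hx (Multiset.mem_filter.1 h).2
          simp [Name.closeAll, this, Name.via, Name.up_down hx]
    · rw [Tm.cnt_lam, h3, ← hxs, Multiset.map_add, Multiset.count_add]
      have h0 : (xs₀.map f).count v.up = 0 := by
        rw [Multiset.count_eq_zero]
        intro h
        obtain ⟨x, hx, hxv⟩ := Multiset.mem_map.1 h
        rw [(Multiset.mem_filter.1 hx).2] at hxv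
        exact Name.up_ne_zero v hxv.symm
      rw [h0, zero_add]
      have h4 : xs₁.map f = (xs₁.map fun x => (f x).down).map Name.up := by
        rw [Multiset.map_map]
        exact Multiset.map_congr rfl fun x hx => (Name.up_down (Multiset.mem_filter.1 hx).2).symm
      rw [h4, Multiset.count_map_eq_count' _ _ Name.up_injective]
  | @app γ r M N A B hM hN ihM ihN =>
    -- The names `n` and `n + 1` are reserved for an application of a variable to a variable, into
    -- which `M'` and `N'` are cut.
    obtain ⟨m₁, hm₁, xs₁, f₁, M', h1, h2, h3⟩ :=
      ihM (fun v hv => hl v (by simp; omega)) (n + 2)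
    obtain ⟨m₂, hm₂, xs₂, f₂, N', k1, k2, k3⟩ := ihN (fun v hv => hl v (by simp; omega)) m₁
    have hx₁ : ∀ x ∈ xs₁, x < m₁ := fun x hx =>
      (h1.mem (Multiset.mem_map_of_mem _ hx)).1.2
    have hx₂ : ∀ x ∈ xs₂, m₁ ≤ x := fun x hx =>
      (k1.mem (Multiset.mem_map_of_mem _ hx)).1.1
    let f : ℕ → Name := fun x => if x < m₁ then f₁ x else f₂ x
    have hf₁ : ∀ x, x < m₁ → f x = f₁ x := fun x hx => if_pos hx
    have hf₂ : ∀ x, m₁ ≤ x → f x = f₂ x := fun x hx => if_neg (by omega)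
    have base := Staged.base (V := Set.Ico n (n + 2)) (r := r)
      (SeqOn.app_vars (f := n) (x := n + 1) (by omega) A B) (by simp)
    simp only [Multiset.map_cons, Multiset.map_singleton] at base
    have c1 := h1.cut (V := Set.Ico n m₁) base
      (Set.disjoint_left.2 fun a ha hb => by simp at ha hb; omega)
      (by intro y; simp; omega)
    have en : M'.cnt (.free (n + 1)) = 0 := by
      by_contra hc
      have := h1.mem_of_cnt hc
      simp at this
    have e1 : (Tm.app (.fvar n) (.fvar (n + 1))).subst n M' = .app M' (.fvar (n + 1)) := by
      simp [Tm.subst]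
    rw [e1, Multiset.add_comm, Multiset.singleton_add] at c1
    have c2 := k1.cut (V := Set.Ico n m₂) c1
      (Set.disjoint_left.2 fun a ha hb => by simp at ha hb; omega)
      (by intro y; simp; omega)
    have e2 : (Tm.app M' (.fvar (n + 1))).subst (n + 1) N' = .app M' N' := by
      simp [Tm.subst, Tm.subst_of_cnt_eq_zero _ en]
    rw [e2, Multiset.add_comm] at c2
    refine ⟨m₂, by omega, xs₁ + xs₂, f, .app M' N', ?_, ?_, fun v => ?_⟩
    · convert c2 using 1
      rw [Multiset.map_add]
      congr 1
      · exact Multiset.map_congr rfl fun x hx => by rw [hf₁ x (hx₁ x hx)]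
      · exact Multiset.map_congr rfl fun x hx => by rw [hf₂ x (hx₂ x hx)]
    · simp only [Tm.ren, Tm.app.injEq]
      rw [h2, k2]
      exact ⟨Tm.cnt_via_congr h1.lc fun x hx => (hf₁ x (h1.mem_of_cnt hx).2).symm,
        Tm.cnt_via_congr k1.lc fun x hx => (hf₂ x (k1.mem_of_cnt hx).1).symm⟩
    · rw [Tm.cnt_app, h3, k3, Multiset.map_add, Multiset.count_add]
      congr 2
      · exact Multiset.map_congr rfl fun x hx => (hf₁ x (hx₁ x hx)).symm
      · exact Multiset.map_congr rfl fun x hx => (hf₂ x (hx₂ x hx)).symm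
  | @enter γ r M A hM ih =>
    obtain ⟨m, hm, xs, f, M', h1, h2, h3⟩ := ih (fun v hv => (hl v hv).trans (by omega)) n
    refine ⟨m, hm, xs, f, M', ?_, h2, h3⟩
    have := h1.enter
    -- All declared levels are at most `r`, so entering the box adds no `!` to the context.
    rwa [map_lower] at this
    intro p hp
    obtain ⟨x, hx, rfl⟩ := Multiset.mem_map.1 hp
    refine hl _ ?_
    rw [h3]
    exact (Multiset.count_pos.2 (Multiset.mem_map_of_mem f hx)).ne'
  | @exit γ r M A hM hl' ih =>
    obtain ⟨m, hm, xs, f, M', h1, h2, h3⟩ := ih hl' n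
    refine ⟨m + 1, by omega, xs, f, M', h1.leave (x := m) (by simp) ?_, h2, h3⟩
    intro y
    simp
    omega

theorem Staged.seqOn {V : Set ℕ} {Ω : Multiset (ℕ × Fm × ℕ)} {M : Tm} {A : Fm}
    (h : Staged V 0 Ω M A) : SeqOn ∅ (Ω.map fun p => (p.1, p.2.1)) M A := by
  generalize hr : 0 = r at h
  cases h with
  | base h _ => simpa [Multiset.map_map] using h
  | exit => omega

/-- Fanned free wires are now allowed, since only bare wires are still cut in. `Θ` is the part of
`Γ` reached so far: the first copy of a variable is renamed, later copies are merged into it, and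
the remaining declarations come from weakening. -/
theorem SeqOn.contractAll {Γ : Basis} (hΓ : Γ.Linear) {T : ℕ → Fm} {g : ℕ → ℕ} {M : Tm} {A : Fm}
    (xs : Multiset ℕ) (Θ : Basis) (hΘ : Θ ≤ Γ)
    (h : SeqOn Set.univ (xs.map (fun x => (x, T (g x))) + Θ) M A)
    (hg : ∀ x ∈ xs, x ∉ Γ.dom ∧ (g x, T (g x)) ∈ Γ)
    (hm : ∀ y, 2 ≤ (xs.map g).count y + Θ.dom.count y → (T y).IsBang) :
    SeqOn Set.univ Γ (M.ren (Name.via fun x => if x ∈ xs then .free (g x) else .free x)) A := by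
  classical
  induction xs using Multiset.induction generalizing M Θ with
  | empty =>
    simp only [Multiset.map_zero, zero_add] at h
    convert h.weak_le hΘ hΓ using 1
    conv_rhs => rw [← M.ren_id]
    refine Tm.ren_congr fun u _ => ?_
    cases u <;> simp [Name.via]
  | cons x xs ih =>
    rw [Multiset.map_cons, Multiset.cons_add] at h
    have hx := hg x (by simp)
    have gx : ∀ z ∈ xs, g x ≠ z := by
      rintro z hz h
      exact (hg z (by simp [hz])).1 (Basis.mem_dom.2 ⟨_, h ▸ hx.2⟩)
    have fin : ∀ M', (M' = (M.subst x (.fvar (g x))).ren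
        (Name.via fun x => if x ∈ xs then .free (g x) else .free x)) →
        M' = M.ren (Name.via fun z => if z ∈ x ::ₘ xs then .free (g z) else .free z) := by
      rintro M' rfl
      rw [Tm.subst_fvar_eq_ren, Tm.ren_ren]
      congr 1
      funext v
      cases v with
      | bound k => simp [Name.via]
      | free z =>
        by_cases hz : z = x
        · subst hz
          have : g z ∉ xs := fun h => gx _ h rfl
          simp [Name.via, this]
        · simp [Name.via, hz]
    rw [← fin _ rfl]
    by_cases hy : (g x, T (g x)) ∈ Θ
    · obtain ⟨Θ', rfl⟩ := Multiset.exists_cons_of_mem hy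
      rw [Multiset.add_cons] at h
      have h1 := h.merge (hm _ (by simp; omega)) trivial
      rw [← Multiset.add_cons] at h1
      refine ih _ hΘ h1 (fun z hz => hg z (by simp [hz])) fun y hy => hm y (hy.trans ?_)
      rw [Multiset.map_cons, Multiset.count_cons]
      omega
    · have hnd : Γ.Nodup := Multiset.Nodup.of_map _ hΓ
      have hyd : g x ∉ Θ.dom := by
        intro h
        obtain ⟨B, hB⟩ := Basis.mem_dom.1 h
        have := Multiset.inj_on_of_nodup_map hΓ _ (Multiset.mem_of_le hΘ hB) _ hx.2 rfl
        rw [this] at hB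
        exact hy hB
      have h1 := h.rename (y := g x) (by
        simp only [Basis.dom_add, Multiset.mem_add, not_or]
        refine ⟨fun h => ?_, hyd⟩
        obtain ⟨B, hB⟩ := Basis.mem_dom.1 h
        obtain ⟨z, hz, hzB⟩ := Multiset.mem_map.1 hB
        exact gx z hz (by simpa using (congrArg Prod.fst hzB).symm))
      rw [← Multiset.add_cons] at h1
      refine ih _ ?_ h1 (fun z hz => hg z (by simp [hz])) fun y hy => hm y (hy.trans ?_)
      · refine Multiset.le_iff_count.2 fun a => ?_
        rw [Multiset.count_cons]
        split
        · next ha =>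
          subst ha
          rw [Multiset.count_eq_zero.2 hy, Multiset.count_eq_one_of_mem hnd hx.2]
        · exact Multiset.count_le_of_le a hΘ
      · rw [Multiset.map_cons, Multiset.count_cons, Basis.dom_cons, Multiset.count_cons]
        dsimp only
        omega

theorem Leveled.typed {γ : LCtx} {M : Tm} {A : Fm} {Γ : Basis} (h : Leveled γ 0 M A) (hM : M.LC)
    (hΓ : Γ.Linear) (hγ : ∀ x, M.cnt (.free x) ≠ 0 → (γ (.free x)).2 = 0 ∧
      (x, (γ (.free x)).1) ∈ Γ)
    (hm : ∀ x, 2 ≤ M.cnt (.free x) → (γ (.free x)).1.IsBang) : Typed Γ M A := by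
  -- Names of copies start beyond the variables of `Γ`, so restoring the original names causes no
  -- clash.
  obtain ⟨n, hn⟩ : ∃ n, ∀ x ∈ Γ.dom, x < n :=
    ⟨Γ.dom.toFinset.sup id + 1, fun x hx => Nat.lt_succ_of_le
      (Finset.le_sup (f := id) (Multiset.mem_toFinset.2 hx))⟩
  obtain ⟨m, hnm, xs, f, M', h1, h2, h3⟩ := h.exists_staged (fun v hv => by
    cases v with
    | bound k => exact absurd (hM k) hv
    | free x => exact (hγ x hv).1.le) n
  let g : ℕ → ℕ := fun x => match f x with
    | .free y => y
    | .bound _ => 0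
  have hfx : ∀ x ∈ xs, M.cnt (f x) ≠ 0 := fun x hx => by
    rw [h3]
    exact (Multiset.count_pos.2 (Multiset.mem_map_of_mem f hx)).ne'
  have hg : ∀ x ∈ xs, f x = .free (g x) := by
    intro x hx
    have := hfx x hx
    simp only [g]
    cases hf : f x with
    | free y => rfl
    | bound k => rw [hf] at this; exact absurd (hM k) this
  have h4 := h1.seqOn
  rw [Multiset.map_map] at h4
  have e : xs.map f = (xs.map g).map Name.free := by
    rw [Multiset.map_map]
    exact Multiset.map_congr rfl hg
  have h5 := SeqOn.contractAll hΓ (T := fun y => (γ (.free y)).1) (g := g) (M := M') (A := A) xs 0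
    (Multiset.zero_le _) ?_ ?_ ?_
  · obtain ⟨G, h6, h7, _⟩ := h5
    refine ⟨G, ?_, h7⟩
    convert h6 using 1
    rw [h2]
    refine Tm.cnt_via_congr h1.lc fun x hx => ?_
    obtain ⟨p, hp, rfl⟩ := h1.exists_mem hx
    obtain ⟨x, hx', rfl⟩ := Multiset.mem_map.1 hp
    simp only [hx', if_true]
    exact hg x hx'
  · rw [add_zero]
    convert h4.mono (Set.empty_subset _) using 1
    exact Multiset.map_congr rfl fun x hx => by simp [hg x hx]
  · intro x hx
    refine ⟨fun h => ?_, ?_⟩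
    · have := (h1.mem (Multiset.mem_map_of_mem _ hx)).1.1
      have := hn x h
      omega
    · have := hfx x hx
      rw [hg x hx] at this
      exact (hγ _ this).2
  · intro y hy
    refine hm y ?_
    rw [h3, e, Multiset.count_map_eq_count' _ _ (fun a b h => by simpa using h)]
    simpa using hy

/-! ### General types and their instances -/

theorem Fm.not_isBang_var (a : ℕ) : ¬ (Fm.var a).IsBang := by rintro ⟨B, h⟩; cases h
theorem Fm.not_isBang_limp (A B : Fm) : ¬ (Fm.limp A B).IsBang := by rintro ⟨B, h⟩; cases h

theorem Fm.bang_injective : Function.Injective Fm.bang := fun _ _ h => Fm.bang.inj h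

theorem Fm.bang_iterate_inj {k : ℕ} {A B : Fm} : Fm.bang^[k] A = Fm.bang^[k] B ↔ A = B :=
  (Fm.bang_injective.iterate k).eq_iff

theorem Fm.isBang_iterate {k : ℕ} {A : Fm} (hA : ¬ A.IsBang) : (Fm.bang^[k] A).IsBang ↔ k ≠ 0 := by
  cases k with
  | zero => simpa using hA
  | succ k => rw [Function.iterate_succ_apply']; exact iff_of_true ⟨_, rfl⟩ (by simp)

theorem Fm.bang_iterate_eq {k l : ℕ} {A B : Fm} (hA : ¬ A.IsBang) (hB : ¬ B.IsBang) :
    Fm.bang^[k] A = Fm.bang^[l] B ↔ k = l ∧ A = B := by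
  refine ⟨fun h => ?_, fun ⟨h1, h2⟩ => h1 ▸ h2 ▸ rfl⟩
  induction k generalizing l with
  | zero =>
    cases l with
    | zero => exact ⟨rfl, h⟩
    | succ l =>
      rw [Function.iterate_succ_apply'] at h
      exact absurd ⟨_, h⟩ hA
  | succ k ih =>
    cases l with
    | zero =>
      rw [Function.iterate_succ_apply'] at h
      exact absurd ⟨_, h.symm⟩ hB
    | succ l =>
      rw [Function.iterate_succ_apply', Function.iterate_succ_apply'] at h
      have := ih (Fm.bang.inj h)
      exact ⟨by omega, this.2⟩

/-- The simple type underlying an EAL formula. -/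
def Fm.skel : Fm → Ty
  | .var a => .var a
  | .limp A B => .arr A.skel B.skel
  | .bang A => A.skel

@[simp] theorem Fm.skel_iterate (k : ℕ) (A : Fm) : (Fm.bang^[k] A).skel = A.skel := by
  induction k with
  | zero => rfl
  | succ k ih => rw [Function.iterate_succ_apply']; exact ih

/-- The simple type underlying a general type. -/
def GTy.skel : GTy → Ty
  | .var _ a => .var a
  | .limp _ Θ Δ => .arr Θ.skel Δ.skel

/-- All exponents are sums of variables below `n`. -/
def GTy.Below (n : ℕ) : GTy → Prop
  | .var ns _ => ∀ i ∈ ns, i < n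
  | .limp ns Θ Δ => (∀ i ∈ ns, i < n) ∧ Θ.Below n ∧ Δ.Below n

/-- The instance of a general type without its outermost exponent. -/
def GTy.body (X : ℕ → ℕ) : GTy → Fm
  | .var _ a => .var a
  | .limp _ Θ Δ => .limp (Θ.inst X) (Δ.inst X)

theorem GTy.not_isBang_body (X : ℕ → ℕ) (Θ : GTy) : ¬ (Θ.body X).IsBang := by
  cases Θ
  · exact Fm.not_isBang_var _
  · exact Fm.not_isBang_limp _ _

theorem GTy.inst_eq (X : ℕ → ℕ) (Θ : GTy) :
    Θ.inst X = Fm.bang^[sumOf X Θ.exps] (Θ.body X) := by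
  cases Θ <;> rfl

theorem GTy.inst_setExps (X : ℕ → ℕ) (ms : List ℕ) (Θ : GTy) :
    (Θ.setExps ms).inst X = Fm.bang^[sumOf X ms] (Θ.body X) := by
  cases Θ <;> rfl

@[simp] theorem sumOf_nil (X : ℕ → ℕ) : sumOf X [] = 0 := rfl

@[simp] theorem sumOf_cons (X : ℕ → ℕ) (n : ℕ) (ns : List ℕ) :
    sumOf X (n :: ns) = X n + sumOf X ns := by simp [sumOf]

theorem sumOf_congr {X Y : ℕ → ℕ} {n : ℕ} {ns : List ℕ} (hn : ∀ i ∈ ns, i < n)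
    (h : ∀ i < n, X i = Y i) : sumOf X ns = sumOf Y ns := by
  unfold sumOf
  congr 1
  exact List.map_congr_left fun i hi => h i (hn i hi)

theorem GTy.inst_bang (X : ℕ → ℕ) (c : ℕ) (Θ : GTy) :
    (Θ.bang c).inst X = Fm.bang^[X c] (Θ.inst X) := by
  rw [GTy.bang, GTy.inst_setExps, GTy.inst_eq, ← Function.iterate_add_apply, sumOf_cons]

theorem GTy.inst_congr {X Y : ℕ → ℕ} {n : ℕ} {Θ : GTy} (hΘ : Θ.Below n)
    (h : ∀ i < n, X i = Y i) : Θ.inst X = Θ.inst Y := by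
  induction Θ with
  | var ns a => simp only [GTy.inst, sumOf_congr hΘ h]
  | limp ns Θ Δ ih1 ih2 => simp only [GTy.inst, sumOf_congr hΘ.1 h, ih1 hΘ.2.1, ih2 hΘ.2.2]

theorem GTy.Below.mono {n m : ℕ} {Θ : GTy} (h : Θ.Below n) (hnm : n ≤ m) : Θ.Below m := by
  induction Θ with
  | var ns a => exact fun i hi => (h i hi).trans_le hnm
  | limp ns Θ Δ ih1 ih2 =>
    exact ⟨fun i hi => (h.1 i hi).trans_le hnm, ih1 h.2.1, ih2 h.2.2⟩

theorem GTy.Below.exps {n : ℕ} {Θ : GTy} (h : Θ.Below n) : ∀ i ∈ Θ.exps, i < n := by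
  cases Θ
  · exact h
  · exact h.1

theorem GTy.Below.setExps {n : ℕ} {Θ : GTy} (h : Θ.Below n) {ms : List ℕ}
    (hm : ∀ i ∈ ms, i < n) : (Θ.setExps ms).Below n := by
  cases Θ
  · exact hm
  · exact ⟨hm, h.2⟩

theorem GTy.Below.bang {n : ℕ} {Θ : GTy} (h : Θ.Below n) {c : ℕ} (hc : c < n) :
    (Θ.bang c).Below n :=
  h.setExps fun i hi => by
    rcases List.mem_cons.1 hi with rfl | hi
    · exact hc
    · exact h.exps i hi

@[simp] theorem GTy.skel_setExps (ms : List ℕ) (Θ : GTy) : (Θ.setExps ms).skel = Θ.skel := by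
  cases Θ <;> rfl

@[simp] theorem GTy.skel_bang (c : ℕ) (Θ : GTy) : (Θ.bang c).skel = Θ.skel :=
  GTy.skel_setExps _ _

/-! ### Most general types and their instances -/

theorem general_spec (σ : Ty) (n : ℕ) :
    n < (general σ n).2 ∧ (general σ n).1.Below (general σ n).2 ∧ (general σ n).1.skel = σ := by
  induction σ generalizing n with
  | var a => simp [general, GTy.Below, GTy.skel]
  | arr σ τ ih1 ih2 =>
    have h1 := ih1 (n + 1)
    have h2 := ih2 (general σ (n + 1)).2
    refine ⟨?_, ⟨?_, h1.2.1.mono h2.1.le, h2.2.1⟩, ?_⟩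
    · simp only [general]; omega
    · simp only [general, List.mem_singleton, forall_eq]; omega
    · simp [general, GTy.skel, h1.2.2, h2.2.2]

theorem Fm.exists_eq_iterate (A : Fm) : ∃ k B, A = Fm.bang^[k] B ∧ ¬ B.IsBang := by
  induction A with
  | var a => exact ⟨0, _, rfl, Fm.not_isBang_var a⟩
  | limp A B => exact ⟨0, _, rfl, Fm.not_isBang_limp A B⟩
  | bang A ih =>
    obtain ⟨k, B, rfl, hB⟩ := ih
    exact ⟨k + 1, B, (Function.iterate_succ_apply' _ _ _).symm, hB⟩

/-- Every formula with the right skeleton is an instance of the most general type. -/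
theorem general_inst (X₀ : ℕ → ℕ) (σ : Ty) (n : ℕ) (A : Fm) (hA : A.skel = σ) :
    ∃ X : ℕ → ℕ, (∀ i < n, X i = X₀ i) ∧ (general σ n).1.inst X = A := by
  induction σ generalizing n A X₀ with
  | var a =>
    obtain ⟨k, B, rfl, hB⟩ := A.exists_eq_iterate
    rw [Fm.skel_iterate] at hA
    refine ⟨Function.update X₀ n k, fun i hi => Function.update_of_ne hi.ne _ _, ?_⟩
    cases B with
    | var b => cases hA; simp [general, GTy.inst]
    | limp => cases hA
    | bang B => exact absurd ⟨B, rfl⟩ hB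
  | arr σ τ ih1 ih2 =>
    obtain ⟨k, B, rfl, hB⟩ := A.exists_eq_iterate
    rw [Fm.skel_iterate] at hA
    cases B with
    | var b => cases hA
    | bang B => exact absurd ⟨B, rfl⟩ hB
    | limp A B =>
      simp only [Fm.skel, Ty.arr.injEq] at hA
      obtain ⟨X₁, h1, h1'⟩ := ih1 (Function.update X₀ n k) (n + 1) A hA.1
      obtain ⟨X₂, h2, h2'⟩ := ih2 X₁ (general σ (n + 1)).2 B hA.2
      have hs := general_spec σ (n + 1)
      refine ⟨X₂, fun i hi => ?_, ?_⟩
      · rw [h2 i (by omega), h1 i (by omega), Function.update_of_ne hi.ne]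
      · simp only [general, GTy.inst, sumOf_cons, sumOf_nil, h2']
        rw [GTy.inst_congr hs.2.1 h2, h1', h2 n (by omega), h1 n (by omega)]
        simp

/-! ### Constraints relative to open boxes -/

/-- The number of slices in `W` that contain the equation `row`. -/
def cntRow (W : List Slice) (row : ℕ) : ℕ := W.countP fun sl => sl.hasRow row

/-- The number of slices in `W` that contain the occurrence `occ`. -/
def cntOcc (W : List Slice) (occ : ℕ) : ℕ := W.countP fun sl => sl.hasOcc occ

/-- The constraint holds when each slice in `W` is used for one more box. -/
def Constraint.HoldsIn (X : ℕ → ℕ) (W : List Slice) : Constraint → Prop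
  | .eqn row pos neg => sumOf X pos = sumOf X neg + row.elim 0 (cntRow W)
  | .geOne ns => 1 ≤ sumOf X ns

@[simp] theorem Slice.hasRow_nil (row : ℕ) : Slice.hasRow [] row = false := rfl
@[simp] theorem Slice.hasOcc_nil (occ : ℕ) : Slice.hasOcc [] occ = false := rfl

@[simp] theorem cntRow_append (U W : List Slice) (row : ℕ) :
    cntRow (U ++ W) row = cntRow U row + cntRow W row := List.countP_append

@[simp] theorem cntOcc_append (U W : List Slice) (occ : ℕ) :
    cntOcc (U ++ W) occ = cntOcc U occ + cntOcc W occ := List.countP_append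

theorem cntOcc_le (W : List Slice) (occ : ℕ) : cntOcc W occ ≤ W.length := List.countP_le_length

theorem cntOcc_replicate (k : ℕ) (sl : Slice) (occ : ℕ) :
    cntOcc (List.replicate k sl) occ = if sl.hasOcc occ then k else 0 := by
  simp [cntOcc, List.countP_replicate]

theorem cntRow_replicate (k : ℕ) (sl : Slice) (row : ℕ) :
    cntRow (List.replicate k sl) row = if sl.hasRow row then k else 0 := by
  simp [cntRow, List.countP_replicate]

theorem Constraint.holdsIn_nil {X : ℕ → ℕ} {a : Constraint} : a.HoldsIn X [] ↔ a.Holds X := by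
  cases a with
  | eqn row pos neg => cases row <;> simp [Constraint.HoldsIn, Constraint.Holds, cntRow]
  | geOne ns => rfl

/-- The label of a constraint. -/
def Constraint.row? : Constraint → Option ℕ
  | .eqn row _ _ => row
  | .geOne _ => none

/-- All variables of the constraint are below `n`. -/
def Constraint.Below (n : ℕ) : Constraint → Prop
  | .eqn _ pos neg => (∀ i ∈ pos, i < n) ∧ ∀ i ∈ neg, i < n
  | .geOne ns => ∀ i ∈ ns, i < n

theorem Constraint.Below.mono {n m : ℕ} {a : Constraint} (h : a.Below n) (hnm : n ≤ m) :
    a.Below m := by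
  cases a with
  | eqn row pos neg =>
    exact ⟨fun i hi => (h.1 i hi).trans_le hnm, fun i hi => (h.2 i hi).trans_le hnm⟩
  | geOne ns => exact fun i hi => (h i hi).trans_le hnm

theorem Constraint.holdsIn_congr_rows {X : ℕ → ℕ} {U W : List Slice} {a : Constraint}
    (hr : ∀ r, a.row? = some r → cntRow U r = cntRow W r) : a.HoldsIn X U ↔ a.HoldsIn X W := by
  cases a with
  | eqn row pos neg =>
    cases row with
    | none => rfl
    | some r => simp [Constraint.HoldsIn, hr r rfl]
  | geOne ns => rfl

theorem Constraint.holdsIn_congr {X Y : ℕ → ℕ} {U W : List Slice} {n : ℕ} {a : Constraint}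
    (ha : a.Below n) (h : ∀ i < n, X i = Y i)
    (hr : ∀ r, a.row? = some r → cntRow U r = cntRow W r) : a.HoldsIn X U ↔ a.HoldsIn Y W := by
  rw [Constraint.holdsIn_congr_rows hr]
  cases a with
  | eqn row pos neg =>
    simp only [Constraint.HoldsIn, sumOf_congr ha.1 h, sumOf_congr ha.2 h]
  | geOne ns => simp only [Constraint.HoldsIn, sumOf_congr ha h]

/-- Only the outermost equation can carry a label, so slices contribute extra `!`s there and nowhere
below. -/
theorem unify_holdsIn {X : ℕ → ℕ} {W : List Slice} (row : Option ℕ) {Θ Θ' : GTy}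
    (h : Θ.skel = Θ'.skel) :
    (∀ a ∈ unify row Θ Θ', a.HoldsIn X W) ↔
      Θ.inst X = Fm.bang^[row.elim 0 (cntRow W)] (Θ'.inst X) := by
  induction Θ generalizing Θ' row with
  | var ns a =>
    cases Θ' with
    | limp => simp [GTy.skel] at h
    | var ms b =>
      simp only [GTy.skel, Ty.var.injEq] at h
      subst h
      simp only [unify, List.mem_singleton, forall_eq, Constraint.HoldsIn, GTy.inst]
      rw [← Function.iterate_add_apply,
        Fm.bang_iterate_eq (Fm.not_isBang_var _) (Fm.not_isBang_var _), add_comm]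
      simp
  | limp ns Θ₁ Θ₂ ih1 ih2 =>
    cases Θ' with
    | var => simp [GTy.skel] at h
    | limp ms Δ₁ Δ₂ =>
      simp only [GTy.skel, Ty.arr.injEq] at h
      rw [unify, List.forall_mem_cons, List.forall_mem_append, ih1 none h.1, ih2 none h.2]
      simp only [Constraint.HoldsIn, GTy.inst]
      rw [← Function.iterate_add_apply,
        Fm.bang_iterate_eq (Fm.not_isBang_limp _ _) (Fm.not_isBang_limp _ _), add_comm]
      simp

theorem unifyAll_holdsIn {X : ℕ → ℕ} {W : List Slice} {Θ : GTy} {l : List GTy}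
    (h : ∀ Θ' ∈ l, Θ'.skel = Θ.skel) :
    (∀ a ∈ unifyAll (Θ :: l), a.HoldsIn X W) ↔ ∀ Θ' ∈ l, Θ'.inst X = Θ.inst X := by
  induction l generalizing Θ with
  | nil => simp [unifyAll]
  | cons Δ l ih =>
    have hΔ := h Δ (by simp)
    have := ih (Θ := Δ) fun Θ' hΘ' => by rw [hΔ]; exact h Θ' (by simp [hΘ'])
    rw [unifyAll, List.forall_mem_append, this, unify_holdsIn none hΔ.symm, List.forall_mem_cons]
    simp only [Option.elim, Function.iterate_zero, id]
    constructor
    · rintro ⟨h1, h2⟩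
      exact ⟨h1.symm, fun Θ' h => (h2 Θ' h).trans h1.symm⟩
    · rintro ⟨h1, h2⟩
      exact ⟨h1.symm, fun Θ' h => (h2 Θ' h).trans h1.symm⟩

theorem contract_holdsIn {X : ℕ → ℕ} {W : List Slice} {Θ : GTy} {l : List GTy}
    (h : ∀ Θ' ∈ l, Θ'.skel = Θ.skel) :
    (∀ a ∈ contract (Θ :: l), a.HoldsIn X W) ↔
      (∀ Θ' ∈ l, Θ'.inst X = Θ.inst X) ∧ (l ≠ [] → (Θ.inst X).IsBang) := by
  cases l with
  | nil => simp [contract]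
  | cons Δ l =>
    have := unifyAll_holdsIn (X := X) (W := W) h
    rw [contract, List.forall_mem_cons, this, and_comm]
    refine and_congr_right fun _ => ?_
    rw [GTy.inst_eq, Fm.isBang_iterate (GTy.not_isBang_body _ _)]
    simp only [Constraint.HoldsIn]
    constructor
    · intro h _; omega
    · intro h; have := h (by simp); omega

theorem unify_below {n : ℕ} {row : Option ℕ} {Θ Θ' : GTy} (h : Θ.Below n) (h' : Θ'.Below n) :
    ∀ a ∈ unify row Θ Θ', a.Below n ∧ (a.row? = none ∨ a.row? = row) := by
  induction Θ generalizing Θ' row with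
  | var ns a =>
    cases Θ' with
    | limp => simp [unify, Constraint.Below, Constraint.row?]
    | var ms b =>
      simp only [unify, List.mem_singleton, forall_eq]
      exact ⟨⟨h, h'⟩, .inr rfl⟩
  | limp ns Θ₁ Θ₂ ih1 ih2 =>
    cases Θ' with
    | var => simp [unify, Constraint.Below, Constraint.row?]
    | limp ms Δ₁ Δ₂ =>
      simp only [unify, List.mem_cons, List.mem_append]
      rintro a (rfl | ha | ha)
      · exact ⟨⟨h.1, h'.1⟩, .inr rfl⟩
      · have := ih1 h.2.1 h'.2.1 a ha
        exact ⟨this.1, .inl (this.2.elim id id)⟩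
      · have := ih2 h.2.2 h'.2.2 a ha
        exact ⟨this.1, .inl (this.2.elim id id)⟩

theorem contract_below {n : ℕ} {l : List GTy} (h : ∀ Θ ∈ l, Θ.Below n) :
    ∀ a ∈ contract l, a.Below n ∧ a.row? = none := by
  have all : ∀ l : List GTy, (∀ Θ ∈ l, Θ.Below n) →
      ∀ a ∈ unifyAll l, a.Below n ∧ a.row? = none := by
    intro l
    induction l with
    | nil => simp [unifyAll]
    | cons Θ l ih =>
      cases l with
      | nil => simp [unifyAll]
      | cons Δ l =>
        intro h a ha
        rcases List.mem_append.1 ha with ha | ha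
        · have := unify_below (h Θ (by simp)) (h Δ (by simp)) a ha
          exact ⟨this.1, this.2.elim id id⟩
        · exact ih (fun Θ' hΘ' => h Θ' (List.mem_cons_of_mem _ hΘ')) a ha
  match l with
  | [] => simp [contract]
  | [_] => simp [contract]
  | Θ :: Δ :: l =>
    intro a ha
    rcases List.mem_cons.1 ha with rfl | ha
    · exact ⟨(h Θ (by simp)).exps, rfl⟩
    · exact all _ h a ha

/-! ### Boxing -/

/-- The boxes through the slices in `cs`, as a list of slices with repetitions. -/
def boxUnits (X : ℕ → ℕ) : List Slice → ℕ → List Slice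
  | [], _ => []
  | sl :: cs, n => List.replicate (X n) sl ++ boxUnits X cs (n + 1)

/-- Boxing through the slices in `cs` with fresh variables from `n` on acts on entries, types and
constraints by `fE`, `fT` and `fC`. -/
structure BoxSpec (cs : List Slice) (n m : ℕ) (fE : Entry → Entry) (fT : GTy → GTy)
    (fC : Constraint → Constraint) : Prop where
  eq : ∀ B Γ A, boxSlices cs B Γ A n = ⟨B.map fE, fT Γ, A.map fC, m⟩
  le : n ≤ m
  occ : ∀ e, (fE e).occ = e.occ
  name : ∀ e, (fE e).name = e.name
  skel_ty : ∀ Θ, (fT Θ).skel = Θ.skel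
  skel_entry : ∀ e, (fE e).ty.skel = e.ty.skel
  below_ty : ∀ Θ, Θ.Below n → (fT Θ).Below m
  below_entry : ∀ e, e.ty.Below n → (fE e).ty.Below m
  below_cons : ∀ a, a.Below n → (fC a).Below m
  row : ∀ a, (fC a).row? = a.row?
  inst_ty : ∀ X Θ, (fT Θ).inst X = Fm.bang^[(boxUnits X cs n).length] (Θ.inst X)
  inst_entry : ∀ X e, (fE e).ty.inst X =
    Fm.bang^[(boxUnits X cs n).length - cntOcc (boxUnits X cs n) e.occ] (e.ty.inst X)
  holdsIn : ∀ X W a, (fC a).HoldsIn X W ↔ a.HoldsIn X (boxUnits X cs n ++ W)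

theorem Constraint.row?_boxSlice (sl : Slice) (c : ℕ) (a : Constraint) :
    (a.boxSlice sl c).row? = a.row? := by
  cases a with
  | eqn row pos neg => cases row <;> rfl
  | geOne => rfl

theorem Constraint.below_boxSlice {sl : Slice} {c n : ℕ} {a : Constraint} (h : a.Below n)
    (hc : c < n) : (a.boxSlice sl c).Below n := by
  cases a with
  | geOne => exact h
  | eqn row pos neg =>
    cases row with
    | none => exact h
    | some r =>
      refine ⟨h.1, ?_⟩
      split
      · simpa using ⟨hc, h.2⟩
      · exact h.2

theorem Constraint.holdsIn_boxSlice {X : ℕ → ℕ} {W : List Slice} {sl : Slice} {c : ℕ}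
    {a : Constraint} :
    (a.boxSlice sl c).HoldsIn X W ↔ a.HoldsIn X (List.replicate (X c) sl ++ W) := by
  cases a with
  | geOne => rfl
  | eqn row pos neg =>
    cases row with
    | none => rfl
    | some r =>
      simp only [Constraint.boxSlice, Constraint.HoldsIn, Option.elim, cntRow_append,
        cntRow_replicate]
      split
      · simp; omega
      · simp

/-- Boxes through a slice act as that many copies of the slice among the open boxes: they shift the
equations in the slice and put a `!` on the type and on every entry whose occurrence lies outside
the slice. -/
theorem exists_boxSpec (cs : List Slice) (n : ℕ) : ∃ m fE fT fC, BoxSpec cs n m fE fT fC := by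
  induction cs generalizing n with
  | nil =>
    exact ⟨n, id, id, id, by simp [boxSlices], le_rfl, fun _ => rfl, fun _ => rfl, fun _ => rfl,
      fun _ => rfl, fun _ h => h, fun _ h => h, fun _ h => h, fun _ => rfl, fun _ _ => rfl,
      fun _ _ => rfl, fun _ _ _ => Iff.rfl⟩
  | cons sl cs ih =>
    obtain ⟨m, fE, fT, fC, h⟩ := ih (n + 1)
    refine ⟨m, fun e => fE (if sl.hasOcc e.occ then e else e.bang n), fun Θ => fT (Θ.bang n),
      fun a => fC (a.boxSlice sl n), ?_⟩
    refine ⟨?_, by have := h.le; omega, ?_, ?_, ?_, ?_, ?_, ?_, ?_, ?_, ?_, ?_, ?_⟩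
    · intro B Γ A
      simp only [boxSlices, h.eq, List.map_map, Function.comp_def]
    · intro e; rw [h.occ]; split <;> rfl
    · intro e; rw [h.name]; split <;> rfl
    · intro Θ; rw [h.skel_ty, GTy.skel_bang]
    · intro e
      rw [h.skel_entry]
      split
      · rfl
      · exact GTy.skel_bang _ _
    · intro Θ hΘ
      exact h.below_ty _ ((hΘ.mono (by omega)).bang (by omega))
    · intro e he
      refine h.below_entry _ ?_
      split
      · exact he.mono (by omega)
      · exact (he.mono (by omega)).bang (by omega)
    · intro a ha
      exact h.below_cons _ (Constraint.below_boxSlice (ha.mono (by omega)) (by omega))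
    · intro a; rw [h.row, Constraint.row?_boxSlice]
    · intro X Θ
      rw [h.inst_ty, GTy.inst_bang, ← Function.iterate_add_apply]
      simp [boxUnits, add_comm]
    · intro X e
      rw [h.inst_entry]
      simp only [boxUnits, List.length_append, List.length_replicate, cntOcc_append,
        cntOcc_replicate]
      have := cntOcc_le (boxUnits X cs (n + 1)) e.occ
      by_cases ho : sl.hasOcc e.occ
      · rw [if_pos ho, if_pos ho, Nat.add_sub_add_left]
      · rw [if_neg ho, if_neg ho]
        simp only [Entry.bang]
        rw [GTy.inst_bang, ← Function.iterate_add_apply, zero_add, add_comm,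
          Nat.add_sub_assoc this]
    · intro X W a
      rw [h.holdsIn, Constraint.holdsIn_boxSlice, boxUnits]
      refine Constraint.holdsIn_congr_rows fun r _ => ?_
      simp only [cntRow_append]
      omega

theorem mem_boxUnits {X : ℕ → ℕ} {cs : List Slice} {n : ℕ} {sl : Slice}
    (h : sl ∈ boxUnits X cs n) : sl ∈ cs := by
  induction cs generalizing n with
  | nil => simp [boxUnits] at h
  | cons s cs ih =>
    rcases List.mem_append.1 h with h | h
    · rw [List.eq_of_mem_replicate h]; simp
    · exact List.mem_cons_of_mem _ (ih h)

/-- The multiplicity of a slice in `U` becomes the value of its fresh variable. The order of `U` is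
lost, but constraints and the fitting of entries depend on counts only. -/
theorem exists_boxUnits_perm (X₀ : ℕ → ℕ) (cs : List Slice) (n : ℕ) (U : List Slice)
    (hU : ∀ sl ∈ U, sl ∈ cs) :
    ∃ X : ℕ → ℕ, (∀ i < n, X i = X₀ i) ∧ (boxUnits X cs n).Perm U := by
  induction cs generalizing n U X₀ with
  | nil =>
    have : U = [] := List.eq_nil_iff_forall_not_mem.2 fun sl h => by simpa using hU sl h
    exact ⟨X₀, fun _ _ => rfl, by simp [this, boxUnits]⟩
  | cons s cs ih =>
    -- All copies of `s` are charged to its first listing; a later listing of the same slice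
    -- receives none.
    obtain ⟨X, h1, h2⟩ := ih (Function.update X₀ n (U.count s)) (n + 1) (U.filter (· ≠ s))
      (fun sl hsl => by
        have h := List.mem_filter.1 hsl
        have h' := hU sl h.1
        simp only [List.mem_cons] at h'
        exact h'.resolve_left (by simpa using h.2))
    refine ⟨X, fun i hi => ?_, ?_⟩
    · rw [h1 i (by omega), Function.update_of_ne hi.ne]
    · rw [boxUnits, h1 n (by omega), Function.update_self]
      refine (h2.append_left _).trans ?_
      have : List.replicate (U.count s) s = U.filter (· = s) := by
        exact (List.filter_eq s).symm
      rw [this]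
      simpa using List.filter_append_perm (fun x => decide (x = s)) U

theorem cntRow_perm {U W : List Slice} (h : U.Perm W) (row : ℕ) : cntRow U row = cntRow W row :=
  h.countP_eq _

theorem cntOcc_perm {U W : List Slice} (h : U.Perm W) (occ : ℕ) : cntOcc U occ = cntOcc W occ :=
  h.countP_eq _

/-- The slices used for boxing the term `M`; the empty slice stands for the boxes around the whole
term. -/
def boxCuts (M : CTm) (cpts : List Slice) : List Slice := if M.isVar then [] else cpts ++ [[]]

/-- A box around the whole term is left nowhere, so it is a box through the empty slice. -/
theorem box_eq (M : CTm) (cpts : List Slice) (B : List Entry) (Γ : GTy) (A : List Constraint)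
    (n : ℕ) : box M cpts B Γ A n = boxSlices (boxCuts M cpts) B Γ A n := by
  unfold box boxCuts
  split
  · rfl
  · have h0 : ∀ c, Constraint.boxSlice [] c = id := by
      intro c
      funext a
      cases a with
      | geOne => rfl
      | eqn row pos neg => cases row <;> rfl
    induction cpts generalizing B Γ A n with
    | nil => simp [boxSlices, h0]
    | cons sl cpts ih => exact ih _ _ _ _

/-! ### Slices -/

theorem Slice.hasRow_append (s t : Slice) (r : ℕ) :
    Slice.hasRow (s ++ t) r = (Slice.hasRow s r || Slice.hasRow t r) := List.any_append

theorem Slice.hasOcc_append (s t : Slice) (x : ℕ) :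
    Slice.hasOcc (s ++ t) x = (Slice.hasOcc s x || Slice.hasOcc t x) := List.any_append

theorem Slice.hasRow_singleton {row r : ℕ} {os : List ℕ} :
    Slice.hasRow [(row, os)] r = true ↔ row = r := by simp [Slice.hasRow]

theorem Slice.hasOcc_singleton {row x : ℕ} {os : List ℕ} :
    Slice.hasOcc [(row, os)] x = true ↔ x ∈ os := by simp [Slice.hasOcc]

theorem mem_addPoint {b : Bool} {cpts : List Slice} {row : ℕ} {os : List ℕ} {sl : Slice} :
    sl ∈ addPoint b cpts row os ↔ sl ∈ cpts ∨ (b = true ∧ sl = [(row, os)]) := by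
  cases b <;> simp [addPoint]

theorem mem_prodUnion {P Q : List Slice} {sl : Slice} :
    sl ∈ prodUnion P Q ↔ sl ∈ P ∨ sl ∈ Q ∨ ∃ s ∈ P, ∃ t ∈ Q, sl = s ++ t := by
  induction P with
  | nil => simp [prodUnion]
  | cons s P ih =>
    cases Q with
    | nil => simp [prodUnion]
    | cons t Q =>
      rw [prodUnion, List.mem_append, ih, List.mem_cons, List.mem_map, List.mem_cons (a := sl) (b := s)]
      constructor
      · rintro ((h | ⟨t', ht, rfl⟩) | h | h | ⟨s', hs, t', ht, rfl⟩)
        · exact .inl (.inl h)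
        · exact .inr (.inr ⟨s, by simp, t', ht, rfl⟩)
        · exact .inl (.inr h)
        · exact .inr (.inl h)
        · exact .inr (.inr ⟨s', by simp [hs], t', ht, rfl⟩)
      · rintro ((h | h) | h | ⟨s', hs, t', ht, rfl⟩)
        · exact .inl (.inl h)
        · exact .inr (.inl h)
        · exact .inr (.inr (.inl h))
        · rcases List.mem_cons.1 hs with rfl | hs
          · exact .inl (.inr ⟨t', ht, rfl⟩)
          · exact .inr (.inr (.inr ⟨s', hs, t', ht, rfl⟩))

/-- Slices of the argument list or the empty slice. -/
def SliceOf (cpts : List Slice) (W : List Slice) : Prop := ∀ sl ∈ W, sl ∈ cpts ∨ sl = []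

/-- Once the empty slice is admitted on both sides, the product union is a plain product; hence the
form of `SliceOf`. -/
theorem mem_prodUnion_or {P Q : List Slice} {sl : Slice} :
    (sl ∈ prodUnion P Q ∨ sl = []) ↔
      ∃ s t, (s ∈ P ∨ s = []) ∧ (t ∈ Q ∨ t = []) ∧ sl = s ++ t := by
  rw [mem_prodUnion]
  constructor
  · rintro ((h | h | ⟨s, hs, t, ht, rfl⟩) | rfl)
    · exact ⟨sl, [], .inl h, .inr rfl, by simp⟩
    · exact ⟨[], sl, .inr rfl, .inl h, rfl⟩
    · exact ⟨s, t, .inl hs, .inl ht, rfl⟩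
    · exact ⟨[], [], .inr rfl, .inr rfl, rfl⟩
  · rintro ⟨s, t, hs | rfl, ht | rfl, rfl⟩
    · exact .inl (.inr (.inr ⟨s, hs, t, ht, rfl⟩))
    · exact .inl (.inl (by simpa using hs))
    · exact .inl (.inr (.inl ht))
    · exact .inr rfl

theorem Entry.isZero_iff {e : Entry} : e.isZero = true ↔ e.name = .bound 0 := by
  obtain ⟨o, v, Θ⟩ := e
  match v with
  | .free x => simp [Entry.isZero]
  | .bound 0 => simp [Entry.isZero]
  | .bound (k + 1) => simp [Entry.isZero]

@[simp] theorem Entry.occ_down (e : Entry) : e.down.occ = e.occ := by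
  obtain ⟨o, v, Θ⟩ := e
  cases v <;> rfl

@[simp] theorem Entry.ty_down (e : Entry) : e.down.ty = e.ty := by
  obtain ⟨o, v, Θ⟩ := e
  cases v <;> rfl

@[simp] theorem Entry.name_down (e : Entry) : e.down.name = e.name.down := by
  obtain ⟨o, v, Θ⟩ := e
  cases v <;> rfl

/-! ### Elementary facts about type synthesis -/

/-- The simple type of a name. -/
def tyOf (ρ : ℕ → Ty) (Δ : List Ty) : Name → Ty
  | .free x => ρ x
  | .bound k => Δ.getD k (.var 0)

theorem tyOf_cons (ρ : ℕ → Ty) (Δ : List Ty) (σ : Ty) :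
    tyOf ρ (σ :: Δ) = Name.cons σ (tyOf ρ Δ) := by
  funext v
  match v with
  | .free x => rfl
  | .bound 0 => rfl
  | .bound (k + 1) => rfl

/-- What type synthesis for `D : σ`, started with the counter at `lo`, guarantees. -/
structure Out.Good (ρ : ℕ → Ty) (Δ : List Ty) (D : CTm) (σ : Ty) (lo : ℕ) (o : Out) : Prop where
  le : lo ≤ o.next
  ty_below : o.ty.Below o.next
  ty_skel : o.ty.skel = σ
  occ : ∀ e ∈ o.base, lo ≤ e.occ ∧ e.occ < o.next
  base_below : ∀ e ∈ o.base, e.ty.Below o.next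
  base_skel : ∀ e ∈ o.base, e.ty.skel = tyOf ρ Δ e.name
  cons_below : ∀ a ∈ o.cons, a.Below o.next
  row : ∀ a ∈ o.cons, ∀ r, a.row? = some r → lo ≤ r ∧ r < o.next
  cpt_row : ∀ sl ∈ o.cpts, ∀ r, sl.hasRow r = true → lo ≤ r ∧ r < o.next
  cpt_occ : ∀ sl ∈ o.cpts, ∀ x, sl.hasOcc x = true → lo ≤ x ∧ x < o.next
  cnt : ∀ v, D.erase.cnt v = o.base.countP fun e => decide (e.name = v)

theorem synthVar_good {ρ : ℕ → Ty} {Δ : List Ty} {D : CTm} (v : Name) (n : ℕ)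
    (hD : D.erase = v.toTm) : (synthVar v (tyOf ρ Δ v) n).Good ρ Δ D (tyOf ρ Δ v) n := by
  obtain ⟨h1, h2, h3⟩ := general_spec (tyOf ρ Δ v) n
  refine ⟨?_, h2.mono ?_, h3, ?_, ?_, ?_, ?_, ?_, ?_, ?_, ?_⟩ <;> simp only [synthVar]
  · omega
  · omega
  · simp; omega
  · simpa using h2.mono (by omega)
  · simpa using h3
  · simp
  · simp
  · simp
  · simp
  · intro u
    rw [hD, Tm.cnt_toTm]
    simp [List.countP_singleton, eq_comm]

theorem synthLam_good {ρ : ℕ → Ty} {Δ : List Ty} {M : CTm} {σ τ : Ty} {lo : ℕ} {r : Out}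
    (h : r.Good ρ (σ :: Δ) M τ lo) :
    (synthLam σ M r).Good ρ Δ (.lam σ M) (.arr σ τ) lo := by
  obtain ⟨m, fE, fT, fC, hb⟩ := exists_boxSpec (boxCuts M r.cpts) r.next
  have hlm : lo ≤ m := h.le.trans hb.le
  have rest : ∀ e ∈ ((r.base.map fE).filter fun e => !e.isZero).map Entry.down,
      (lo ≤ e.occ ∧ e.occ < m) ∧ e.ty.Below m ∧ e.ty.skel = tyOf ρ Δ e.name := by
    intro e he
    rw [List.mem_map] at he
    obtain ⟨e, he, rfl⟩ := he
    rw [List.mem_filter] at he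
    obtain ⟨he, hz⟩ := he
    rw [List.mem_map] at he
    obtain ⟨e, he, rfl⟩ := he
    have hz' : e.name ≠ .bound 0 := by
      rw [← hb.name]
      intro h
      rw [Entry.isZero_iff.2 h] at hz
      simp at hz
    have := h.occ e he
    refine ⟨?_, ?_, ?_⟩
    · rw [Entry.occ_down, hb.occ]
      exact ⟨this.1, this.2.trans_le hb.le⟩
    · rw [Entry.ty_down]
      exact hb.below_entry e (h.base_below e he)
    · rw [Entry.ty_down, Entry.name_down, hb.skel_entry, hb.name, h.base_skel e he, tyOf_cons]
      conv_lhs => rw [← Name.up_down hz', Name.cons_up]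
  have restcnt : ∀ v, (CTm.lam σ M).erase.cnt v =
      (((r.base.map fE).filter fun e => !e.isZero).map Entry.down).countP
        fun e => decide (e.name = v) := by
    intro v
    rw [CTm.erase, Tm.cnt_lam, h.cnt, List.countP_map, List.countP_filter, List.countP_map]
    refine List.countP_congr fun e _ => ?_
    simp only [Function.comp_def, decide_eq_true_eq, Bool.and_eq_true, Entry.name_down, hb.name,
      Bool.not_eq_true', ← Bool.not_eq_true, Entry.isZero_iff]
    constructor
    · intro h
      rw [h]
      exact ⟨by cases v <;> rfl, Name.up_ne_zero v⟩
    · rintro ⟨h1, h2⟩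
      rw [← h1, Name.up_down h2]
  have cons : ∀ a ∈ r.cons.map fC, a.Below m ∧ ∀ r, a.row? = some r → lo ≤ r ∧ r < m := by
    intro a ha
    rw [List.mem_map] at ha
    obtain ⟨a, ha, rfl⟩ := ha
    refine ⟨hb.below_cons a (h.cons_below a ha), fun r' hr => ?_⟩
    rw [hb.row] at hr
    have := h.row a ha r' hr
    exact ⟨this.1, this.2.trans_le hb.le⟩
  unfold synthLam
  simp only [box_eq, hb.eq]
  split
  · next x l hx =>
    have hxs : ∀ e ∈ x :: l, e.ty.Below m ∧ e.ty.skel = σ := by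
      intro e he
      rw [← hx] at he
      rw [List.mem_filter] at he
      obtain ⟨he, hz⟩ := he
      rw [List.mem_map] at he
      obtain ⟨e, he, rfl⟩ := he
      rw [Entry.isZero_iff, hb.name] at hz
      refine ⟨hb.below_entry e (h.base_below e he), ?_⟩
      rw [hb.skel_entry, h.base_skel e he, hz]
      rfl
    have hcon := contract_below (n := m) (l := (x :: l).map Entry.ty) (by
      intro Θ hΘ
      obtain ⟨e, he, rfl⟩ := List.mem_map.1 hΘ
      exact (hxs e he).1)
    refine ⟨hlm, ?_, ?_, fun e he => (rest e he).1, fun e he => (rest e he).2.1,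
      fun e he => (rest e he).2.2, ?_, ?_, ?_, ?_, restcnt⟩
    · exact ⟨by simp, (hxs x (by simp)).1, hb.below_ty _ h.ty_below⟩
    · simp only [GTy.skel, (hxs x (by simp)).2, hb.skel_ty, h.ty_skel]
    · intro a ha
      rcases List.mem_append.1 ha with ha | ha
      · exact (cons a ha).1
      · rw [hx] at ha
        exact (hcon a ha).1
    · intro a ha r' hr
      rcases List.mem_append.1 ha with ha | ha
      · exact (cons a ha).2 r' hr
      · rw [hx] at ha
        rw [(hcon a ha).2] at hr
        cases hr
    · intro sl hsl r' hr
      have := h.cpt_row sl (List.mem_filter.1 hsl).1 r' hr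
      exact ⟨this.1, this.2.trans_le hb.le⟩
    · intro sl hsl r' hr
      have := h.cpt_occ sl (List.mem_filter.1 hsl).1 r' hr
      exact ⟨this.1, this.2.trans_le hb.le⟩
  · obtain ⟨g1, g2, g3⟩ := general_spec σ m
    have hcr : ∀ sl ∈ r.cpts, ∀ r', sl.hasRow r' = true → lo ≤ r' ∧ r' < m := by
      intro sl hsl r' hr
      have := h.cpt_row sl hsl r' hr
      exact ⟨this.1, this.2.trans_le hb.le⟩
    have hco : ∀ sl ∈ r.cpts, ∀ r', sl.hasOcc r' = true → lo ≤ r' ∧ r' < m := by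
      intro sl hsl r' hr
      have := h.cpt_occ sl hsl r' hr
      exact ⟨this.1, this.2.trans_le hb.le⟩
    split
    · refine ⟨?_, ?_, ?_, fun e he => ⟨(rest e he).1.1, ?_⟩,
        fun e he => (rest e he).2.1.mono ?_, fun e he => (rest e he).2.2, ?_, ?_, ?_, ?_, restcnt⟩
      · dsimp only; omega
      · refine ⟨by simp, g2.mono (by simp), ?_⟩
        exact ((hb.below_ty _ h.ty_below).mono (by dsimp only; omega)).setExps (by simp)
      · simp only [GTy.skel, g3, GTy.skel_setExps, hb.skel_ty, h.ty_skel]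
      · have := (rest e he).1.2; dsimp only; omega
      · dsimp only; omega
      · intro a ha
        rcases List.mem_append.1 ha with ha | ha
        · exact (cons a ha).1.mono (by dsimp only; omega)
        · rw [List.mem_singleton] at ha
          subst ha
          refine ⟨fun i hi => ?_, by simp⟩
          have := (hb.below_ty _ h.ty_below).exps i hi
          dsimp only; omega
      · intro a ha r' hr
        rcases List.mem_append.1 ha with ha | ha
        · have := (cons a ha).2 r' hr
          dsimp only; omega
        · rw [List.mem_singleton] at ha
          subst ha
          simp only [Constraint.row?, Option.some.injEq] at hr
          dsimp only; omega
      · dsimp only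
        intro sl hsl r' hr
        rcases mem_addPoint.1 hsl with hsl | ⟨_, rfl⟩
        · have := hcr sl hsl r' hr; omega
        · rw [Slice.hasRow_singleton] at hr; omega
      · dsimp only
        intro sl hsl r' hr
        rcases mem_addPoint.1 hsl with hsl | ⟨_, rfl⟩
        · have := hco sl hsl r' hr; omega
        · rw [Slice.hasOcc_singleton] at hr
          obtain ⟨e, he, rfl⟩ := List.mem_map.1 hr
          have := (rest e he).1
          omega
    · refine ⟨?_, ?_, ?_, fun e he => ⟨(rest e he).1.1, ?_⟩,
        fun e he => (rest e he).2.1.mono ?_, fun e he => (rest e he).2.2, ?_, ?_, ?_, ?_, restcnt⟩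
      · dsimp only; omega
      · exact ⟨by simp, g2, (hb.below_ty _ h.ty_below).mono g1.le⟩
      · simp only [GTy.skel, g3, hb.skel_ty, h.ty_skel]
      · have := (rest e he).1.2; dsimp only; omega
      · dsimp only; omega
      · exact fun a ha => (cons a ha).1.mono (by dsimp only; omega)
      · intro a ha r' hr
        have := (cons a ha).2 r' hr
        dsimp only; omega
      · intro sl hsl r' hr
        have := hcr sl hsl r' hr; dsimp only; omega
      · intro sl hsl r' hr
        have := hco sl hsl r' hr; dsimp only; omega

theorem synthApp_good {ρ : ℕ → Ty} {Δ : List Ty} {M N : CTm} {σ τ : Ty} {lo : ℕ} {r s : Out}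
    (hr : r.Good ρ Δ M (.arr σ τ) lo) (hs : s.Good ρ Δ N σ r.next) :
    (synthApp M N r s).Good ρ Δ (.app M N) τ lo := by
  obtain ⟨m, fE, fT, fC, hb⟩ := exists_boxSpec (boxCuts N s.cpts) s.next
  obtain ⟨rty, rbase, rcons, rcpts, rnext⟩ := r
  cases rty with
  | var => have := hr.ty_skel; simp [GTy.skel] at this
  | limp ns Θ Γ =>
    have hle1 := hr.le
    have hle2 := hs.le
    have hle3 := hb.le
    dsimp only at hle1 hle2 hle3 hs
    have hsk := hr.ty_skel
    simp only [GTy.skel, Ty.arr.injEq] at hsk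
    have hbel := hr.ty_below
    dsimp only at hbel
    have base : ∀ e ∈ rbase ++ s.base.map fE, (lo ≤ e.occ ∧ e.occ < m) ∧ e.ty.Below m ∧
        e.ty.skel = tyOf ρ Δ e.name := by
      intro e he
      rw [List.mem_append] at he
      rcases he with he | he
      · have := hr.occ e he
        dsimp only at this
        exact ⟨by omega, (hr.base_below e he).mono (by dsimp only; omega), hr.base_skel e he⟩
      · rw [List.mem_map] at he
        obtain ⟨e, he, rfl⟩ := he
        have := hs.occ e he
        refine ⟨?_, hb.below_entry e (hs.base_below e he), ?_⟩
        · rw [hb.occ]; omega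
        · rw [hb.skel_entry, hb.name, hs.base_skel e he]
    have hun := unify_below (row := some (m + 1)) (n := m) (hb.below_ty _ hs.ty_below)
      (hbel.2.1.mono (by omega))
    have point : ∀ {b : Bool} {cpts : List Slice} {row : ℕ} {os : List ℕ},
        (∀ sl ∈ cpts, ∀ r, sl.hasRow r = true → lo ≤ r ∧ r < m) →
        (∀ sl ∈ cpts, ∀ x, sl.hasOcc x = true → lo ≤ x ∧ x < m) →
        (lo ≤ row ∧ row < m + 2) → (∀ x ∈ os, lo ≤ x ∧ x < m) →
        ∀ sl ∈ addPoint b cpts row os, (∀ r, sl.hasRow r = true → lo ≤ r ∧ r < m + 2) ∧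
          ∀ x, sl.hasOcc x = true → lo ≤ x ∧ x < m + 2 := by
      intro b cpts row os h1 h2 h3 h4 sl hsl
      rcases mem_addPoint.1 hsl with hsl | ⟨_, rfl⟩
      · refine ⟨fun r hr => ?_, fun x hx => ?_⟩
        · have := h1 sl hsl r hr; omega
        · have := h2 sl hsl x hx; omega
      · refine ⟨fun r hr => ?_, fun x hx => ?_⟩
        · rw [Slice.hasRow_singleton] at hr; omega
        · rw [Slice.hasOcc_singleton] at hx; have := h4 x hx; omega
    unfold synthApp
    simp only [box_eq, hb.eq]
    have pM := point (b := M.isApp) (cpts := rcpts) (row := m) (os := occs rbase)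
      (fun sl h r h' => by have := hr.cpt_row sl h r h'; dsimp only at this; omega)
      (fun sl h r h' => by have := hr.cpt_occ sl h r h'; dsimp only at this; omega)
      (by omega) (fun x hx => by
        obtain ⟨e, he, rfl⟩ := List.mem_map.1 hx
        exact (base e (by simp [he])).1)
    have pN := point (b := N.isApp) (cpts := s.cpts) (row := m + 1) (os := occs (s.base.map fE))
      (fun sl h r h' => by have := hs.cpt_row sl h r h'; omega)
      (fun sl h r h' => by have := hs.cpt_occ sl h r h'; omega)
      (by omega) (fun x hx => by
        obtain ⟨e, he, rfl⟩ := List.mem_map.1 hx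
        exact (base e (List.mem_append.2 (.inr he))).1)
    have pMN : ∀ sl ∈ prodUnion (addPoint M.isApp rcpts m (occs rbase))
        (addPoint N.isApp s.cpts (m + 1) (occs (s.base.map fE))),
        (∀ r, sl.hasRow r = true → lo ≤ r ∧ r < m + 2) ∧
          ∀ x, sl.hasOcc x = true → lo ≤ x ∧ x < m + 2 := by
      intro sl hsl
      rcases mem_prodUnion.1 hsl with h | h | ⟨s, h1, t, h2, rfl⟩
      · exact pM sl h
      · exact pN sl h
      · refine ⟨fun r hr => ?_, fun x hx => ?_⟩
        · rw [Slice.hasRow_append, Bool.or_eq_true] at hr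
          exact hr.elim ((pM s h1).1 r) ((pN t h2).1 r)
        · rw [Slice.hasOcc_append, Bool.or_eq_true] at hx
          exact hx.elim ((pM s h1).2 x) ((pN t h2).2 x)
    refine ⟨by dsimp only; omega, hbel.2.2.mono (by dsimp only; omega), hsk.2, ?_, ?_,
      fun e he => (base e he).2.2, ?_, ?_, fun sl h => (pMN sl h).1, fun sl h => (pMN sl h).2, ?_⟩
    · intro e he
      have := (base e he).1
      dsimp only; omega
    · exact fun e he => (base e he).2.1.mono (by dsimp only; omega)
    · intro a ha
      simp only [List.mem_append, List.mem_singleton] at ha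
      rcases ha with ((ha | ha) | ha) | rfl
      · exact (hr.cons_below a ha).mono (by dsimp only; omega)
      · rw [List.mem_map] at ha
        obtain ⟨a, ha, rfl⟩ := ha
        exact (hb.below_cons a (hs.cons_below a ha)).mono (by dsimp only; omega)
      · exact (hun a ha).1.mono (by dsimp only; omega)
      · refine ⟨fun i hi => ?_, by simp⟩
        have := hbel.1 i hi
        dsimp only; omega
    · intro a ha q hq
      simp only [List.mem_append, List.mem_singleton] at ha
      rcases ha with ((ha | ha) | ha) | rfl
      · have := hr.row a ha q hq
        dsimp only at this ⊢; omega
      · rw [List.mem_map] at ha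
        obtain ⟨a, ha, rfl⟩ := ha
        rw [hb.row] at hq
        have := hs.row a ha q hq
        dsimp only; omega
      · rcases (hun a ha).2 with h | h
        · rw [h] at hq; cases hq
        · rw [h] at hq
          simp only [Option.some.injEq] at hq
          dsimp only; omega
      · simp only [Constraint.row?, Option.some.injEq] at hq
        dsimp only; omega
    · intro v
      have e : ((fun e : Entry => decide (e.name = v)) ∘ fE) = fun e => decide (e.name = v) := by
        funext e
        simp [hb.name]
      rw [CTm.erase, Tm.cnt_app, hr.cnt, hs.cnt, List.countP_append, List.countP_map, e]

/-- The intervals of the counter used by the function and by the argument of an application are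
disjoint, which later allows each slice of the application to be separated into its two parts. -/
theorem synth_good {ρ : ℕ → Ty} {Δ : List Ty} {D : CTm} {σ : Ty} (h : HasType ρ Δ D σ) (n : ℕ) :
    (synth ρ Δ D n).Good ρ Δ D σ n := by
  induction h generalizing n with
  | fvar Δ x => exact synthVar_good (Δ := Δ) (.free x) n rfl
  | @bvar Δ k σ h =>
    have : tyOf ρ Δ (.bound k) = σ := by simp [tyOf, List.getD, h]
    have h1 := synthVar_good (ρ := ρ) (Δ := Δ) (D := .bvar k) (.bound k) n rfl
    rw [this] at h1
    have h2 : synth ρ Δ (.bvar k) n = synthVar (.bound k) σ n := by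
      rw [← this]
      rfl
    rwa [h2]
  | lam _ ih => exact synthLam_good (ih n)
  | app _ _ ih1 ih2 => exact synthApp_good (ih1 n) (ih2 _)

/-! ### Soundness of type synthesis -/

/-- `o` counts the boxes left at the new critical point, and `W₁` lists those that stay open past
it. -/
theorem SliceOf.addPoint {b : Bool} {cpts : List Slice} {row : ℕ} {os : List ℕ} {W : List Slice}
    (hW : SliceOf (addPoint b cpts row os) W) (hf : ∀ sl ∈ cpts, ¬ sl.hasRow row = true) :
    ∃ o W₁, W.length = W₁.length + o ∧ (b = false → o = 0) ∧ SliceOf cpts W₁ ∧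
      cntRow W row = o ∧ (∀ r, r ≠ row → cntRow W r = cntRow W₁ r) ∧
      ∀ x ∈ os, cntOcc W x = cntOcc W₁ x + o := by
  induction W with
  | nil => exact ⟨0, [], by simp [SliceOf, cntRow, cntOcc]⟩
  | cons sl W ih =>
    obtain ⟨o, W₁, h1, h2, h3, h4, h5, h6⟩ := ih fun s hs => hW s (List.mem_cons_of_mem _ hs)
    have keep : sl ∈ cpts ∨ sl = [] → ¬ sl.hasRow row = true →
        ∃ o W₁, (sl :: W).length = W₁.length + o ∧ (b = false → o = 0) ∧ SliceOf cpts W₁ ∧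
        cntRow (sl :: W) row = o ∧ (∀ r, r ≠ row → cntRow (sl :: W) r = cntRow W₁ r) ∧
        ∀ x ∈ os, cntOcc (sl :: W) x = cntOcc W₁ x + o := by
      intro hsl hr
      refine ⟨o, sl :: W₁, by simp [h1]; omega, h2, ?_, ?_, ?_, ?_⟩
      · intro s hs
        rcases List.mem_cons.1 hs with rfl | hs
        · exact hsl
        · exact h3 s hs
      · simpa [cntRow, List.countP_cons, hr] using h4
      · intro r hr'
        have := h5 r hr'
        simp only [cntRow, List.countP_cons] at this ⊢
        omega
      · intro x hx
        have := h6 x hx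
        simp only [cntOcc, List.countP_cons] at this ⊢
        omega
    rcases hW sl (by simp) with hsl | hsl
    · rcases mem_addPoint.1 hsl with hsl | ⟨hb, rfl⟩
      · exact keep (.inl hsl) (hf sl hsl)
      · refine ⟨o + 1, W₁, by simp [h1]; omega, by simp [hb], h3, ?_, ?_, ?_⟩
        · have hp : Slice.hasRow [(row, os)] row = true := Slice.hasRow_singleton.2 rfl
          simp only [cntRow, List.countP_cons, hp] at h4 ⊢
          simp [h4]
        · intro r hr
          rw [← h5 r hr, cntRow, cntRow, List.countP_cons_of_neg]
          exact fun h => hr (Slice.hasRow_singleton.1 h).symm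
        · intro x hx
          have hp : Slice.hasOcc [(row, os)] x = true := Slice.hasOcc_singleton.2 hx
          have := h6 x hx
          simp only [cntOcc, List.countP_cons, hp, if_true] at this ⊢
          omega
    · exact keep (.inr hsl) (by simp [hsl])

/-- Each open box is seen once from the function and once from the argument; a label or an
occurrence foreign to one side is counted entirely on the other. -/
theorem SliceOf.prodUnion {P Q W : List Slice} (hW : SliceOf (prodUnion P Q) W) :
    ∃ W₁ W₂, SliceOf P W₁ ∧ SliceOf Q W₂ ∧ W₁.length = W.length ∧ W₂.length = W.length ∧
      (∀ r, (∀ t ∈ Q, ¬ t.hasRow r = true) → cntRow W r = cntRow W₁ r) ∧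
      (∀ r, (∀ s ∈ P, ¬ s.hasRow r = true) → cntRow W r = cntRow W₂ r) ∧
      (∀ x, (∀ t ∈ Q, ¬ t.hasOcc x = true) → cntOcc W x = cntOcc W₁ x) ∧
      ∀ x, (∀ s ∈ P, ¬ s.hasOcc x = true) → cntOcc W x = cntOcc W₂ x := by
  induction W with
  | nil => exact ⟨[], [], by simp [SliceOf]⟩
  | cons sl W ih =>
    obtain ⟨W₁, W₂, h1, h2, h3, h4, h5, h6, h7, h8⟩ :=
      ih fun s hs => hW s (List.mem_cons_of_mem _ hs)
    obtain ⟨s, t, hs, ht, rfl⟩ := mem_prodUnion_or.1 (hW sl (by simp))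
    have nr : ∀ {L : List Slice} {s : Slice} {r : ℕ}, (s ∈ L ∨ s = []) →
        (∀ t ∈ L, ¬ t.hasRow r = true) → s.hasRow r = false := by
      rintro L s r (h | rfl) h'
      · simpa using h' s h
      · rfl
    have no : ∀ {L : List Slice} {s : Slice} {r : ℕ}, (s ∈ L ∨ s = []) →
        (∀ t ∈ L, ¬ t.hasOcc r = true) → s.hasOcc r = false := by
      rintro L s r (h | rfl) h'
      · simpa using h' s h
      · rfl
    refine ⟨s :: W₁, t :: W₂, ?_, ?_, by simp [h3], by simp [h4], ?_, ?_, ?_, ?_⟩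
    · intro u hu
      rcases List.mem_cons.1 hu with rfl | hu
      · exact hs
      · exact h1 u hu
    · intro u hu
      rcases List.mem_cons.1 hu with rfl | hu
      · exact ht
      · exact h2 u hu
    · intro r hr
      have := h5 r hr
      simp only [cntRow, List.countP_cons, Slice.hasRow_append, nr ht hr, Bool.or_false] at this ⊢
      omega
    · intro r hr
      have := h6 r hr
      simp only [cntRow, List.countP_cons, Slice.hasRow_append, nr hs hr, Bool.false_or] at this ⊢
      omega
    · intro r hr
      have := h7 r hr
      simp only [cntOcc, List.countP_cons, Slice.hasOcc_append, no ht hr, Bool.or_false] at this ⊢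
      omega
    · intro r hr
      have := h8 r hr
      simp only [cntOcc, List.countP_cons, Slice.hasOcc_append, no hs hr, Bool.false_or] at this ⊢
      omega

/-- Inside the boxes through the slices in `W`, the entry agrees with the context. -/
def Entry.Fits (X : ℕ → ℕ) (W : List Slice) (γ : LCtx) (e : Entry) : Prop :=
  (γ e.name).2 + cntOcc W e.occ ≤ W.length ∧
    (γ e.name).1 = Fm.bang^[W.length - (γ e.name).2 - cntOcc W e.occ] (e.ty.inst X)

/-- Leaving a box lowers the depth and the count alike, so the number of `!`s does not change. -/
theorem Entry.Fits.leave {X : ℕ → ℕ} {W W₁ : List Slice} {γ : LCtx} {e : Entry} {o : ℕ}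
    (h : e.Fits X W γ) (hl : W.length = W₁.length + o)
    (hc : cntOcc W e.occ = cntOcc W₁ e.occ + o) : e.Fits X W₁ γ := by
  obtain ⟨h1, h2⟩ := h
  refine ⟨by omega, ?_⟩
  have : W₁.length - (γ e.name).2 - cntOcc W₁ e.occ =
      W.length - (γ e.name).2 - cntOcc W e.occ := by omega
  rw [this, h2]

/-- Type synthesis for `M` with the result `r` is sound. -/
def Out.Sound (M : Tm) (r : Out) : Prop :=
  ∀ (X : ℕ → ℕ) (W : List Slice) (γ : LCtx), SliceOf r.cpts W → (∀ a ∈ r.cons, a.HoldsIn X W) →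
    (∀ e ∈ r.base, e.Fits X W γ) → Leveled γ W.length M (r.ty.inst X)

/-- The new boxes `U` are added as the innermost ones: soundness for `U ++ W` types the term
`U.length` boxes deeper, and entering these boxes produces the `!`s of the boxed type. -/
theorem Out.Sound.box {M : Tm} {D : CTm} {r : Out} (h : r.Sound M) {m : ℕ} {fE : Entry → Entry}
    {fT : GTy → GTy} {fC : Constraint → Constraint}
    (hb : BoxSpec (boxCuts D r.cpts) r.next m fE fT fC) {X : ℕ → ℕ} {W : List Slice} {γ : LCtx}
    (hW : SliceOf r.cpts W) (hc : ∀ a ∈ r.cons, (fC a).HoldsIn X W)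
    (he : ∀ e ∈ r.base, (fE e).Fits X W γ) : Leveled γ W.length M ((fT r.ty).inst X) := by
  rw [hb.inst_ty]
  set U := boxUnits X (boxCuts D r.cpts) r.next with hU
  refine Leveled.enter_iterate _ ?_
  have := h X (U ++ W) γ ?_ ?_ ?_
  · rwa [List.length_append, add_comm] at this
  · intro sl hsl
    rcases List.mem_append.1 hsl with hsl | hsl
    · have := mem_boxUnits hsl
      unfold boxCuts at this
      split at this
      · simp at this
      · simpa using this
    · exact hW sl hsl
  · exact fun a ha => (hb.holdsIn X W a).1 (hc a ha)
  · intro e h'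
    obtain ⟨h1, h2⟩ := he e h'
    rw [hb.name, hb.occ] at h1 h2
    rw [hb.inst_entry, ← hU, ← Function.iterate_add_apply] at h2
    have := cntOcc_le U e.occ
    refine ⟨by simp; omega, ?_⟩
    rw [h2]
    congr 2
    simp only [List.length_append, cntOcc_append]
    omega

theorem Out.Good.level_le {ρ : ℕ → Ty} {Δ : List Ty} {D : CTm} {σ : Ty} {lo : ℕ} {r : Out}
    (h : r.Good ρ Δ D σ lo) {l : ℕ} {γ : LCtx} (he : ∀ e ∈ r.base, (γ e.name).2 ≤ l) (v : Name)
    (hv : D.erase.cnt v ≠ 0) : (γ v).2 ≤ l := by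
  rw [h.cnt] at hv
  obtain ⟨e, he', hev⟩ := List.countP_pos_iff.1 (Nat.pos_of_ne_zero hv)
  simp only [decide_eq_true_eq] at hev
  exact hev ▸ he e he'

/-- The labelled equations equate the `!`s in front of the implication, and the surplus of `!`s of
the argument over the expected type, with the numbers of boxes left at the two roots. Leaving those
boxes makes the types match. -/
theorem synthApp_sound {ρ : ℕ → Ty} {Δ : List Ty} {M N : CTm} {σ τ : Ty} {lo : ℕ} {r s : Out}
    (hr : r.Good ρ Δ M (.arr σ τ) lo) (hs : s.Good ρ Δ N σ r.next) (hM : r.Sound M.erase)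
    (hN : s.Sound N.erase) : (synthApp M N r s).Sound (.app M.erase N.erase) := by
  obtain ⟨m, fE, fT, fC, hb⟩ := exists_boxSpec (boxCuts N s.cpts) s.next
  obtain ⟨rty, rbase, rcons, rcpts, rnext⟩ := r
  have hle2 := hs.le
  have hle3 := hb.le
  dsimp only at hle2 hle3 hs
  cases rty with
  | var => have := hr.ty_skel; simp [GTy.skel] at this
  | limp ns Θ Γ =>
    have hsk := hr.ty_skel
    simp only [GTy.skel, Ty.arr.injEq] at hsk
    intro X W γ hW hc he
    unfold synthApp at hW hc he ⊢
    simp only [box_eq, hb.eq] at hW hc he ⊢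
    obtain ⟨W₁, W₂, k1, k2, k3, k4, k5, k6, k7, k8⟩ := hW.prodUnion
    obtain ⟨o₁, V₁, a1, -, a3, a4, a5, a6⟩ := k1.addPoint fun sl hsl h => by
      have := hr.cpt_row sl hsl _ h
      dsimp only at this
      omega
    obtain ⟨o₂, V₂, b1, -, b3, b4, b5, b6⟩ := k2.addPoint fun sl hsl h => by
      have := hs.cpt_row sl hsl _ h
      omega
    have rowM : ∀ q, q < rnext ∨ q = m → cntRow W q = cntRow W₁ q := by
      intro q hq
      refine k5 q fun t ht h => ?_
      rcases mem_addPoint.1 ht with ht | ⟨_, rfl⟩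
      · have := hs.cpt_row t ht q h
        omega
      · rw [Slice.hasRow_singleton] at h
        omega
    have rowN : ∀ q, (rnext ≤ q ∧ q < m) ∨ q = m + 1 → cntRow W q = cntRow W₂ q := by
      intro q hq
      refine k6 q fun t ht h => ?_
      rcases mem_addPoint.1 ht with ht | ⟨_, rfl⟩
      · have := hr.cpt_row t ht q h
        dsimp only at this
        omega
      · rw [Slice.hasRow_singleton] at h
        omega
    have fitM : ∀ e ∈ rbase, e.Fits X V₁ γ := by
      intro e h
      refine (he e (by simp [h])).leave (k3 ▸ a1) ?_
      rw [k7, a6 _ (List.mem_map_of_mem h)]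
      intro t ht h'
      have h1 := (hr.occ e h).2
      dsimp only at h1
      rcases mem_addPoint.1 ht with ht | ⟨_, rfl⟩
      · have := hs.cpt_occ t ht _ h'
        omega
      · rw [Slice.hasOcc_singleton] at h'
        obtain ⟨e', he', h2⟩ := List.mem_map.1 h'
        obtain ⟨e'', he'', rfl⟩ := List.mem_map.1 he'
        rw [hb.occ] at h2
        have := hs.occ e'' he''
        omega
    have fitN : ∀ e ∈ s.base, (fE e).Fits X V₂ γ := by
      intro e h
      refine (he _ (List.mem_append.2 (.inr (List.mem_map_of_mem h)))).leave (k4 ▸ b1) ?_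
      rw [k8, b6 _ (List.mem_map_of_mem (List.mem_map_of_mem h))]
      intro t ht h'
      rw [hb.occ] at h'
      have h1 := (hs.occ e h).1
      rcases mem_addPoint.1 ht with ht | ⟨_, rfl⟩
      · have := hr.cpt_occ t ht _ h'
        dsimp only at this
        omega
      · rw [Slice.hasOcc_singleton] at h'
        obtain ⟨e', he', h2⟩ := List.mem_map.1 h'
        have := hr.occ e' he'
        dsimp only at this
        omega
    have lM := hM X V₁ γ a3 (fun a ha => by
      refine (Constraint.holdsIn_congr_rows fun q hq => ?_).1 (hc a (by simp [ha]))
      have := hr.row a ha q hq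
      dsimp only at this
      rw [rowM q (by omega), a5 q (by omega)]) fitM
    have lN := hN.box hb b3 (fun a ha => by
      refine (Constraint.holdsIn_congr_rows fun q hq => ?_).1
        (hc (fC a) (by simp only [List.mem_append]; exact .inl (.inl (.inr (List.mem_map_of_mem ha)))))
      rw [hb.row] at hq
      have := hs.row a ha q hq
      rw [rowN q (by omega), b5 q (by omega)]) fitN
    have hrow := hc (.eqn (some m) ns []) (by simp)
    simp only [Constraint.HoldsIn, sumOf_nil, zero_add, Option.elim, rowM m (by omega), a4] at hrow
    have huni := (unify_holdsIn (X := X) (W := W) (some (m + 1)) (Θ := fT s.ty) (Θ' := Θ)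
      (by rw [hb.skel_ty, hs.ty_skel, hsk.1])).1 fun a ha => hc a (by
        simp only [List.mem_append]; exact .inl (.inr ha))
    simp only [Option.elim, rowN (m + 1) (by omega), b4] at huni
    simp only [GTy.inst, hrow] at lM
    rw [huni] at lN
    -- The inequality in `Entry.Fits` is what grants the side condition for leaving boxes.
    have eM := lM.exit_iterate _ (hr.level_le fun e h => by have := (fitM e h).1; omega)
    have eN := lN.exit_iterate _ (hs.level_le fun e h => by
      have := (fitN e h).1
      rw [hb.name] at this
      omega)
    rw [← a1, k3] at eM
    rw [← b1, k4] at eN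
    exact .app eM eN

theorem synthLam_sound {ρ : ℕ → Ty} {Δ : List Ty} {M : CTm} {σ τ : Ty} {lo : ℕ} {r : Out}
    (h : r.Good ρ (σ :: Δ) M τ lo) (hM : r.Sound M.erase) :
    (synthLam σ M r).Sound (.lam M.erase) := by
  obtain ⟨m, fE, fT, fC, hb⟩ := exists_boxSpec (boxCuts M r.cpts) r.next
  intro X W γ
  have fitRest : ∀ {W : List Slice} {T : Fm × ℕ},
      (∀ e ∈ ((r.base.map fE).filter fun e => !e.isZero).map Entry.down, e.Fits X W γ) →
      ∀ e ∈ r.base, e.name ≠ .bound 0 → (fE e).Fits X W (Name.cons T γ) := by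
    intro W T hf e he hz
    have := hf (fE e).down (List.mem_map_of_mem (List.mem_filter.2 ⟨List.mem_map_of_mem he, by
      rw [Bool.not_eq_true', ← Bool.not_eq_true, Entry.isZero_iff, hb.name]
      exact hz⟩))
    unfold Entry.Fits at this ⊢
    rw [Entry.name_down, Entry.occ_down, Entry.ty_down] at this
    rw [hb.name] at this ⊢
    have e1 : Name.cons T γ e.name = γ e.name.down := by
      conv_lhs => rw [← Name.up_down hz, Name.cons_up]
    rwa [e1]
  have hcnt : M.erase.cnt (.bound 0) = ((r.base.map fE).filter Entry.isZero).length := by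
    rw [h.cnt, ← List.countP_eq_length_filter, List.countP_map]
    refine List.countP_congr fun e _ => ?_
    simp [Entry.isZero_iff, hb.name]
  unfold synthLam
  simp only [box_eq, hb.eq]
  split
  · next x l hx =>
    intro hW hc he
    dsimp only at hW hc he
    have hskel : ∀ e ∈ x :: l, e.ty.skel = σ := by
      intro e he
      rw [← hx, List.mem_filter, List.mem_map] at he
      obtain ⟨⟨e, he, rfl⟩, hz⟩ := he
      rw [Entry.isZero_iff, hb.name] at hz
      rw [hb.skel_entry, h.base_skel e he, hz]
      rfl
    have hcon := (contract_holdsIn (X := X) (W := W) (Θ := x.ty) (l := l.map Entry.ty) (by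
      intro Θ hΘ
      obtain ⟨e, he, rfl⟩ := List.mem_map.1 hΘ
      rw [hskel e (by simp [he]), hskel x (by simp)])).1 fun a ha => hc a (by
        rw [hx]; exact List.mem_append.2 (.inr ha))
    have hinst : ∀ e ∈ x :: l, e.ty.inst X = x.ty.inst X := by
      intro e he
      rcases List.mem_cons.1 he with rfl | he
      · rfl
      · exact hcon.1 _ (List.mem_map_of_mem he)
    refine .lam (hM.box hb ?_ (fun a ha => hc _ (List.mem_append.2
      (.inl (List.mem_map_of_mem ha)))) ?_) ?_
    · exact fun sl hsl => (hW sl hsl).imp_left fun h => (List.mem_filter.1 h).1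
    · intro e he'
      by_cases hz : e.name = .bound 0
      · have hmem : fE e ∈ x :: l := by
          rw [← hx, List.mem_filter, Entry.isZero_iff, hb.name]
          exact ⟨List.mem_map_of_mem he', hz⟩
        -- The slices with an occurrence of the bound variable were dropped, and the empty slice has
        -- no occurrence.
        have h0 : cntOcc W e.occ = 0 := by
          refine List.countP_eq_zero.2 fun sl hsl hocc => ?_
          rcases hW sl hsl with h1 | rfl
          · have := (List.mem_filter.1 h1).2
            rw [Bool.not_eq_true', ← Bool.not_eq_true, List.any_eq_true] at this
            exact this ⟨fE e, hx ▸ hmem, by rwa [hb.occ]⟩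
          · simp at hocc
        unfold Entry.Fits
        rw [hb.name, hb.occ, hz, h0]
        simp [hinst _ hmem]
      · exact fitRest he e he' hz
    · intro h2
      refine hcon.2 fun hl => ?_
      rw [hcnt, hx] at h2
      simp at hl
      simp [hl] at h2
  · next hx =>
    have hz : ∀ e ∈ r.base, e.name ≠ .bound 0 := by
      intro e he hz
      have : fE e ∈ ([] : List Entry) := by
        rw [← hx, List.mem_filter, Entry.isZero_iff, hb.name]
        exact ⟨List.mem_map_of_mem he, hz⟩
      simp at this
    have hm : ∀ {A : Fm}, 2 ≤ M.erase.cnt (.bound 0) → A.IsBang := by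
      intro A h2
      rw [hcnt, hx] at h2
      simp at h2
    obtain ⟨g1, g2, g3⟩ := general_spec σ m
    split
    · intro hW hc he
      dsimp only at hW hc he ⊢
      obtain ⟨o, V, a1, -, a3, a4, a5, a6⟩ := hW.addPoint fun sl hsl h' => by
        have := h.cpt_row sl hsl _ h'
        have := hb.le
        omega
      have fitV : ∀ e ∈ r.base, (fE e).Fits X V (Name.cons ((general σ m).1.inst X, W.length) γ) :=
        fun e he' => fitRest (fun e h' => (he e h').leave a1 (a6 _ (List.mem_map_of_mem h'))) e he'
          (hz e he')
      refine .lam ?_ hm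
      have lM := hM.box hb a3 (fun a ha => by
        refine (Constraint.holdsIn_congr_rows fun q hq => ?_).1 (hc _ (List.mem_append.2
          (.inl (List.mem_map_of_mem ha))))
        rw [hb.row] at hq
        have := h.row a ha q hq
        have := hb.le
        exact a5 q (by omega)) fitV
      have hrow := hc (.eqn (some ((general σ m).2 + 1)) (fT r.ty).exps [(general σ m).2]) (by simp)
      simp only [Constraint.HoldsIn, Option.elim, a4] at hrow
      -- The equation splits the exponent of the body into the `o` boxes left at its root and the
      -- exponent that the resulting type keeps.
      rw [GTy.inst_eq X (fT r.ty), hrow, add_comm, Function.iterate_add_apply, ← GTy.inst_setExps] at lM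
      rw [a1]
      rw [a1] at lM
      refine lM.exit_iterate _ (h.level_le fun e he => ?_)
      have := (fitV e he).1
      rw [hb.name, a1] at this
      omega
    · intro hW hc he
      dsimp only at hW hc he ⊢
      exact .lam (hM.box hb hW (fun a ha => hc _ (List.mem_map_of_mem ha))
        fun e he' => fitRest he e he' (hz e he')) hm

theorem synthVar_sound (v : Name) (σ : Ty) (n : ℕ) : (synthVar v σ n).Sound v.toTm := by
  intro X W γ _ _ he
  obtain ⟨h1, h2⟩ := he ⟨(general σ n).2, v, (general σ n).1⟩ (by simp [synthVar])
  dsimp only at h1 h2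
  have : cntOcc W (general σ n).2 = 0 := by
    refine List.countP_eq_zero.2 fun sl hsl hocc => ?_
    rcases ‹SliceOf _ W› sl hsl with h | rfl
    · simp [synthVar] at h
    · simp at hocc
  rw [this] at h1 h2
  exact .var v rfl (by omega) h2

theorem synth_sound {ρ : ℕ → Ty} {Δ : List Ty} {D : CTm} {σ : Ty} (h : HasType ρ Δ D σ) (n : ℕ) :
    (synth ρ Δ D n).Sound D.erase := by
  induction h generalizing n with
  | fvar Δ x => exact synthVar_sound (.free x) _ n
  | @bvar Δ k σ h => exact synthVar_sound (.bound k) _ n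
  | lam h ih => exact synthLam_sound (synth_good h n) (ih n)
  | app hM hN ihM ihN =>
    exact synthApp_sound (synth_good hM n) (synth_good hN _) (ihM n) (ihN _)

/-! ### Changing the skeleton of a formula -/

/-- A simple type as a formula without exponentials. -/
def Ty.toFm : Ty → Fm
  | .var a => .var a
  | .arr σ τ => .limp σ.toFm τ.toFm

/-- Keep the exponentials of a formula, as far as its structure agrees with the simple type `σ`,
but take the rest from `σ`. -/
def Fm.reshape : Fm → Ty → Fm
  | .bang A, σ => .bang (A.reshape σ)
  | .limp A B, .arr σ τ => .limp (A.reshape σ) (B.reshape τ)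
  | .limp _ _, .var a => .var a
  | .var _, σ => σ.toFm

theorem Ty.skel_toFm (σ : Ty) : σ.toFm.skel = σ := by
  induction σ with
  | var a => rfl
  | arr σ τ ih1 ih2 => simp [Ty.toFm, Fm.skel, ih1, ih2]

theorem Fm.skel_reshape (A : Fm) (σ : Ty) : (A.reshape σ).skel = σ := by
  induction A generalizing σ with
  | var a => simp [Fm.reshape, Ty.skel_toFm]
  | limp A B ih1 ih2 => cases σ <;> simp [Fm.reshape, Fm.skel, ih1, ih2]
  | bang A ih => exact ih σ

theorem Fm.reshape_iterate (k : ℕ) (A : Fm) (σ : Ty) :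
    (Fm.bang^[k] A).reshape σ = Fm.bang^[k] (A.reshape σ) := by
  induction k with
  | zero => rfl
  | succ k ih => rw [Function.iterate_succ_apply', Function.iterate_succ_apply', Fm.reshape, ih]

theorem Fm.IsBang.reshape {A : Fm} (h : A.IsBang) (σ : Ty) : (A.reshape σ).IsBang := by
  obtain ⟨B, rfl⟩ := h
  exact ⟨B.reshape σ, rfl⟩

/-- Reshape all types of a context. -/
def LCtx.reshape (γ : LCtx) (δ : Name → Ty) : LCtx := fun v => ((γ v).1.reshape (δ v), (γ v).2)

theorem Fm.exists_of_iterate_eq {o s : ℕ} {A B : Fm} (hB : ¬ B.IsBang)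
    (h : Fm.bang^[o] A = Fm.bang^[s] B) : ∃ k, s = k + o ∧ A = Fm.bang^[k] B := by
  rcases Nat.le_total o s with hle | hle
  · obtain ⟨k, rfl⟩ := Nat.exists_eq_add_of_le' hle
    refine ⟨k, rfl, ?_⟩
    rw [add_comm, Function.iterate_add_apply, Fm.bang_iterate_inj] at h
    exact h
  · obtain ⟨k, rfl⟩ := Nat.exists_eq_add_of_le' hle
    rw [add_comm, Function.iterate_add_apply, Fm.bang_iterate_inj] at h
    cases k with
    | zero => exact ⟨0, by simp, by simpa using h⟩
    | succ k =>
      rw [Function.iterate_succ_apply'] at h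
      exact absurd ⟨_, h.symm⟩ hB

/-! ### Inversion of typing with levels -/

/-- The last rule is neither the entering nor the leaving of a box. -/
def Leveled.Step (γ : LCtx) (r : ℕ) : Tm → Fm → Prop
  | .fvar x, A => (γ (.free x)).2 ≤ r ∧ (γ (.free x)).1 = Fm.bang^[r - (γ (.free x)).2] A
  | .bvar k, A => (γ (.bound k)).2 ≤ r ∧ (γ (.bound k)).1 = Fm.bang^[r - (γ (.bound k)).2] A
  | .lam M, C => ∃ A B, C = .limp A B ∧ Leveled (Name.cons (A, r) γ) r M B ∧
      (2 ≤ M.cnt (.bound 0) → A.IsBang)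
  | .app M N, B => ∃ A, Leveled γ r M (.limp A B) ∧ Leveled γ r N A

theorem Leveled.step_toTm {γ : LCtx} {r : ℕ} {v : Name} {A : Fm} :
    Leveled.Step γ r v.toTm A ↔ (γ v).2 ≤ r ∧ (γ v).1 = Fm.bang^[r - (γ v).2] A := by
  cases v <;> rfl

def Tm.IsApp (M : Tm) : Prop := ∃ N P, M = .app N P
def Tm.IsVar (M : Tm) : Prop := ∃ v : Name, M = v.toTm

theorem CTm.isApp_of_erase {D : CTm} (h : D.erase.IsApp) : D.isApp = true := by
  obtain ⟨N, P, h⟩ := h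
  cases D <;> simp_all [CTm.erase, CTm.isApp]

theorem CTm.isVar_erase {D : CTm} (h : D.isVar = true) : D.erase.IsVar := by
  cases D with
  | fvar x => exact ⟨.free x, rfl⟩
  | bvar k => exact ⟨.bound k, rfl⟩
  | lam => simp [CTm.isVar] at h
  | app => simp [CTm.isVar] at h

/-- Seen from outside, `o` boxes are left and then `i` are entered, since entering a box and leaving
it at once cancels. A variable absorbs both. An abstraction has an implication as its type, so
leaving a box presupposes an entering just inside, and the two cancel. Hence critical points are
needed at applications only. -/
theorem Leveled.invert {γ : LCtx} {r : ℕ} {M : Tm} {A : Fm} (h : Leveled γ r M A)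
    (hl : ∀ v, M.cnt v ≠ 0 → (γ v).2 ≤ r) :
    ∃ q o i A', r = q + o ∧ (∀ v, M.cnt v ≠ 0 → (γ v).2 ≤ q) ∧ Leveled.Step γ (q + i) M A' ∧
      Fm.bang^[o] A = Fm.bang^[i] A' ∧ (o = 0 ∨ M.IsApp) ∧ (i = 0 ∨ ¬ M.IsVar) := by
  induction h with
  | @var γ r M A v hM hle hT =>
    subst hM
    exact ⟨r, 0, 0, A, rfl, hl, Leveled.step_toTm.2 ⟨hle, hT⟩, rfl, .inl rfl, .inl rfl⟩
  | @lam γ r M A B h hm _ =>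
    exact ⟨r, 0, 0, _, rfl, hl, ⟨A, B, rfl, h, hm⟩, rfl, .inl rfl, .inl rfl⟩
  | @app γ r M N A B hM hN _ _ =>
    exact ⟨r, 0, 0, _, rfl, hl, ⟨A, hM, hN⟩, rfl, .inl rfl, .inl rfl⟩
  | @enter γ r M A h ih =>
    obtain ⟨q, o, i, A', h1, h2, h3, h4, h5, h6⟩ := ih fun v hv => (hl v hv).trans (by omega)
    cases o with
    | zero =>
      obtain rfl : q = r + 1 := by omega
      by_cases hv : M.IsVar
      · obtain rfl : i = 0 := h6.resolve_right (fun h => h hv)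
        obtain ⟨v, rfl⟩ := hv
        obtain ⟨h7, h8⟩ := Leveled.step_toTm.1 h3
        have hv := hl v (by simp)
        refine ⟨r, 0, 0, .bang A', rfl, hl, Leveled.step_toTm.2 ⟨hv, ?_⟩, ?_, .inl rfl, .inl rfl⟩
        · rw [h8, add_zero, Nat.succ_sub hv]
          rfl
        · simpa using h4
      · refine ⟨r, 0, i + 1, A', rfl, hl, by rwa [add_right_comm] at h3, ?_, .inl rfl, .inr hv⟩
        rw [Function.iterate_succ_apply', ← h4]
        rfl
    | succ o =>
      refine ⟨q, o, i, A', by omega, h2, h3, ?_, .inr (h5.resolve_left (by omega)), h6⟩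
      rw [← h4]
      rfl
  | @exit γ r M A h hl' ih =>
    obtain ⟨q, o, i, A', h1, h2, h3, h4, h5, h6⟩ := ih hl'
    by_cases ha : M.IsApp
    · exact ⟨q, o + 1, i, A', by omega, h2, h3, h4, .inr ha, h6⟩
    · obtain rfl : o = 0 := h5.resolve_right ha
      obtain rfl : r = q := h1
      have h4' : Fm.bang A = Fm.bang^[i] A' := h4
      by_cases hv : M.IsVar
      · obtain rfl : i = 0 := h6.resolve_right (fun h => h hv)
        obtain ⟨v, rfl⟩ := hv
        obtain ⟨h7, h8⟩ := Leveled.step_toTm.1 h3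
        refine ⟨r + 1, 0, 0, A, rfl, hl, Leveled.step_toTm.2 ⟨h7.trans (by omega), ?_⟩, rfl,
          .inl rfl, .inl rfl⟩
        have h9 : A' = .bang A := h4'.symm
        rw [h8, h9, add_zero, add_zero, Nat.succ_sub h7]
        rfl
      · cases M with
        | fvar x => exact absurd ⟨.free x, rfl⟩ hv
        | bvar k => exact absurd ⟨.bound k, rfl⟩ hv
        | app N P => exact absurd ⟨N, P, rfl⟩ ha
        | lam M =>
          cases i with
          | zero =>
            obtain ⟨C, B, rfl, -, -⟩ := h3
            cases h4'
          | succ i =>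
            rw [Function.iterate_succ_apply', Fm.bang.injEq] at h4'
            exact ⟨r + 1, 0, i, A', rfl, hl, by rwa [← add_assoc, add_right_comm] at h3, h4',
              .inl rfl, .inr hv⟩

/-- An implication has no outer `!`, so every box entered cancels against one that was left. -/
theorem Leveled.invert_limp {γ : LCtx} {r : ℕ} {M : Tm} {A B : Fm}
    (h : Leveled γ r M (.limp A B)) (hl : ∀ v, M.cnt v ≠ 0 → (γ v).2 ≤ r) :
    ∃ q o, r = q + o ∧ (∀ v, M.cnt v ≠ 0 → (γ v).2 ≤ q) ∧
      Leveled.Step γ q M (Fm.bang^[o] (.limp A B)) ∧ (o = 0 ∨ M.IsApp) := by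
  obtain ⟨q, o, i, A', h1, h2, h3, h4, h5, -⟩ := h.invert hl
  obtain ⟨k, rfl, rfl⟩ := Fm.exists_of_iterate_eq (Fm.not_isBang_limp A B) h4.symm
  exact ⟨q + i, k, by omega, fun v hv => (h2 v hv).trans (by omega), h3,
    h5.imp_left fun h => by omega⟩

/-! ### Completeness of type synthesis -/

/-- The entry does not occur in the slices of the outermost boxes, up to its level. -/
def Entry.Avoids (W : List Slice) (γ : LCtx) (e : Entry) : Prop :=
  ∀ sl ∈ W.drop (W.length - (γ e.name).2), ¬ sl.hasOcc e.occ = true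

theorem Entry.Fits.congr {X Y : ℕ → ℕ} {W : List Slice} {γ : LCtx} {e : Entry} {n : ℕ}
    (h : e.Fits X W γ) (he : e.ty.Below n) (hXY : ∀ i < n, Y i = X i) : e.Fits Y W γ :=
  ⟨h.1, by rw [GTy.inst_congr he hXY]; exact h.2⟩

/-! ### Assembling slices for the completeness proof -/

/-- Leaving `o` boxes at a critical point, then using the slices in `V`. -/
def exitSlices (o row : ℕ) (os : List ℕ) (V : List Slice) : List Slice :=
  List.replicate o [(row, os)] ++ V

theorem length_exitSlices (o row : ℕ) (os : List ℕ) (V : List Slice) :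
    (exitSlices o row os V).length = V.length + o := by simp [exitSlices, add_comm]

theorem sliceOf_exitSlices {b : Bool} {cpts : List Slice} {o row : ℕ} {os : List ℕ}
    {V : List Slice} (hV : SliceOf cpts V) (hb : o = 0 ∨ b = true) :
    SliceOf (addPoint b cpts row os) (exitSlices o row os V) := by
  intro sl hsl
  rcases List.mem_append.1 hsl with h | h
  · obtain ⟨h1, h2⟩ := List.mem_replicate.1 h
    exact .inl (mem_addPoint.2 (.inr ⟨hb.resolve_left h1, h2⟩))
  · exact (hV sl h).imp_left fun h => mem_addPoint.2 (.inl h)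

theorem cntRow_exitSlices_of_ne {o row r : ℕ} {os : List ℕ} {V : List Slice} (h : r ≠ row) :
    cntRow (exitSlices o row os V) r = cntRow V r := by
  have : ¬ Slice.hasRow [(row, os)] r = true := fun h' => h (Slice.hasRow_singleton.1 h').symm
  rw [exitSlices, cntRow_append, cntRow_replicate, if_neg this, zero_add]

theorem cntRow_exitSlices_self {o row : ℕ} {os : List ℕ} {V cpts : List Slice}
    (hV : SliceOf cpts V) (hf : ∀ sl ∈ cpts, ¬ sl.hasRow row = true) :
    cntRow (exitSlices o row os V) row = o := by
  have : cntRow V row = 0 := by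
    refine List.countP_eq_zero.2 fun sl hsl h => ?_
    rcases hV sl hsl with h' | rfl
    · exact hf sl h' h
    · simp at h
  rw [exitSlices, cntRow_append, cntRow_replicate, if_pos (Slice.hasRow_singleton.2 rfl), this,
    add_zero]

theorem Entry.Fits.exitSlices {X : ℕ → ℕ} {V : List Slice} {γ : LCtx} {e : Entry} {o row : ℕ}
    {os : List ℕ} (h : e.Fits X V γ) (he : e.occ ∈ os) :
    e.Fits X (exitSlices o row os V) γ := by
  have hc : cntOcc (EAL.exitSlices o row os V) e.occ = o + cntOcc V e.occ := by
    rw [EAL.exitSlices, cntOcc_append, cntOcc_replicate, if_pos (Slice.hasOcc_singleton.2 he)]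
  obtain ⟨h1, h2⟩ := h
  unfold Entry.Fits
  rw [length_exitSlices, hc]
  refine ⟨by omega, ?_⟩
  rw [h2]
  have : V.length + o - (γ e.name).2 - (o + cntOcc V e.occ) =
    V.length - (γ e.name).2 - cntOcc V e.occ := by omega
  rw [this]

/-- The boxes left here are the innermost ones, all inside the binder of the entry. -/
theorem Entry.Avoids.exitSlices {V : List Slice} {γ : LCtx} {e : Entry} {o row : ℕ}
    {os : List ℕ} (h : e.Avoids V γ) (hl : (γ e.name).2 ≤ V.length) :
    e.Avoids (exitSlices o row os V) γ := by
  unfold Entry.Avoids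
  rw [length_exitSlices, EAL.exitSlices, List.drop_append]
  have h1 : V.length + o - (γ e.name).2 - (List.replicate o [(row, os)]).length =
      V.length - (γ e.name).2 := by simp; omega
  rw [h1, List.drop_of_length_le (by simp; omega), List.nil_append]
  exact h

/-- The converse of `SliceOf.prodUnion`: the two parts of each open box are glued position by
position. Whole lists of membership bits are compared, not just counts, because `Entry.Avoids`
depends on positions. -/
theorem sliceOf_zip {P Q W₁ W₂ : List Slice} (h₁ : SliceOf P W₁) (h₂ : SliceOf Q W₂)
    (hl : W₁.length = W₂.length) :
    (List.zipWith (· ++ ·) W₁ W₂).length = W₁.length ∧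
      SliceOf (prodUnion P Q) (List.zipWith (· ++ ·) W₁ W₂) ∧
      (∀ r, (∀ t ∈ Q, ¬ t.hasRow r = true) →
        cntRow (List.zipWith (· ++ ·) W₁ W₂) r = cntRow W₁ r) ∧
      (∀ r, (∀ s ∈ P, ¬ s.hasRow r = true) →
        cntRow (List.zipWith (· ++ ·) W₁ W₂) r = cntRow W₂ r) ∧
      (∀ x, (∀ t ∈ Q, ¬ t.hasOcc x = true) → (List.zipWith (· ++ ·) W₁ W₂).map (·.hasOcc x) =
        W₁.map (·.hasOcc x)) ∧
      ∀ x, (∀ s ∈ P, ¬ s.hasOcc x = true) → (List.zipWith (· ++ ·) W₁ W₂).map (·.hasOcc x) =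
        W₂.map (·.hasOcc x) := by
  have nr : ∀ {L : List Slice} {s : Slice} {r : ℕ}, (s ∈ L ∨ s = []) →
      (∀ t ∈ L, ¬ t.hasRow r = true) → s.hasRow r = false := by
    rintro L s r (h | rfl) h'
    · simpa using h' s h
    · rfl
  have no : ∀ {L : List Slice} {s : Slice} {r : ℕ}, (s ∈ L ∨ s = []) →
      (∀ t ∈ L, ¬ t.hasOcc r = true) → s.hasOcc r = false := by
    rintro L s r (h | rfl) h'
    · simpa using h' s h
    · rfl
  induction W₁ generalizing W₂ with
  | nil =>
    obtain rfl : W₂ = [] := List.eq_nil_of_length_eq_zero hl.symm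
    simp [SliceOf]
  | cons s W₁ ih =>
    cases W₂ with
    | nil => simp at hl
    | cons t W₂ =>
      obtain ⟨k1, k2, k3, k4, k5, k6⟩ := ih (W₂ := W₂)
        (fun u hu => h₁ u (List.mem_cons_of_mem _ hu))
        (fun u hu => h₂ u (List.mem_cons_of_mem _ hu)) (by simpa using hl)
      have hs := h₁ s (by simp)
      have ht := h₂ t (by simp)
      refine ⟨by simp [k1], ?_, ?_, ?_, ?_, ?_⟩
      · intro u hu
        rw [List.zipWith_cons_cons, List.mem_cons] at hu
        rcases hu with rfl | hu
        · exact mem_prodUnion_or.2 ⟨s, t, hs, ht, rfl⟩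
        · exact k2 u hu
      · intro r hr
        have := k3 r hr
        simp only [cntRow, List.zipWith_cons_cons, List.countP_cons, Slice.hasRow_append,
          nr ht hr, Bool.or_false] at this ⊢
        omega
      · intro r hr
        have := k4 r hr
        simp only [cntRow, List.zipWith_cons_cons, List.countP_cons, Slice.hasRow_append,
          nr hs hr, Bool.false_or] at this ⊢
        omega
      · intro x hx
        have := k5 x hx
        simp only [List.zipWith_cons_cons, List.map_cons, Slice.hasOcc_append,
          no ht hx, Bool.or_false, this]
      · intro x hx
        have := k6 x hx
        simp only [List.zipWith_cons_cons, List.map_cons, Slice.hasOcc_append,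
          no hs hx, Bool.false_or, this]

theorem Entry.Fits.of_map {X : ℕ → ℕ} {V W : List Slice} {γ : LCtx} {e : Entry}
    (h : e.Fits X V γ) (hm : W.map (·.hasOcc e.occ) = V.map (·.hasOcc e.occ)) :
    e.Fits X W γ := by
  have hl : W.length = V.length := by simpa using congrArg List.length hm
  have hc : cntOcc W e.occ = cntOcc V e.occ := by
    have := congrArg (List.countP id) hm
    simpa [cntOcc, List.countP_map, Function.comp_def] using this
  unfold Entry.Fits
  rw [hl, hc]
  exact h

theorem Entry.Avoids.of_map {V W : List Slice} {γ : LCtx} {e : Entry}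
    (h : e.Avoids V γ) (hm : W.map (·.hasOcc e.occ) = V.map (·.hasOcc e.occ)) :
    e.Avoids W γ := by
  have hl : W.length = V.length := by simpa using congrArg List.length hm
  intro sl hsl hocc
  have h1 : true ∈ (W.map (·.hasOcc e.occ)).drop (V.length - (γ e.name).2) := by
    rw [← List.map_drop, ← hl]
    exact List.mem_map.2 ⟨sl, hsl, hocc⟩
  rw [hm, ← List.map_drop] at h1
  obtain ⟨sl', h2, h3⟩ := List.mem_map.1 h1
  exact h sl' h2 h3

/-- Every typing of `M` with levels comes from a solution of the constraints in `o`, up to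
the skeletons of the types. -/
def Out.Complete (M : Tm) (δ : Name → Ty) (σ : Ty) (n : ℕ) (o : Out) : Prop :=
  ∀ (X₀ : ℕ → ℕ) (γ : LCtx) (d : ℕ) (A : Fm), Leveled.Step γ d M A →
    (∀ v, M.cnt v ≠ 0 → (γ v).2 ≤ d) →
    ∃ (X : ℕ → ℕ) (W : List Slice), (∀ i < n, X i = X₀ i) ∧ W.length = d ∧ SliceOf o.cpts W ∧
      (∀ a ∈ o.cons, a.HoldsIn X W) ∧
      (∀ e ∈ o.base, e.Fits X W (γ.reshape δ) ∧ e.Avoids W γ) ∧ o.ty.inst X = A.reshape σ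

/-- After inversion, the `i` innermost slices of `W` belong to the boxes entered at the root and
become the values of the fresh boxing variables; the other slices stay open, and `o` boxes remain to
be accounted for as left at the root. -/
theorem Out.Complete.box {ρ : ℕ → Ty} {Δ : List Ty} {D : CTm} {τ : Ty} {n : ℕ} {r : Out}
    (h : r.Complete D.erase (tyOf ρ Δ) τ n) (hg : r.Good ρ Δ D τ n) {m : ℕ} {fE : Entry → Entry}
    {fT : GTy → GTy} {fC : Constraint → Constraint}
    (hb : BoxSpec (boxCuts D r.cpts) r.next m fE fT fC) (X₀ : ℕ → ℕ) {γ : LCtx} {d : ℕ} {A : Fm}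
    (hA : Leveled γ d D.erase A) (hl : ∀ v, D.erase.cnt v ≠ 0 → (γ v).2 ≤ d) :
    ∃ (X : ℕ → ℕ) (V : List Slice) (o : ℕ), (∀ i < n, X i = X₀ i) ∧ d = V.length + o ∧
      (o = 0 ∨ D.isApp = true) ∧ SliceOf r.cpts V ∧ (∀ a ∈ r.cons, (fC a).HoldsIn X V) ∧
      (∀ e ∈ r.base, (fE e).Fits X V (γ.reshape (tyOf ρ Δ)) ∧ (fE e).Avoids V γ) ∧
      (fT r.ty).inst X = Fm.bang^[o] (A.reshape τ) := by
  obtain ⟨q, o, i, A', h1, h2, h3, h4, h5, h6⟩ := hA.invert hl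
  obtain ⟨X₁, W, k1, k2, k3, k4, k5, k6⟩ := h X₀ γ (q + i) A' h3
    fun v hv => (h2 v hv).trans (by omega)
  obtain ⟨X, l1, l2⟩ := exists_boxUnits_perm X₁ (boxCuts D r.cpts) r.next (W.take i) (by
    intro sl hsl
    unfold boxCuts
    split
    · next hv =>
      have : i = 0 := h6.resolve_right fun h => h (CTm.isVar_erase hv)
      simp [this] at hsl
    · simpa using k3 sl (List.mem_of_mem_take hsl))
  have hlen : (W.take i).length = i := by simp [k2]
  have hV : (W.drop i).length = q := by simp [k2]
  refine ⟨X, W.drop i, o, fun j hj => ?_, by omega, h5.imp_right CTm.isApp_of_erase,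
    fun sl hsl => k3 sl (List.mem_of_mem_drop hsl), fun a ha => ?_, fun e he => ?_, ?_⟩
  · rw [l1 j (hj.trans_le hg.le), k1 j hj]
  · rw [hb.holdsIn, Constraint.holdsIn_congr (hg.cons_below a ha) l1 (W := W)]
    · exact k4 a ha
    · intro row _
      rw [cntRow_append, cntRow_perm l2, ← cntRow_append, List.take_append_drop]
  · obtain ⟨f1, f2⟩ := k5 e he
    have hc : cntOcc W e.occ = cntOcc (W.take i) e.occ + cntOcc (W.drop i) e.occ := by
      rw [← cntOcc_append, List.take_append_drop]
    have hle : (γ e.name).2 ≤ q := by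
      refine h2 _ ?_
      rw [hg.cnt]
      exact (List.countP_pos_iff.2 ⟨e, he, by simp⟩).ne'
    have havoid : (fE e).Avoids (W.drop i) γ := by
      unfold Entry.Avoids at f2 ⊢
      rw [hb.name, hb.occ, hV, List.drop_drop]
      have : i + (q - (γ e.name).2) = W.length - (γ e.name).2 := by omega
      rwa [this]
    -- Boxes around the binder are not left on the way to the occurrence, so at most `q` minus its
    -- level can be. This bound keeps the truncated subtractions below exact.
    have hcV : cntOcc (W.drop i) e.occ ≤ q - (γ e.name).2 := by
      unfold Entry.Avoids at havoid
      rw [hb.name, hb.occ, hV] at havoid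
      have h0 : cntOcc ((W.drop i).drop (q - (γ e.name).2)) e.occ = 0 :=
        List.countP_eq_zero.2 havoid
      have h1 := cntOcc_le ((W.drop i).take (q - (γ e.name).2)) e.occ
      have h2 := cntOcc_append ((W.drop i).take (q - (γ e.name).2))
        ((W.drop i).drop (q - (γ e.name).2)) e.occ
      rw [List.take_append_drop] at h2
      have h3 : ((W.drop i).take (q - (γ e.name).2)).length ≤ q - (γ e.name).2 :=
        List.length_take_le _ _
      omega
    refine ⟨?_, havoid⟩
    have hcU := cntOcc_le (W.take i) e.occ
    rw [hlen] at hcU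
    unfold Entry.Fits at f1 ⊢
    rw [hb.inst_entry, cntOcc_perm l2, l2.length_eq, hlen, hb.name, hb.occ, hV,
      GTy.inst_congr (hg.base_below e he) l1, ← Function.iterate_add_apply]
    simp only [LCtx.reshape] at f1 ⊢
    refine ⟨by omega, ?_⟩
    rw [f1.2, k2, hc]
    have : q + i - (γ e.name).2 - (cntOcc (W.take i) e.occ + cntOcc (W.drop i) e.occ) =
      q - (γ e.name).2 - cntOcc (W.drop i) e.occ + (i - cntOcc (W.take i) e.occ) := by omega
    rw [this]
  · rw [hb.inst_ty, l2.length_eq, hlen, GTy.inst_congr hg.ty_below l1, k6, ← Fm.reshape_iterate,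
      ← h4, Fm.reshape_iterate]

theorem synthVar_complete {δ : Name → Ty} (v : Name) (n : ℕ) :
    (synthVar v (δ v) n).Complete v.toTm δ (δ v) n := by
  intro X₀ γ d A h _
  obtain ⟨h1, h2⟩ := Leveled.step_toTm.1 h
  obtain ⟨X, hX, hX'⟩ := general_inst X₀ (δ v) n (A.reshape (δ v)) (Fm.skel_reshape _ _)
  -- There is no critical point at a variable, so every box still open is never left.
  refine ⟨X, List.replicate d [], hX, by simp, ?_, by simp [synthVar], ?_, hX'⟩
  · exact fun sl hsl => .inr (List.eq_of_mem_replicate hsl)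
  · intro e he
    simp only [synthVar, List.mem_singleton] at he
    subst he
    refine ⟨⟨?_, ?_⟩, ?_⟩
    · simpa [cntOcc_replicate, LCtx.reshape] using h1
    · simp only [cntOcc_replicate, LCtx.reshape, h2, Fm.reshape_iterate, hX']
      simp
    · intro sl hsl
      rw [List.eq_of_mem_replicate (List.mem_of_mem_drop hsl)]
      simp

theorem synthApp_complete {ρ : ℕ → Ty} {Δ : List Ty} {M N : CTm} {σ τ : Ty} {lo : ℕ} {r s : Out}
    (hr : r.Good ρ Δ M (.arr σ τ) lo) (hs : s.Good ρ Δ N σ r.next)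
    (hM : r.Complete M.erase (tyOf ρ Δ) (.arr σ τ) lo)
    (hN : s.Complete N.erase (tyOf ρ Δ) σ r.next) :
    (synthApp M N r s).Complete (.app M.erase N.erase) (tyOf ρ Δ) τ lo := by
  obtain ⟨m, fE, fT, fC, hb⟩ := exists_boxSpec (boxCuts N s.cpts) s.next
  obtain ⟨rty, rbase, rcons, rcpts, rnext⟩ := r
  have hle2 := hs.le
  have hle3 := hb.le
  dsimp only at hle2 hle3 hs hN
  cases rty with
  | var => have := hr.ty_skel; simp [GTy.skel] at this
  | limp ns Θ Γ =>
    have hsk := hr.ty_skel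
    simp only [GTy.skel, Ty.arr.injEq] at hsk
    have hbel := hr.ty_below
    dsimp only at hbel
    rintro X₀ γ d B ⟨A, lM, lN⟩ hl
    have hlM : ∀ v, M.erase.cnt v ≠ 0 → (γ v).2 ≤ d := fun v hv => hl v (by simp; omega)
    have hlN : ∀ v, N.erase.cnt v ≠ 0 → (γ v).2 ≤ d := fun v hv => hl v (by simp; omega)
    obtain ⟨q₁, o₁, a1, a2, a3, a4⟩ := lM.invert_limp hlM
    -- The solution is extended in the order of the counter: the values chosen for `N` leave the
    -- variables of `M` untouched.
    obtain ⟨X₁, V₁, b1, b2, b3, b4, b5, b6⟩ := hM X₀ γ q₁ _ a3 a2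
    obtain ⟨X, V₂, o₂, c1, c2, c3, c4, c5, c6, c7⟩ := hN.box hs hb X₁ lN hlN
    dsimp only at b3 b4 b5 b6
    rw [Fm.reshape_iterate, Fm.reshape, GTy.inst,
      Fm.bang_iterate_eq (Fm.not_isBang_limp _ _) (Fm.not_isBang_limp _ _), Fm.limp.injEq] at b6
    obtain ⟨d1, d2, d3⟩ := b6
    unfold synthApp
    simp only [box_eq, hb.eq]
    have freshM : ∀ sl ∈ rcpts, ¬ sl.hasRow m = true := fun sl hsl h => by
      have := hr.cpt_row sl hsl _ h
      dsimp only at this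
      omega
    have freshN : ∀ sl ∈ s.cpts, ¬ sl.hasRow (m + 1) = true := fun sl hsl h => by
      have := hs.cpt_row sl hsl _ h
      omega
    have s1 := sliceOf_exitSlices (b := M.isApp) (o := o₁) (row := m) (os := occs rbase) b3
      (a4.imp_right CTm.isApp_of_erase)
    have s2 := sliceOf_exitSlices (b := N.isApp) (o := o₂) (row := m + 1)
      (os := occs (s.base.map fE)) c4 c3
    obtain ⟨k1, k2, k3, k4, k5, k6⟩ := sliceOf_zip s1 s2 (by
      rw [length_exitSlices, length_exitSlices, b2, ← a1, c2])
    set W₁ := exitSlices o₁ m (occs rbase) V₁ with hW₁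
    set W₂ := exitSlices o₂ (m + 1) (occs (s.base.map fE)) V₂ with hW₂
    have rowM : ∀ q, q < rnext ∨ q = m →
        cntRow (List.zipWith (· ++ ·) W₁ W₂) q = cntRow W₁ q := by
      intro q hq
      refine k3 q fun t ht h => ?_
      rcases mem_addPoint.1 ht with ht | ⟨_, rfl⟩
      · have := hs.cpt_row t ht q h
        omega
      · rw [Slice.hasRow_singleton] at h
        omega
    have rowN : ∀ q, (rnext ≤ q ∧ q < m) ∨ q = m + 1 →
        cntRow (List.zipWith (· ++ ·) W₁ W₂) q = cntRow W₂ q := by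
      intro q hq
      refine k4 q fun t ht h => ?_
      rcases mem_addPoint.1 ht with ht | ⟨_, rfl⟩
      · have := hr.cpt_row t ht q h
        dsimp only at this
        omega
      · rw [Slice.hasRow_singleton] at h
        omega
    refine ⟨X, List.zipWith (· ++ ·) W₁ W₂, ?_, ?_, k2, ?_, ?_, ?_⟩
    · intro i hi
      rw [c1 i (hi.trans_le hr.le), b1 i hi]
    · rw [k1, hW₁, length_exitSlices]
      omega
    · intro a ha
      simp only [List.mem_append, List.mem_singleton] at ha
      rcases ha with ((ha | ha) | ha) | rfl
      · refine (Constraint.holdsIn_congr (hr.cons_below a ha) c1 fun q hq => ?_).2 (b4 a ha)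
        have := hr.row a ha q hq
        dsimp only at this
        rw [rowM q (by omega), hW₁, cntRow_exitSlices_of_ne (by omega)]
      · rw [List.mem_map] at ha
        obtain ⟨a, ha, rfl⟩ := ha
        refine (Constraint.holdsIn_congr_rows fun q hq => ?_).2 (c5 a ha)
        rw [hb.row] at hq
        have := hs.row a ha q hq
        rw [rowN q (by omega), hW₂, cntRow_exitSlices_of_ne (by omega)]
      · refine (unify_holdsIn (some (m + 1)) (by rw [hb.skel_ty, hs.ty_skel, hsk.1])).2 ?_ a ha
        simp only [Option.elim]
        rw [rowN _ (by omega), hW₂, cntRow_exitSlices_self c4 freshN, c7,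
          GTy.inst_congr hbel.2.1 c1, d2]
      · simp only [Constraint.HoldsIn, Option.elim, sumOf_nil, zero_add]
        rw [rowM _ (by omega), hW₁, cntRow_exitSlices_self b3 freshM, sumOf_congr hbel.1 c1, d1]
    · intro e he
      rw [List.mem_append] at he
      rcases he with he | he
      · have hm := k5 e.occ (by
          intro t ht h'
          have h1 := (hr.occ e he).2
          dsimp only at h1
          rcases mem_addPoint.1 ht with ht | ⟨_, rfl⟩
          · have := hs.cpt_occ t ht _ h'
            omega
          · rw [Slice.hasOcc_singleton] at h'
            obtain ⟨e', he', h2⟩ := List.mem_map.1 h'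
            obtain ⟨e'', he'', rfl⟩ := List.mem_map.1 he'
            rw [hb.occ] at h2
            have := hs.occ e'' he''
            omega)
        obtain ⟨f1, f2⟩ := b5 e he
        have hlv : (γ e.name).2 ≤ V₁.length := by
          have := f1.1
          simp only [LCtx.reshape] at this
          omega
        exact ⟨((f1.congr (hr.base_below e he) c1).exitSlices (List.mem_map_of_mem he)).of_map hm,
          (f2.exitSlices hlv).of_map hm⟩
      · rw [List.mem_map] at he
        obtain ⟨e, he, rfl⟩ := he
        have hm := k6 (fE e).occ (by
          intro t ht h'
          rw [hb.occ] at h'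
          have h1 := (hs.occ e he).1
          rcases mem_addPoint.1 ht with ht | ⟨_, rfl⟩
          · have := hr.cpt_occ t ht _ h'
            dsimp only at this
            omega
          · rw [Slice.hasOcc_singleton] at h'
            obtain ⟨e', he', h2⟩ := List.mem_map.1 h'
            have := hr.occ e' he'
            dsimp only at this
            omega)
        obtain ⟨f1, f2⟩ := c6 e he
        have hlv : (γ (fE e).name).2 ≤ V₂.length := by
          have := f1.1
          simp only [LCtx.reshape] at this
          omega
        exact ⟨(f1.exitSlices (List.mem_map_of_mem (List.mem_map_of_mem he))).of_map hm,
          (f2.exitSlices hlv).of_map hm⟩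
    · rw [GTy.inst_congr hbel.2.2 c1, d3]

theorem synthLam_complete {ρ : ℕ → Ty} {Δ : List Ty} {M : CTm} {σ τ : Ty} {lo : ℕ} {r : Out}
    (h : r.Good ρ (σ :: Δ) M τ lo) (hM : r.Complete M.erase (tyOf ρ (σ :: Δ)) τ lo) :
    (synthLam σ M r).Complete (.lam M.erase) (tyOf ρ Δ) (.arr σ τ) lo := by
  obtain ⟨m, fE, fT, fC, hb⟩ := exists_boxSpec (boxCuts M r.cpts) r.next
  rintro X₀ γ d C ⟨A, B, rfl, lM, hm⟩ hl
  have hl' : ∀ v, M.erase.cnt v ≠ 0 → (Name.cons (A, d) γ v).2 ≤ d := by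
    intro v hv
    rcases v.eq_zero_or_up with rfl | ⟨v, rfl⟩
    · simp
    · simpa using hl v hv
  obtain ⟨X₁, V, o, c1, c2, c3, c4, c5, c6, c7⟩ := hM.box h hb X₀ lM hl'
  have hlom : lo ≤ m := h.le.trans hb.le
  have hz0 : LCtx.reshape (Name.cons (A, d) γ) (tyOf ρ (σ :: Δ)) (.bound 0) = (A.reshape σ, d) :=
    rfl
  have fitRest : ∀ e ∈ ((r.base.map fE).filter fun e => !e.isZero).map Entry.down,
      e.Fits X₁ V (γ.reshape (tyOf ρ Δ)) ∧ e.Avoids V γ ∧ e.ty.Below m ∧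
        (γ e.name).2 ≤ V.length := by
    intro e he
    rw [List.mem_map] at he
    obtain ⟨e, he, rfl⟩ := he
    rw [List.mem_filter, Bool.not_eq_true', ← Bool.not_eq_true, Entry.isZero_iff, List.mem_map] at he
    obtain ⟨⟨e, he, rfl⟩, hz⟩ := he
    obtain ⟨f1, f2⟩ := c6 e he
    have e1 : Name.cons (A, d) γ (fE e).name = γ (fE e).name.down := by
      conv_lhs => rw [← Name.up_down hz, Name.cons_up]
    have e2 : tyOf ρ (σ :: Δ) (fE e).name = tyOf ρ Δ (fE e).name.down := by
      rw [tyOf_cons]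
      conv_lhs => rw [← Name.up_down hz, Name.cons_up]
    unfold Entry.Fits at f1 ⊢
    unfold Entry.Avoids at f2 ⊢
    simp only [LCtx.reshape, Entry.name_down, Entry.occ_down, Entry.ty_down, e1, e2] at f1 f2 ⊢
    exact ⟨f1, f2, hb.below_entry e (h.base_below e he), by omega⟩
  have hcnt : M.erase.cnt (.bound 0) = ((r.base.map fE).filter Entry.isZero).length := by
    rw [h.cnt, ← List.countP_eq_length_filter, List.countP_map]
    refine List.countP_congr fun e _ => ?_
    simp [Entry.isZero_iff, hb.name]
  unfold synthLam
  simp only [box_eq, hb.eq]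
  split
  · next x l hx =>
    have hxs : ∀ e ∈ x :: l, e.Fits X₁ V
        (LCtx.reshape (Name.cons (A, d) γ) (tyOf ρ (σ :: Δ))) ∧
        e.Avoids V (Name.cons (A, d) γ) ∧ e.name = .bound 0 ∧ e.ty.skel = σ := by
      intro e he
      rw [← hx, List.mem_filter, Entry.isZero_iff, List.mem_map] at he
      obtain ⟨⟨e, he, rfl⟩, hz⟩ := he
      refine ⟨(c6 e he).1, (c6 e he).2, hz, ?_⟩
      rw [hb.name] at hz
      rw [hb.skel_entry, h.base_skel e he, hz]
      rfl
    -- The bound variable has level `d` and occurs in the body, so no box can be left at the root of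
    -- the body.
    obtain rfl : o = 0 := by
      obtain ⟨f1, -, f3, -⟩ := hxs x (by simp)
      have := f1.1
      rw [f3, hz0] at this
      dsimp only at this
      omega
    have hinst : ∀ e ∈ x :: l, e.ty.inst X₁ = A.reshape σ := by
      intro e he
      obtain ⟨f1, -, f3, -⟩ := hxs e he
      unfold Entry.Fits at f1
      rw [f3, hz0] at f1
      have h0 : V.length - d = 0 := by omega
      simp only [h0, Nat.zero_sub] at f1
      exact f1.2.symm
    refine ⟨X₁, V, c1, by omega, ?_, ?_, fun e he => ⟨(fitRest e he).1, (fitRest e he).2.1⟩, ?_⟩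
    · intro sl hsl
      refine (c4 sl hsl).imp_left fun h1 => List.mem_filter.2 ⟨h1, ?_⟩
      rw [Bool.not_eq_true', ← Bool.not_eq_true, List.any_eq_true]
      rintro ⟨e, he, hocc⟩
      rw [hx] at he
      obtain ⟨-, f2, f3, -⟩ := hxs e he
      -- The level of the bound variable is the length of `V`, so avoidance covers every slice and
      -- the filter discards none of them.
      refine f2 sl ?_ hocc
      rw [f3]
      have h0 : V.length - (Name.cons (A, d) γ (.bound 0)).2 = 0 := by
        simp only [Name.cons_zero]; omega
      rw [h0]
      exact hsl
    · intro a ha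
      rw [List.mem_append] at ha
      rcases ha with ha | ha
      · rw [List.mem_map] at ha
        obtain ⟨a, ha', rfl⟩ := ha
        exact c5 a ha'
      · rw [hx, List.map_cons] at ha
        refine (contract_holdsIn (by
          intro Θ hΘ
          obtain ⟨e, he, rfl⟩ := List.mem_map.1 hΘ
          rw [(hxs e (by simp [he])).2.2.2, (hxs x (by simp)).2.2.2])).2 ⟨?_, ?_⟩ a ha
        · intro Θ hΘ
          obtain ⟨e, he, rfl⟩ := List.mem_map.1 hΘ
          rw [hinst e (by simp [he]), hinst x (by simp)]
        · intro hne
          rw [hinst x (by simp)]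
          refine (hm ?_).reshape σ
          rw [hcnt, hx]
          have : l ≠ [] := by simpa using hne
          have := List.length_pos_iff.2 this
          simp only [List.length_cons]
          omega
    · simp only [GTy.inst, sumOf_nil, Function.iterate_zero, id, Fm.reshape,
        hinst x (by simp), c7]
  · next hx =>
    obtain ⟨g1, g2, g3⟩ := general_spec σ m
    obtain ⟨X₂, l1, l2⟩ := general_inst X₁ σ m (A.reshape σ) (Fm.skel_reshape _ _)
    have hty := hb.below_ty _ h.ty_below
    split
    · next happ =>
      have h7 := c7
      rw [GTy.inst_eq] at h7
      obtain ⟨k, k1, k2⟩ := Fm.exists_of_iterate_eq (GTy.not_isBang_body X₁ (fT r.ty)) h7.symm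
      set p := (general σ m).2 with hp
      -- `k` is the exponent of the body that remains after its `o` boxes have been left.
      let X := Function.update X₂ p k
      have hX₂ : ∀ i < p, X i = X₂ i := fun i hi => Function.update_of_ne hi.ne _ _
      have hX₁ : ∀ i < m, X i = X₁ i := fun i hi => by rw [hX₂ i (by omega), l1 i hi]
      have hXp : X p = k := Function.update_self _ _ _
      have fresh : ∀ sl ∈ r.cpts, ¬ sl.hasRow (p + 1) = true := fun sl hsl h' => by
        have := h.cpt_row sl hsl _ h'
        have := hb.le
        omega
      refine ⟨X, exitSlices o (p + 1) (occs (((r.base.map fE).filter fun e => !e.isZero).map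
        Entry.down)) V, ?_, ?_, sliceOf_exitSlices c4 (.inr rfl), ?_, ?_, ?_⟩
      · intro i hi
        rw [hX₁ i (by omega), c1 i hi]
      · rw [length_exitSlices, c2]
      · intro a ha
        rw [List.mem_append] at ha
        rcases ha with ha | ha
        · rw [List.mem_map] at ha
          obtain ⟨a, ha', rfl⟩ := ha
          refine (Constraint.holdsIn_congr (hb.below_cons a (h.cons_below a ha')) hX₁
            fun q hq => ?_).2 (c5 a ha')
          rw [hb.row] at hq
          have := h.row a ha' q hq
          have := hb.le
          exact cntRow_exitSlices_of_ne (by omega)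
        · rw [List.mem_singleton] at ha
          subst ha
          simp only [Constraint.HoldsIn, Option.elim, cntRow_exitSlices_self c4 fresh, sumOf_cons,
            sumOf_nil, hXp, sumOf_congr hty.exps hX₁, k1, add_zero]
      · intro e he
        obtain ⟨f1, f2, f3, f4⟩ := fitRest e he
        exact ⟨(f1.congr f3 hX₁).exitSlices (List.mem_map_of_mem he), f2.exitSlices f4⟩
      · have hbody : (fT r.ty).body X = (fT r.ty).body X₁ := by
          have h1 := GTy.inst_congr hty hX₁
          rw [GTy.inst_eq, GTy.inst_eq, sumOf_congr hty.exps hX₁, Fm.bang_iterate_inj] at h1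
          exact h1
        simp only [GTy.inst, sumOf_nil, Function.iterate_zero, id, Fm.reshape, GTy.inst_setExps,
          sumOf_cons, hXp, add_zero, hbody, ← k2, GTy.inst_congr g2 hX₂, l2]
    · next happ =>
      obtain rfl : o = 0 := c3.resolve_right happ
      refine ⟨X₂, V, ?_, by omega, c4, ?_, ?_, ?_⟩
      · intro i hi
        rw [l1 i (by omega), c1 i hi]
      · intro a ha
        rw [List.mem_map] at ha
        obtain ⟨a, ha', rfl⟩ := ha
        exact (Constraint.holdsIn_congr (hb.below_cons a (h.cons_below a ha')) l1
          fun _ _ => rfl).2 (c5 a ha')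
      · intro e he
        obtain ⟨f1, f2, f3, -⟩ := fitRest e he
        exact ⟨f1.congr f3 l1, f2⟩
      · simp only [GTy.inst, sumOf_nil, Function.iterate_zero, id, Fm.reshape, l2,
          GTy.inst_congr hty l1, c7]

theorem synth_complete {ρ : ℕ → Ty} {Δ : List Ty} {D : CTm} {σ : Ty} (h : HasType ρ Δ D σ)
    (n : ℕ) : (synth ρ Δ D n).Complete D.erase (tyOf ρ Δ) σ n := by
  induction h generalizing n with
  | fvar Δ x => exact synthVar_complete (δ := tyOf ρ Δ) (.free x) n
  | @bvar Δ k σ h =>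
    have e : tyOf ρ Δ (.bound k) = σ := by simp [tyOf, List.getD, h]
    have h1 := synthVar_complete (δ := tyOf ρ Δ) (.bound k) n
    rw [e] at h1
    have h2 : synth ρ Δ (.bvar k) n = synthVar (.bound k) σ n := by
      rw [← e]
      rfl
    rw [h2]
    exact h1
  | lam h ih => exact synthLam_complete (synth_good h n) (ih n)
  | app hM hN ihM ihN =>
    exact synthApp_complete (synth_good hM n) (synth_good hN _) (ihM n) (ihN _)

/-! ### Substitution of formulas -/

theorem Fm.subst_iterate (S : ℕ → Fm) (k : ℕ) (A : Fm) :
    (Fm.bang^[k] A).subst S = Fm.bang^[k] (A.subst S) := by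
  induction k with
  | zero => rfl
  | succ k ih => rw [Function.iterate_succ_apply', Function.iterate_succ_apply', Fm.subst, ih]

theorem Fm.IsBang.subst {A : Fm} (h : A.IsBang) (S : ℕ → Fm) : (A.subst S).IsBang := by
  obtain ⟨B, rfl⟩ := h
  exact ⟨B.subst S, rfl⟩

/-- Typing with levels is closed under substitution of formulas for type variables. -/
theorem Leveled.substFm {γ γ' : LCtx} {r : ℕ} {M : Tm} {A : Fm} (h : Leveled γ r M A) (S : ℕ → Fm)
    (hγ : ∀ v, γ' v = ((γ v).1.subst S, (γ v).2)) : Leveled γ' r M (A.subst S) := by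
  induction h generalizing γ' with
  | var v hM hl hT =>
    refine .var v hM ?_ ?_
    · rw [hγ]; exact hl
    · simp only [hγ, hT, Fm.subst_iterate]
  | lam _ hm ih =>
    refine .lam (ih fun v => ?_) fun h2 => (hm h2).subst S
    rcases v.eq_zero_or_up with rfl | ⟨v, rfl⟩
    · simp
    · simp [hγ]
  | app _ _ ihM ihN => exact .app (ihM hγ) (ihN hγ)
  | enter _ ih => exact .enter (ih hγ)
  | exit _ hl ih =>
    refine .exit (ih hγ) fun v hv => ?_
    rw [hγ]
    exact hl v hv

/-! ### Simple types from formulas -/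

/-- An injective numbering of the formulas. -/
def Fm.code : Fm → ℕ
  | .var a => 3 * a
  | .limp A B => 3 * Nat.pair A.code B.code + 1
  | .bang A => 3 * A.code + 2

theorem Fm.code_injective : Function.Injective Fm.code := by
  intro A B h
  induction A generalizing B with
  | var a => cases B <;> simp only [Fm.code] at h <;> first | omega | (congr 1; omega)
  | limp A A' ih1 ih2 =>
    cases B with
    | limp B B' =>
      simp only [Fm.code] at h
      have := Nat.pair_eq_pair.1
        (show Nat.pair A.code A'.code = Nat.pair B.code B'.code by omega)
      rw [ih1 this.1, ih2 this.2]
    | _ => simp only [Fm.code] at h; omega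
  | bang A ih =>
    cases B with
    | bang B =>
      simp only [Fm.code] at h
      rw [ih (show A.code = B.code by omega)]
    | _ => simp only [Fm.code] at h; omega

/-- The simple type that is obtained from a formula by dropping the exponentials, as far as the
formula has the structure of the simple type `σ`; a part that stands for a type variable of `σ`
becomes a type variable of its own. -/
def Fm.expand : Fm → Ty → Ty
  | .bang A, σ => A.expand σ
  | .limp A B, .arr σ τ => .arr (A.expand σ) (B.expand τ)
  | .limp A B, .var _ => .var (Fm.limp A B).code
  | .var b, _ => .var (Fm.var b).code

theorem Fm.expand_iterate (k : ℕ) (A : Fm) (σ : Ty) :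
    (Fm.bang^[k] A).expand σ = A.expand σ := by
  induction k with
  | zero => rfl
  | succ k ih => rw [Function.iterate_succ_apply', Fm.expand, ih]

/-- A typing with levels of a simply typed term gives another simple typing. -/
theorem Leveled.exists_hasType {γ : LCtx} {r : ℕ} {M : Tm} {A : Fm} (h : Leveled γ r M A)
    {ρ : ℕ → Ty} {Δ : List Ty} {D : CTm} {σ : Ty} (hD : HasType ρ Δ D σ) (he : D.erase = M) :
    ∃ D' : CTm, D'.erase = M ∧ HasType (fun x => (γ (.free x)).1.expand (ρ x))
      (Δ.mapIdx fun k τ => (γ (.bound k)).1.expand τ) D' (A.expand σ) := by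
  induction h generalizing Δ D σ with
  | @var γ r M A v hM hl hT =>
    subst hM
    have key : ∀ τ, (γ v).1.expand τ = A.expand τ := fun τ => by rw [hT, Fm.expand_iterate]
    cases v with
    | free x =>
      cases hD <;> simp only [CTm.erase, Name.toTm] at he <;> try exact Tm.noConfusion he
      cases he
      exact ⟨.fvar x, rfl, key _ ▸ .fvar _ x⟩
    | bound k =>
      cases hD <;> simp only [CTm.erase, Name.toTm] at he <;> try exact Tm.noConfusion he
      next hk =>
      cases he
      exact ⟨.bvar k, rfl, .bvar (by simp [hk, key])⟩
  | lam _ hm ih =>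
    cases hD <;> simp only [CTm.erase] at he <;> try exact Tm.noConfusion he
    next hM =>
    cases he
    obtain ⟨D', h1, h2⟩ := ih hM rfl
    rw [List.mapIdx_cons] at h2
    exact ⟨.lam _ D', by simp [CTm.erase, h1], .lam h2⟩
  | app _ _ ihM ihN =>
    cases hD <;> simp only [CTm.erase] at he <;> try exact Tm.noConfusion he
    next hN hM =>
    cases he
    obtain ⟨D₁, h1, h2⟩ := ihM hM rfl
    obtain ⟨D₂, h3, h4⟩ := ihN hN rfl
    exact ⟨.app D₁ D₂, by simp [CTm.erase, h1, h3], .app h2 h4⟩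
  | enter _ ih => exact ih hD he
  | exit _ hl ih => exact ih hD he

instance : Nonempty Fm := ⟨.var 0⟩

/-- The formula substitution that undoes the coding in `Fm.expand`. -/
noncomputable def decode (s : ℕ → Ty) (a : ℕ) : Fm :=
  match s a with
  | .var c => Function.invFun Fm.code c
  -- A default value: `decode_eq` is applied only where `s a` is a coded variable.
  | .arr _ _ => .var 0

theorem decode_eq {s : ℕ → Ty} {a : ℕ} {A : Fm} (h : s a = .var A.code) : decode s a = A := by
  rw [decode, h]
  exact Function.leftInverse_invFun Fm.code_injective A

/-- Where `σ` has a type variable `a`, the formula is `!^k B` with `B` not banged: `reshape` keeps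
the `k` and `expand` records the code of `B`, so the value of `a` is recovered even if `k` varies
between occurrences of `a`. -/
theorem Fm.subst_decode_reshape {s : ℕ → Ty} {A : Fm} {σ : Ty} (h : σ.subst s = A.expand σ) :
    (A.reshape σ).subst (decode s) = A := by
  induction A generalizing σ with
  | var b =>
    cases σ with
    | var a => exact decode_eq h
    | arr σ τ => exact Ty.noConfusion h
  | limp A B ih1 ih2 =>
    cases σ with
    | var a => exact decode_eq h
    | arr σ τ =>
      simp only [Ty.subst, Fm.expand, Ty.arr.injEq] at h
      simp only [Fm.reshape, Fm.subst, ih1 h.1, ih2 h.2]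
  | bang A ih => simp only [Fm.reshape, Fm.subst, ih h]

/-! ### Correctness of type synthesis -/

theorem HasType.lt_of_cnt {ρ : ℕ → Ty} {Δ : List Ty} {D : CTm} {σ : Ty} (h : HasType ρ Δ D σ)
    {k : ℕ} (hk : D.erase.cnt (.bound k) ≠ 0) : k < Δ.length := by
  induction h generalizing k with
  | fvar Δ x => simp [CTm.erase, Tm.cnt] at hk
  | @bvar Δ j σ h =>
    have : k = j := by simpa [CTm.erase, Tm.cnt] using hk
    subst this
    exact (List.getElem?_eq_some_iff.1 h).1
  | lam _ ih => simpa using ih hk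
  | @app _ _ _ M N _ _ ihM ihN =>
    simp only [CTm.erase, Tm.cnt_app] at hk
    by_cases hM : M.erase.cnt (.bound k) = 0
    · exact ihN (by omega)
    · exact ihM hM

theorem HasType.lc {ρ : ℕ → Ty} {D : CTm} {σ : Ty} (h : HasType ρ [] D σ) : D.erase.LC :=
  fun k => by_contra fun hk => absurd (h.lt_of_cnt hk) (by simp)

theorem Name.free?_beq {v : Name} {x : ℕ} : (v.free? == some x) = true ↔ v = .free x := by
  cases v <;> simp [Name.free?]

theorem mem_freeNames {B : List Entry} {x : ℕ} :
    x ∈ freeNames B ↔ ∃ e ∈ B, e.name = .free x := by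
  simp only [freeNames, List.mem_dedup, List.mem_filterMap, ← Name.free?_beq, beq_iff_eq]

theorem mem_occTypes {B : List Entry} {x : ℕ} {Θ : GTy} :
    Θ ∈ occTypes B x ↔ ∃ e ∈ B, e.name = .free x ∧ e.ty = Θ := by
  simp only [occTypes, List.mem_map, List.mem_filter, Name.free?_beq, and_assoc]

theorem length_occTypes (B : List Entry) (x : ℕ) :
    (occTypes B x).length = B.countP fun e => decide (e.name = .free x) := by
  rw [occTypes, List.length_map, ← List.countP_eq_length_filter]
  exact List.countP_congr fun e _ => by rw [Name.free?_beq, decide_eq_true_iff]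

/-- Quantifying over the common type `T`, arbitrary for the empty list, treats variables that do not
occur uniformly with the others. -/
theorem contract_holds {X : ℕ → ℕ} {l : List GTy} {τ : Ty} (h : ∀ Θ ∈ l, Θ.skel = τ) :
    (∀ a ∈ contract l, a.Holds X) ↔
      ∃ T : Fm, (∀ Θ ∈ l, Θ.inst X = T) ∧ (2 ≤ l.length → T.IsBang) := by
  cases l with
  | nil => exact ⟨fun _ => ⟨.var 0, by simp, by simp⟩, fun _ => by simp [contract]⟩
  | cons Θ l =>
    have key := contract_holdsIn (X := X) (W := []) (Θ := Θ) (l := l) fun Θ' h' => by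
      rw [h Θ' (by simp [h']), h Θ (by simp)]
    simp only [Constraint.holdsIn_nil] at key
    have hl : l ≠ [] ↔ 2 ≤ (Θ :: l).length := by
      rw [← List.length_pos_iff, List.length_cons]; omega
    rw [key, hl]
    constructor
    · rintro ⟨h1, h2⟩
      exact ⟨Θ.inst X, by simpa using h1, h2⟩
    · rintro ⟨T, h1, h2⟩
      have h3 := h1 Θ (by simp)
      exact ⟨fun Θ' h' => by rw [h3, h1 Θ' (by simp [h'])], fun h => h3 ▸ h2 h⟩

theorem typeSynthesis_eq {ρ : ℕ → Ty} {D : CTm} {m : ℕ} {fE : Entry → Entry} {fT : GTy → GTy}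
    {fC : Constraint → Constraint}
    (hb : BoxSpec (boxCuts D (synth ρ [] D 0).cpts) (synth ρ [] D 0).next m fE fT fC) :
    typeSynthesis ρ D =
      (fT (synth ρ [] D 0).ty,
        (freeNames ((synth ρ [] D 0).base.map fE)).filterMap fun x =>
          (occTypes ((synth ρ [] D 0).base.map fE) x).head?.map fun Θ => (x, Θ),
        (synth ρ [] D 0).cons.map fC ++ (freeNames ((synth ρ [] D 0).base.map fE)).flatMap fun x =>
          contract (occTypes ((synth ρ [] D 0).base.map fE) x)) := by
  simp only [typeSynthesis, box_eq, hb.eq]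

/-- The constraints found by type synthesis, in terms of the types of the free variables. -/
theorem typeSynthesis_holds {ρ : ℕ → Ty} {D : CTm} {σ : Ty} (h : HasType ρ [] D σ) {m : ℕ}
    {fE : Entry → Entry} {fT : GTy → GTy} {fC : Constraint → Constraint}
    (hb : BoxSpec (boxCuts D (synth ρ [] D 0).cpts) (synth ρ [] D 0).next m fE fT fC)
    (X : ℕ → ℕ) :
    (∀ a ∈ (typeSynthesis ρ D).2.2, a.Holds X) ↔
      (∀ a ∈ (synth ρ [] D 0).cons, (fC a).Holds X) ∧
      ∃ T : ℕ → Fm,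
        (∀ x, ∀ e ∈ (synth ρ [] D 0).base, e.name = .free x → (fE e).ty.inst X = T x) ∧
        ∀ x, 2 ≤ D.erase.cnt (.free x) → (T x).IsBang := by
  have hg := synth_good h 0
  rw [typeSynthesis_eq hb]
  set r := synth ρ [] D 0
  have hmem : ∀ x Θ, Θ ∈ occTypes (r.base.map fE) x ↔
      ∃ e ∈ r.base, e.name = .free x ∧ (fE e).ty = Θ := by
    intro x Θ
    simp only [mem_occTypes, List.mem_map]
    constructor
    · rintro ⟨_, ⟨e, he, rfl⟩, h1, h2⟩
      exact ⟨e, he, by rw [← hb.name e, h1], h2⟩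
    · rintro ⟨e, he, h1, h2⟩
      exact ⟨fE e, ⟨e, he, rfl⟩, by rw [hb.name, h1], h2⟩
  have hlen : ∀ x, (occTypes (r.base.map fE) x).length = D.erase.cnt (.free x) := by
    intro x
    rw [length_occTypes, hg.cnt, List.countP_map]
    exact List.countP_congr fun e _ => by simp [hb.name]
  have hskel : ∀ x, ∀ Θ ∈ occTypes (r.base.map fE) x, Θ.skel = ρ x := by
    intro x Θ hΘ
    obtain ⟨e, he, h1, rfl⟩ := (hmem x Θ).1 hΘ
    rw [hb.skel_entry, hg.base_skel e he, h1, tyOf]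
  have hnames : (∀ x ∈ freeNames (r.base.map fE), ∀ a ∈ contract (occTypes (r.base.map fE) x),
      a.Holds X) ↔ ∀ x, ∀ a ∈ contract (occTypes (r.base.map fE) x), a.Holds X := by
    refine ⟨fun H x => ?_, fun H x _ => H x⟩
    by_cases hx : x ∈ freeNames (r.base.map fE)
    · exact H x hx
    · have : occTypes (r.base.map fE) x = [] := List.eq_nil_iff_forall_not_mem.2 fun Θ hΘ => by
        obtain ⟨e, he, h1, -⟩ := mem_occTypes.1 hΘ
        exact hx (mem_freeNames.2 ⟨e, he, h1⟩)
      simp [this, contract]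
  have hcontr : (∀ x, ∀ a ∈ contract (occTypes (r.base.map fE) x), a.Holds X) ↔
      ∃ T : ℕ → Fm, (∀ x, ∀ e ∈ r.base, e.name = .free x → (fE e).ty.inst X = T x) ∧
        ∀ x, 2 ≤ D.erase.cnt (.free x) → (T x).IsBang := by
    rw [forall_congr' fun x => contract_holds (hskel x), Classical.skolem]
    simp only [hlen, hmem, forall_and]
    refine exists_congr fun T => and_congr_left fun _ => forall_congr' fun x => ?_
    exact ⟨fun H e he h1 => H _ ⟨e, he, h1, rfl⟩, fun H Θ ⟨e, he, h1, h2⟩ => h2 ▸ H e he h1⟩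
  rw [← hcontr, ← hnames]
  simp only [List.mem_append, List.mem_map, List.mem_flatMap]
  constructor
  · exact fun H => ⟨fun a ha => H _ (.inl ⟨a, ha, rfl⟩), fun x hx a ha => H a (.inr ⟨x, hx, ha⟩)⟩
  · rintro ⟨H1, H2⟩ a (⟨a, ha, rfl⟩ | ⟨x, hx, ha⟩)
    · exact H1 a ha
    · exact H2 x hx a ha

/-- The declarations found by type synthesis, in terms of the types of the free variables. -/
theorem typeSynthesis_base {ρ : ℕ → Ty} {D : CTm} {σ : Ty} (h : HasType ρ [] D σ) {m : ℕ}
    {fE : Entry → Entry} {fT : GTy → GTy} {fC : Constraint → Constraint}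
    (hb : BoxSpec (boxCuts D (synth ρ [] D 0).cpts) (synth ρ [] D 0).next m fE fT fC)
    {X : ℕ → ℕ} {T : ℕ → Fm}
    (hT : ∀ x, ∀ e ∈ (synth ρ [] D 0).base, e.name = .free x → (fE e).ty.inst X = T x)
    (P : ℕ → Fm → Prop) :
    (∀ p ∈ (typeSynthesis ρ D).2.1, P p.1 (p.2.inst X)) ↔
      ∀ x, D.erase.cnt (.free x) ≠ 0 → P x (T x) := by
  have hg := synth_good h 0
  rw [typeSynthesis_eq hb]
  set r := synth ρ [] D 0
  have hT' : ∀ x, ∀ Θ ∈ occTypes (r.base.map fE) x, Θ.inst X = T x := by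
    intro x Θ hΘ
    obtain ⟨e, he, h1, rfl⟩ := mem_occTypes.1 hΘ
    obtain ⟨e, he', rfl⟩ := List.mem_map.1 he
    exact hT x e he' (by rw [← hb.name e, h1])
  have hcnt : ∀ x, D.erase.cnt (.free x) ≠ 0 ↔ ∃ e ∈ r.base, e.name = .free x := by
    intro x
    rw [hg.cnt, ← Nat.pos_iff_ne_zero, List.countP_pos_iff]
    simp only [decide_eq_true_iff]
  have hne : ∀ x, x ∈ freeNames (r.base.map fE) ↔ D.erase.cnt (.free x) ≠ 0 := by
    intro x
    rw [hcnt, mem_freeNames]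
    simp only [List.mem_map, exists_exists_and_eq_and, hb.name]
  simp only [List.mem_filterMap]
  constructor
  · intro H x hx
    obtain ⟨e, he, h1⟩ := mem_freeNames.1 ((hne x).2 hx)
    have hmem : e.ty ∈ occTypes (r.base.map fE) x := mem_occTypes.2 ⟨e, he, h1, rfl⟩
    cases hl : occTypes (r.base.map fE) x with
    | nil => rw [hl] at hmem; simp at hmem
    | cons Θ l =>
      have := H (x, Θ) ⟨x, (hne x).2 hx, by rw [hl]; rfl⟩
      rwa [hT' x Θ (by rw [hl]; simp)] at this
  · rintro H p ⟨x, hx, hp⟩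
    obtain ⟨Θ, hΘ, rfl⟩ := Option.map_eq_some_iff.1 hp
    simp only [hT' x Θ (List.mem_of_head? hΘ)]
    exact H x ((hne x).1 hx)

/-- At the root no box is open and all free variables have level `0`, so soundness applies with `W =
[]`; the substitution `S` acts on the typing with levels. -/
theorem typed_of_typeSynthesis {M : Tm} {ρ : ℕ → Ty} {σ : Ty} {D : CTm}
    (hD : IsSimpleDerivation ρ D M σ) {Γ : Basis} (hΓ : Γ.Linear) {X : ℕ → ℕ}
    (hA : ∀ a ∈ (typeSynthesis ρ D).2.2, a.Holds X) {S : ℕ → Fm}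
    (hB : ∀ p ∈ (typeSynthesis ρ D).2.1, (p.1, (p.2.inst X).subst S) ∈ Γ) :
    Typed Γ M (((typeSynthesis ρ D).1.inst X).subst S) := by
  obtain ⟨rfl, hD⟩ := hD
  have hg := synth_good hD 0
  obtain ⟨m, fE, fT, fC, hb⟩ := exists_boxSpec (boxCuts D (synth ρ [] D 0).cpts)
    (synth ρ [] D 0).next
  obtain ⟨hc, T, hT, hm⟩ := (typeSynthesis_holds hD hb X).1 hA
  have hB' := (typeSynthesis_base hD hb hT fun x A => (x, A.subst S) ∈ Γ).1 hB
  let γ : LCtx := fun v => match v with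
    | .free x => (T x, 0)
    | .bound _ => (.var 0, 0)
  have hbound : ∀ e ∈ (synth ρ [] D 0).base, ∃ x, e.name = .free x := by
    intro e he
    cases hn : e.name with
    | free x => exact ⟨x, rfl⟩
    | bound k =>
      have h0 := hD.lc k
      rw [hg.cnt, List.countP_eq_zero] at h0
      exact absurd (by simpa using hn) (h0 e he)
  have h1 := (synth_sound hD 0).box hb (X := X) (W := []) (γ := γ) (fun sl hsl => by simp at hsl)
    (fun a ha => (Constraint.holdsIn_nil).2 (hc a ha)) (fun e he => by
      obtain ⟨x, hx⟩ := hbound e he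
      simp only [Entry.Fits, hb.name, hx, γ]
      exact ⟨by simp [cntOcc], by simp [hT x e he hx]⟩)
  rw [typeSynthesis_eq hb]
  refine Leveled.typed (h1.substFm S fun v => rfl) hD.lc hΓ (fun x hx => ⟨rfl, hB' x hx⟩)
    fun x hx => (hm x hx).subst S

theorem typeSynthesis_of_typed {M : Tm} {ρ : ℕ → Ty} {σ : Ty} (hσ : IsPrincipal M ρ σ) {D : CTm}
    (hD : IsSimpleDerivation ρ D M σ) {Γ : Basis} {C : Fm} (h : Typed Γ M C) :
    ∃ X : ℕ → ℕ, (∀ a ∈ (typeSynthesis ρ D).2.2, a.Holds X) ∧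
      ∃ S : ℕ → Fm, (∀ p ∈ (typeSynthesis ρ D).2.1, (p.1, (p.2.inst X).subst S) ∈ Γ) ∧
        ((typeSynthesis ρ D).1.inst X).subst S = C := by
  classical
  obtain ⟨rfl, hD⟩ := hD
  obtain ⟨G, hS, hG⟩ := h
  have hU : ∀ x, ∃ U : Fm, ∀ A, (x, A) ∈ Γ → A = U := by
    intro x
    by_cases hx : ∃ A, (x, A) ∈ Γ
    · obtain ⟨U, hU⟩ := hx
      refine ⟨U, fun A hA => ?_⟩
      have := Multiset.inj_on_of_nodup_map hS.linear _ hA _ hU rfl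
      exact congrArg Prod.snd this
    · exact ⟨.var 0, fun A hA => absurd ⟨A, hA⟩ hx⟩
  choose U hU using hU
  let γ : LCtx := fun v => match v with
    | .free x => (U x, 0)
    | .bound _ => (.var 0, 0)
  have hγ : ∀ v, (γ v).2 = 0 := fun v => by cases v <;> rfl
  have hdecl : ∀ x, D.erase.cnt (.free x) ≠ 0 → (x, U x) ∈ Γ := by
    intro x hx
    obtain ⟨A, hA⟩ := Basis.mem_dom.1 (hS.mem_dom_of_cnt hx)
    exact hU x A hA ▸ hA
  obtain ⟨hL, hm⟩ := hS.leveled hG (γ := γ) fun p hp => by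
    simp only [γ, hU p.1 p.2 hp]
  obtain ⟨m, fE, fT, fC, hb⟩ := exists_boxSpec (boxCuts D (synth ρ [] D 0).cpts)
    (synth ρ [] D 0).next
  obtain ⟨X, V, o, -, c2, -, -, c5, c6, c7⟩ := (synth_complete hD 0).box (synth_good hD 0) hb
    (fun _ => 0) hL fun v _ => (hγ v).le
  obtain rfl : V = [] := List.length_eq_zero_iff.1 (by omega)
  obtain rfl : o = 0 := by simpa using c2.symm
  have hT : ∀ x, ∀ e ∈ (synth ρ [] D 0).base, e.name = .free x →
      (fE e).ty.inst X = (U x).reshape (ρ x) := by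
    intro x e he hx
    have := (c6 e he).1.2
    simpa [LCtx.reshape, hb.name, hx, tyOf, γ] using this.symm
  -- Principality is used only for this coded simple typing; the instance it yields is decoded into
  -- the substitution of formulas.
  obtain ⟨D', h1, h2⟩ := hL.exists_hasType hD rfl
  obtain ⟨s, s1, s2⟩ := hσ.2 _ _ D' ⟨h1, h2⟩
  refine ⟨X, (typeSynthesis_holds hD hb X).2
    ⟨fun a ha => Constraint.holdsIn_nil.1 (c5 a ha), fun x => (U x).reshape (ρ x), hT,
      fun x hx => ?_⟩, decode s, ?_, ?_⟩
  · exact (hm (x, U x) (hdecl x (by omega)) hx).reshape _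
  · refine (typeSynthesis_base hD hb hT fun x A => (x, A.subst (decode s)) ∈ Γ).2 fun x hx => ?_
    rw [Fm.subst_decode_reshape (s2 x (Tm.mem_fv.2 hx))]
    exact hdecl x hx
  · rw [typeSynthesis_eq hb]
    simp only [c7, Function.iterate_zero, id]
    exact Fm.subst_decode_reshape s1

end EAL

/-! ### Soundness and completeness of type synthesis combined -/

theorem mainTheorem3 (M : EAL.Tm) (ρ : ℕ → EAL.Ty) (σ : EAL.Ty) (hσ : EAL.IsPrincipal M ρ σ)
    (D : EAL.CTm) (hD : EAL.IsSimpleDerivation ρ D M σ)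
    (Γ : EAL.Basis) (hΓ : Γ.Linear) (C : EAL.Fm) :
    EAL.Typed Γ M C ↔
      ∃ (Θ : EAL.GTy) (B : List (ℕ × EAL.GTy)) (A : List EAL.Constraint),
        EAL.typeSynthesis ρ D = (Θ, B, A) ∧
        ∃ X : ℕ → ℕ, (∀ a ∈ A, a.Holds X) ∧
          ∃ S : ℕ → EAL.Fm,
            (∀ p ∈ B, (p.1, (p.2.inst X).subst S) ∈ Γ) ∧ (Θ.inst X).subst S = C := by
  constructor
  · exact fun h => ⟨_, _, _, rfl, EAL.typeSynthesis_of_typed hσ hD h⟩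
  · rintro ⟨Θ, B, A, h, X, hA, S, hB, rfl⟩
    have := EAL.typed_of_typeSynthesis hD hΓ (X := X) (by rw [h]; exact hA) (S := S)
      (by rw [h]; exact hB)
    rwa [h] at this
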